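/- Let $\Delta^\vee\subset\mathbb R^d$ be a reflexive polytope: the convex hull of finitely many points of $\mathbb Z^d$, with the origin in its interior, such that the vertices of the dual polytope $\Delta=\{m\in(\mathbb R^d)^*:\langle m,n\rangle\le 1\ \forall n\in\Delta^\vee\}$ lie in the dual lattice $(\mathbb Z^d)^*$. Let $\lambda\in\mathbb Z^{\Delta\cap(\mathbb Z^d)^*}$ and $\nu\in\mathbb Z^{\Delta^\vee\cap\mathbb Z^d}$ be generic heights inducing (through their upper, concave envelopes) central coherent triangulations of $\Delta$ and $\Delta^\vee$. Here generic means that the lattice points at which an affine function $\ge\lambda$ (resp. $\ge\nu$) attains equality are always affinely independent, and central means that every maximal simplex has the origin as a vertex. Let $S$ and $T$ be the triangulations of $\partial\Delta$ and $\partial\Delta^\vee$ obtained by restriction, let $\operatorname{bsd}(S)$ be the barycentric subdivision of $S$, and put $$\Delta^\vee_\lambda=\{n\in\mathbb R^d:\langle m,n\rangle\le\lambda(0)-\lambda(m)\ \forall m\in\Delta\cap(\mathbb Z^d)^*\},\qquad |\Sigma|=\{(m,n)\in\Delta\times\Delta^\vee:\langle m,n\rangle=1\}.$$ The coherent subdivision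 of a polytope $Q$ given by a piecewise linear concave function $f$ on $Q$ (a minimum of finitely many affine functions) has as cells the nonempty sets $\{x\in Q: f(x)=\ell(x)\}$ with $\ell$ affine and $\ell\ge f$ on $Q$; the cells contained in $\partial Q$ form the induced coherent subdivision of $\partial Q$. The restriction of $\operatorname{bsd}(S)\times T$ to $|\Sigma|$ consists of its cells contained in $|\Sigma|$. Two subdivisions are combinatorially isomorphic if their posets of nonempty cells, ordered by inclusion, are isomorphic. **Lemma.** There is a coherent subdivision of $\partial\Delta^\vee_\lambda$ which is combinatorially isomorphic to the restriction to $|\Sigma|$ of the product subdivision $\operatorname{bsd}(S)\times T$. More precisely, for a nonempty face $F$ of $\Delta^\vee_\lambda$ let $\kappa(F)$ be the face of $\Delta^\vee$ on which the linear functions that are maximal over $\Delta^\vee_\lambda$ precisely on $F$ attain their maximum over $\Delta^\vee$. Choose $\varepsilon>0$, points $\widehat F$ for the nonempty faces $F$ of $\Delta^\vee_\lambda$, and points $\widehat G\in G$ for the nonempty faces $G$ of $\Delta^\vee$, such that each small copy $\widehat F+\varepsilon(\kappa(F)-\widehat{\kappa(F)})$ lies in the relative interior of $F$. Such choices exist.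 For every such choice, let $\operatorname{bsd}(\Delta^\vee_\lambda;\Delta^\vee)$ be the complex with cells $$\operatorname{conv}_i\bigl(\widehat F_i-\varepsilon\widehat{\kappa(F_i)}\bigr)+\varepsilon G$$ for the chains $F_0\prec\dots\prec F_r$ of nonempty faces of $\Delta^\vee_\lambda$ and the nonempty faces $G$ of $\kappa(F_0)$. Let $\tilde\nu$ be the function on $\Delta^\vee_\lambda$ that takes the value $\hat\nu(g)$ at each point $x+\varepsilon g$ of such a cell, with $x\in\operatorname{conv}_i(\widehat F_i-\varepsilon\widehat{\kappa(F_i)})$ and $g\in G$, where $\hat\nu$ is the concave piecewise linear function on $\Delta^\vee$ induced by $\nu$. Then: 1. There is a piecewise linear concave function $\psi$ on $\Delta^\vee_\lambda$ whose coherent subdivision is $\operatorname{bsd}(\Delta^\vee_\lambda;\Delta^\vee)$. 2. For every such $\psi$ there is $N_0$ such that, for all real $N\ge N_0$, the function $N\psi+\tilde\nu$ is concave and piecewise linear on $\Delta^\vee_\lambda$, and the coherent subdivision of $\partial\Delta^\vee_\lambda$ it induces is combinatorially isomorphic to the restriction of $\operatorname{bsd}(S)\times T$ to $|\Sigma|$.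 -/

import Mathlib

open scoped Pointwise

noncomputable section

namespace MixSubdiv

/-- The inclusion of the lattice `ℤ^d` in `ℝ^d`. The dual space is identified with `ℝ^d`, and the
dual lattice with `ℤ^d`, through the dot product. -/
def toReal {d : ℕ} (z : Fin d → ℤ) : Fin d → ℝ := fun i => (z i : ℝ)

/-- The dual polytope `{m : ⟨m, n⟩ ≤ 1 for all n ∈ P}`. -/
def dualPolytope {d : ℕ} (P : Set (Fin d → ℝ)) : Set (Fin d → ℝ) :=
  {m | ∀ n ∈ P, m ⬝ᵥ n ≤ 1}

/-- A lattice polytope with the origin in its interior, all of whose dual vertices are lattice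
points. -/
structure IsReflexive {d : ℕ} (P : Set (Fin d → ℝ)) : Prop where
  isLatticePolytope : ∃ A : Finset (Fin d → ℤ), P = convexHull ℝ (toReal '' (A : Set (Fin d → ℤ)))
  zero_mem_interior : (0 : Fin d → ℝ) ∈ interior P
  dual_vertices : (dualPolytope P).extremePoints ℝ ⊆ Set.range toReal

/-! ### Coherent triangulations given by heights on lattice points -/

/-- `σ` is (the set of marked points of) a cell of the coherent subdivision of `P` induced by the
heights `w` on the lattice points of `P`: some affine function is at least `w` on all
lattice points of `P`, with equality exactly on the nonempty set `σ`. -/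
def IsHeightCell {d : ℕ} (P : Set (Fin d → ℝ)) (w : (Fin d → ℤ) → ℤ)
    (σ : Finset (Fin d → ℤ)) : Prop :=
  σ.Nonempty ∧ ∃ (u : Fin d → ℝ) (c : ℝ),
    (∀ z, toReal z ∈ P → (w z : ℝ) ≤ u ⬝ᵥ toReal z + c) ∧
    ∀ z, z ∈ σ ↔ toReal z ∈ P ∧ (w z : ℝ) = u ⬝ᵥ toReal z + c

/-- The heights `w` are generic enough to induce a triangulation of `P` (every cell is a simplex on
its marked points), and the triangulation is central: its maximal simplices contain the origin as
a vertex. -/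
structure InducesCentralTriangulation {d : ℕ} (P : Set (Fin d → ℝ))
    (w : (Fin d → ℤ) → ℤ) : Prop where
  isTriangulation : ∀ σ, IsHeightCell P w σ →
    AffineIndependent ℝ (fun z : σ => toReal (z : Fin d → ℤ))
  isCentral : ∀ σ, IsHeightCell P w σ → ∃ σ', IsHeightCell P w σ' ∧ σ ⊆ σ' ∧ 0 ∈ σ'

/-- The simplex with vertex set `σ`. -/
def simplex {d : ℕ} (σ : Finset (Fin d → ℤ)) : Set (Fin d → ℝ) :=
  convexHull ℝ (toReal '' (σ : Set (Fin d → ℤ)))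

/-- The nonempty simplices (as vertex sets) of the induced triangulation of the boundary of `P`. -/
def boundaryTriangulation {d : ℕ} (P : Set (Fin d → ℝ)) (w : (Fin d → ℤ) → ℤ) :
    Set (Finset (Fin d → ℤ)) :=
  {σ | IsHeightCell P w σ ∧ simplex σ ⊆ frontier P}

/-- The polytope `{n : ⟨m, n⟩ ≤ w(0) - w(m) for all lattice points m of P}`. -/
def heightPolytope {d : ℕ} (P : Set (Fin d → ℝ)) (w : (Fin d → ℤ) → ℤ) : Set (Fin d → ℝ) :=
  {n | ∀ z, toReal z ∈ P → toReal z ⬝ᵥ n ≤ (w 0 : ℝ) - (w z : ℝ)}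

/-- The concave piecewise linear function on `P` induced by the heights `w`: the smallest concave
function that is at least `w` on the lattice points of `P`, as the lower envelope of the affine
functions with that property. It interpolates `w` on the simplices of the triangulation. -/
def heightFun {d : ℕ} (P : Set (Fin d → ℝ)) (w : (Fin d → ℤ) → ℤ) (x : Fin d → ℝ) : ℝ :=
  sInf {t | ∃ (u : Fin d → ℝ) (c : ℝ),
    (∀ z, toReal z ∈ P → (w z : ℝ) ≤ u ⬝ᵥ toReal z + c) ∧ t = u ⬝ᵥ x + c}

/-! ### The restriction of `bsd(S) × T` to `|Σ|` -/

/-- The barycenter of the simplex with vertex set `σ`. -/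
def barycenter {d : ℕ} (σ : Finset (Fin d → ℤ)) : Fin d → ℝ :=
  (σ.card : ℝ)⁻¹ • ∑ z ∈ σ, toReal z

/-- The closed simplices of the barycentric subdivision of the simplicial complex `S`: one for each
nonempty chain of simplices of `S`. -/
def bsdSimplices {d : ℕ} (S : Set (Finset (Fin d → ℤ))) : Set (Set (Fin d → ℝ)) :=
  {X | ∃ c : Set (Finset (Fin d → ℤ)), c.Nonempty ∧ c ⊆ S ∧ IsChain (· ⊆ ·) c ∧
    X = convexHull ℝ (barycenter '' c)}

/-- `|Σ|`: the pairs `(m, n)` in `P^∨ × P` with `⟨m, n⟩ = 1`. -/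
def sigmaSpace {d : ℕ} (P : Set (Fin d → ℝ)) : Set ((Fin d → ℝ) × (Fin d → ℝ)) :=
  {p | p.1 ∈ dualPolytope P ∧ p.2 ∈ P ∧ p.1 ⬝ᵥ p.2 = 1}

/-- The nonempty cells of the product subdivision `bsd(S) × T` that lie in `|Σ|`, where `S` and `T`
are the boundary triangulations induced by `lam` (on the dual of `P`) and `nu` (on `P`). -/
def restrictedProductCells {d : ℕ} (P : Set (Fin d → ℝ)) (lam nu : (Fin d → ℤ) → ℤ) :
    Set (Set ((Fin d → ℝ) × (Fin d → ℝ))) :=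
  {Y | (∃ X ∈ bsdSimplices (boundaryTriangulation (dualPolytope P) lam),
      ∃ τ ∈ boundaryTriangulation P nu, Y = X ×ˢ simplex τ) ∧ Y ⊆ sigmaSpace P}

/-! ### Coherent subdivisions given by concave functions -/

/-- On `Q`, the function `f` is concave and piecewise linear, i.e. it is the minimum of finitely
many affine functions. -/
def IsPLConcaveOn {d : ℕ} (Q : Set (Fin d → ℝ)) (f : (Fin d → ℝ) → ℝ) : Prop :=
  ∃ (L : Finset ((Fin d → ℝ) × ℝ)) (h : L.Nonempty),
    ∀ x ∈ Q, f x = L.inf' h (fun p => p.1 ⬝ᵥ x + p.2)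

/-- The nonempty cells of the coherent subdivision of `Q` induced by a concave piecewise linear
function `f`: the maximal domains of linearity and their faces. They are the sets where
an affine function that is at least `f` on `Q` agrees with `f`. -/
def coherentCells {d : ℕ} (Q : Set (Fin d → ℝ)) (f : (Fin d → ℝ) → ℝ) :
    Set (Set (Fin d → ℝ)) :=
  {X | X.Nonempty ∧ ∃ (u : Fin d → ℝ) (c : ℝ),
    (∀ x ∈ Q, f x ≤ u ⬝ᵥ x + c) ∧ X = {x | x ∈ Q ∧ f x = u ⬝ᵥ x + c}}

/-- The induced coherent subdivision of the boundary of `Q`. -/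
def boundaryCoherentCells {d : ℕ} (Q : Set (Fin d → ℝ)) (f : (Fin d → ℝ) → ℝ) :
    Set (Set (Fin d → ℝ)) :=
  {X | X ∈ coherentCells Q f ∧ X ⊆ frontier Q}

/-- Two families of cells are combinatorially isomorphic: their posets under inclusion are
isomorphic. -/
def CombIso {α β : Type*} (A : Set (Set α)) (B : Set (Set β)) : Prop :=
  Nonempty (A ≃o B)

/-! ### The barycentric subdivision of `Q` with respect to a Minkowski summand `P` -/

/-- The face of `Q` on which the linear function `⟨u, ·⟩` is maximal. -/
def maxFace {d : ℕ} (Q : Set (Fin d → ℝ)) (u : Fin d → ℝ) : Set (Fin d → ℝ) :=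
  {x | x ∈ Q ∧ ∀ y ∈ Q, u ⬝ᵥ y ≤ u ⬝ᵥ x}

/-- The nonempty faces of the polytope `Q` (with `Q` itself, for `u = 0`). -/
def IsFace {d : ℕ} (Q F : Set (Fin d → ℝ)) : Prop :=
  F.Nonempty ∧ ∃ u, F = maxFace Q u

/-- The correspondence `κ` from faces of `Q` to faces of `P`, for a Minkowski summand `P` of `Q`:
every linear function that is maximal over `Q` precisely on `F` is maximal over `P`
precisely on `κ(F)`. -/
def kappa {d : ℕ} (Q P F : Set (Fin d → ℝ)) : Set (Fin d → ℝ) :=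
  {x | x ∈ P ∧ ∀ u, maxFace Q u = F → x ∈ maxFace P u}

/-- The choices in the barycentric subdivision of `Q` with respect to `P`: a scale `ε > 0`
and centers of the faces of `Q` and `P`, such that for each face `F` of `Q` the small copy of
`κ(F)` at the center of `F` lies in the relative interior of `F`. -/
structure Placement {d : ℕ} (Q P : Set (Fin d → ℝ)) where
  eps : ℝ
  eps_pos : 0 < eps
  centerQ : Set (Fin d → ℝ) → (Fin d → ℝ)
  centerP : Set (Fin d → ℝ) → (Fin d → ℝ)
  centerP_mem : ∀ G, IsFace P G → centerP G ∈ G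
  copy_subset : ∀ F, IsFace Q F → ∀ g ∈ kappa Q P F,
    centerQ F + eps • (g - centerP (kappa Q P F)) ∈ intrinsicInterior ℝ F

/-- The translation vector `center(F) - ε center(κ(F))` of the small copy of `κ(F)` in `F`. -/
def Placement.shift {d : ℕ} {Q P : Set (Fin d → ℝ)} (r : Placement Q P)
    (F : Set (Fin d → ℝ)) : Fin d → ℝ :=
  r.centerQ F - r.eps • r.centerP (kappa Q P F)

/-- The index set of the cells: pairs of a nonempty chain `C = (F_0 ≺ ⋯ ≺ F_r)` of faces of `Q`
and a face `G` of `P` that is a face of `κ(F_0)` (equivalently, since `κ` preserves the order,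
of every `κ(F_i)`). -/
def IsBsdIndex {d : ℕ} (Q P : Set (Fin d → ℝ)) (C : Set (Set (Fin d → ℝ)))
    (G : Set (Fin d → ℝ)) : Prop :=
  C.Nonempty ∧ (∀ F ∈ C, IsFace Q F) ∧ IsChain (· ⊆ ·) C ∧
    IsFace P G ∧ ∀ F ∈ C, G ⊆ kappa Q P F

/-- The nonempty cells of `bsd(Q; P)`: for each index `(F_0 ≺ ⋯ ≺ F_r, G)` the convex hull of the
small copies of `G` within the `F_i`. -/
def bsdCells {d : ℕ} {Q P : Set (Fin d → ℝ)} (r : Placement Q P) : Set (Set (Fin d → ℝ)) :=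
  {X | ∃ C G, IsBsdIndex Q P C G ∧ X = convexHull ℝ (r.shift '' C) + r.eps • G}

/-- `ψ` is a concave piecewise linear function on `Q` whose domains of linearity are
given by `bsd(Q; P)`. -/
def IsAdapted {d : ℕ} {Q P : Set (Fin d → ℝ)} (r : Placement Q P)
    (ψ : (Fin d → ℝ) → ℝ) : Prop :=
  IsPLConcaveOn Q ψ ∧ coherentCells Q ψ = bsdCells r

/-- The piecewise linear function on `Q` induced by a function `h` on `P`: on the cell
`conv(shift F_i) + ε G` it is `h` in the direction of `G` and constant in the direction of the
`F_i`, i.e. it takes the value `h g` at `x + ε g`. At each point of `Q` the set below has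
exactly one element, and `sSup` picks it. -/
def tildeFun {d : ℕ} {Q P : Set (Fin d → ℝ)} (r : Placement Q P) (h : (Fin d → ℝ) → ℝ)
    (y : Fin d → ℝ) : ℝ :=
  sSup {t | ∃ C G, IsBsdIndex Q P C G ∧ ∃ x ∈ convexHull ℝ (r.shift '' C), ∃ g ∈ G,
    y = x + r.eps • g ∧ t = h g}

end MixSubdiv

end

/-! Write `Q` for the height polytope and `P` for the reflexive polytope. A face of `Q` is recorded
by the set `σ` of inequalities tight in its relative interior, so larger faces have smaller `σ` and
`∅` stands for `Q` itself. Genericity and centrality make the tight normals at each point linearly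
independent and give a point `x ∈ P` with `⟨z, x⟩ = 1` for all of them (`exists_common_facet`).
Hence the nonempty `σ` are exactly the simplices of `S` (`exists_setup`), and `κ` sends the face of
`σ` to `kap σ = {x ∈ P : ⟨z, x⟩ = 1 for z ∈ σ}` (`kappa_face`). A product of the simplex of a chain
`C` in `bsd(S)` with `τ ∈ T` lies in `|Σ|` exactly when `τ` lies in `kap σ` for all `σ ∈ C`. So both
posets are indexed by the same pairs `(C, τ)`, ordered by inclusion, once the coherent cells of `N ψ
+ ν̃` are known to be the sets `cell C τ`; the boundary cells are those with `∅ ∉ C`.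

Three facts give those cells. A point of `Q` has at most one representation over a chain
(`rep_unique`), by comparing the slack of one well-chosen inequality. Lift the marked points `pt (σ,
t)`, with `t` a lattice point of `kap σ`, to the heights `δ ^ |σ|`: for small `δ` a supporting
affine function touches only mutually compatible marked points (`eventually_compatible`), because
larger faces are lifted far higher. Hence the cells cover `Q`, and each coarse cell, where `τ` is a
whole face, is exposed (`exists_affine_cell`); the minimum of the exposing functions is a possible
`ψ`. Finally, affine functions on a cell can be prescribed separately along the chain and along `P`
(`exists_affine`). So a supporting function of `ν` on `τ` can be added to `N` times one of `ψ`, and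
for large `N` the sum stays above all heights (`eventually_coherentCells`).

`coherent_of_supporting` turns such supporting data at the marked points into a description of all
coherent cells. -/

namespace MixSubdiv

/-! ### Convex weights -/

/-- `w` is a system of convex weights supported on the finite set `I`. -/
structure IsWt {α : Type*} (I : Finset α) (w : α → ℝ) : Prop where
  nonneg : ∀ i, 0 ≤ w i
  supp : ∀ i, i ∉ I → w i = 0
  sum_eq : ∑ i ∈ I, w i = 1

namespace IsWt

variable {α : Type*} {I J : Finset α} {w : α → ℝ}

lemma mem_of_pos (hw : IsWt I w) {i : α} (hi : 0 < w i) : i ∈ I := by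
  by_contra h
  exact hi.ne' (hw.supp i h)

lemma exists_pos (hw : IsWt I w) : ∃ i ∈ I, 0 < w i := by
  by_contra! h
  have := Finset.sum_nonpos h
  linarith [hw.sum_eq]

lemma sum_smul_eq {M : Type*} [AddCommGroup M] [Module ℝ M] (hw : IsWt I w) (hIJ : I ⊆ J)
    (v : α → M) : ∑ i ∈ J, w i • v i = ∑ i ∈ I, w i • v i :=
  (Finset.sum_subset hIJ fun i _ hi => by rw [hw.supp i hi, zero_smul]).symm

lemma mono (hw : IsWt I w) (hIJ : I ⊆ J) : IsWt J w where
  nonneg := hw.nonneg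
  supp i hi := hw.supp i fun h => hi (hIJ h)
  sum_eq := by
    rw [← Finset.sum_subset hIJ fun i _ hi => hw.supp i hi]
    exact hw.sum_eq

lemma restrict (hw : IsWt I w) (h : ∀ i, 0 < w i → i ∈ J) : IsWt J w where
  nonneg := hw.nonneg
  supp i hi := by
    by_contra h0
    exact hi (h i (lt_of_le_of_ne (hw.nonneg i) (Ne.symm h0)))
  sum_eq := by
    classical
    have h1 : ∑ i ∈ I ∪ J, w i = ∑ i ∈ J, w i := by
      refine (Finset.sum_subset Finset.subset_union_right fun i _ hi => ?_).symm
      by_contra h0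
      exact hi (h i (lt_of_le_of_ne (hw.nonneg i) (Ne.symm h0)))
    have h2 : ∑ i ∈ I ∪ J, w i = ∑ i ∈ I, w i :=
      (Finset.sum_subset Finset.subset_union_left fun i _ hi => hw.supp i hi).symm
    rw [← h1, h2, hw.sum_eq]

lemma sum_smul_restrict {M : Type*} [AddCommGroup M] [Module ℝ M] (hw : IsWt I w)
    (hw' : IsWt J w) (v : α → M) : ∑ i ∈ I, w i • v i = ∑ i ∈ J, w i • v i := by
  classical
  rw [← hw.sum_smul_eq (Finset.subset_union_left (s₂ := J)),
    ← hw'.sum_smul_eq (Finset.subset_union_right (s₁ := I))]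

lemma sum_le (hw : IsWt I w) {f g : α → ℝ} (h : ∀ i ∈ I, f i ≤ g i) :
    ∑ i ∈ I, w i * f i ≤ ∑ i ∈ I, w i * g i :=
  Finset.sum_le_sum fun i hi => mul_le_mul_of_nonneg_left (h i hi) (hw.nonneg i)

/-- Complementary slackness. Most membership statements below about faces and cells come from it: an
affine bound attained at a convex combination is attained at every point of positive weight. -/
lemma eq_of_sum_le (hw : IsWt I w) {f g : α → ℝ} (h : ∀ i ∈ I, f i ≤ g i)
    (hs : ∑ i ∈ I, w i * g i ≤ ∑ i ∈ I, w i * f i) {i : α} (hi : 0 < w i) : f i = g i := by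
  have hle : ∀ j ∈ I, w j * f j ≤ w j * g j :=
    fun j hj => mul_le_mul_of_nonneg_left (h j hj) (hw.nonneg j)
  have := (Finset.sum_eq_sum_iff_of_le hle).1 (le_antisymm (Finset.sum_le_sum hle) hs) i
    (hw.mem_of_pos hi)
  exact mul_left_cancel₀ hi.ne' this

lemma dot_sum {d : ℕ} (hw : IsWt I w) (u : Fin d → ℝ) (c : ℝ) (v : α → Fin d → ℝ) :
    u ⬝ᵥ (∑ i ∈ I, w i • v i) + c = ∑ i ∈ I, w i * (u ⬝ᵥ v i + c) := by
  rw [dotProduct_sum]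
  simp only [dotProduct_smul, smul_eq_mul, mul_add, Finset.sum_add_distrib, ← Finset.sum_mul,
    hw.sum_eq, one_mul]

lemma prod {β : Type*} {J : Finset β} {q : β → ℝ} (hw : IsWt I w) (hq : IsWt J q) :
    IsWt (I ×ˢ J) (fun p => w p.1 * q p.2) where
  nonneg p := mul_nonneg (hw.nonneg _) (hq.nonneg _)
  supp p hp := by
    by_cases h : p.1 ∈ I
    · have : p.2 ∉ J := fun h' => hp (Finset.mem_product.2 ⟨h, h'⟩)
      simp [hq.supp _ this]
    · simp [hw.supp _ h]
  sum_eq := by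
    rw [Finset.sum_product, ← Finset.sum_mul_sum, hw.sum_eq, hq.sum_eq, one_mul]

lemma fst {β : Type*} {J : Finset β} {p : α × β → ℝ} (hp : IsWt (I ×ˢ J) p) :
    IsWt I (fun i => ∑ j ∈ J, p (i, j)) where
  nonneg i := Finset.sum_nonneg fun j _ => hp.nonneg _
  supp i hi := Finset.sum_eq_zero fun j _ => hp.supp _ fun h => hi (Finset.mem_product.1 h).1
  sum_eq := by rw [← Finset.sum_product', hp.sum_eq]

lemma snd {β : Type*} {J : Finset β} {p : α × β → ℝ} (hp : IsWt (I ×ˢ J) p) :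
    IsWt J (fun j => ∑ i ∈ I, p (i, j)) where
  nonneg i := Finset.sum_nonneg fun j _ => hp.nonneg _
  supp i hi := Finset.sum_eq_zero fun j _ => hp.supp _ fun h => hi (Finset.mem_product.1 h).2
  sum_eq := by rw [← Finset.sum_product_right', hp.sum_eq]

/-- Product weights turn a Minkowski sum of two hulls into the hull of the pairwise sums; the
marginals in `fst_snd_sum` go back. Cells are thus both Minkowski sums and hulls of marked points.
-/
lemma prod_sum {β M : Type*} [AddCommGroup M] [Module ℝ M] {J : Finset β} {q : β → ℝ}
    (hw : IsWt I w) (hq : IsWt J q) (v : α → M) (v' : β → M) (ε : ℝ) :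
    ∑ p ∈ I ×ˢ J, (w p.1 * q p.2) • (v p.1 + ε • v' p.2) =
      ∑ i ∈ I, w i • v i + ε • ∑ j ∈ J, q j • v' j := by
  simp only [smul_add, Finset.sum_add_distrib]
  congr 1
  · rw [Finset.sum_product]
    refine Finset.sum_congr rfl fun i _ => ?_
    change ∑ j ∈ J, (w i * q j) • v i = w i • v i
    rw [← Finset.sum_smul, ← Finset.mul_sum, hq.sum_eq, mul_one]
  · rw [Finset.sum_product_right, Finset.smul_sum]
    refine Finset.sum_congr rfl fun j _ => ?_
    change ∑ i ∈ I, (w i * q j) • ε • v' j = ε • q j • v' j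
    rw [← Finset.sum_smul, ← Finset.sum_mul, hw.sum_eq, one_mul, smul_comm]

lemma fst_snd_sum {β M : Type*} [AddCommGroup M] [Module ℝ M] {J : Finset β} {p : α × β → ℝ}
    (v : α → M) (v' : β → M) (ε : ℝ) :
    ∑ x ∈ I ×ˢ J, p x • (v x.1 + ε • v' x.2) =
      ∑ i ∈ I, (∑ j ∈ J, p (i, j)) • v i + ε • ∑ j ∈ J, (∑ i ∈ I, p (i, j)) • v' j := by
  simp only [smul_add, Finset.sum_add_distrib]
  congr 1
  · rw [Finset.sum_product]
    exact Finset.sum_congr rfl fun i _ => by rw [Finset.sum_smul]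
  · rw [Finset.sum_product_right, Finset.smul_sum]
    refine Finset.sum_congr rfl fun j _ => ?_
    rw [Finset.sum_smul, Finset.smul_sum]
    exact Finset.sum_congr rfl fun i _ => smul_comm ..

lemma single [DecidableEq α] {i : α} (hi : i ∈ I) : IsWt I (fun j => if j = i then 1 else 0) where
  nonneg j := by split_ifs <;> norm_num
  supp j hj := if_neg (ne_of_mem_of_not_mem hi hj).symm
  sum_eq := by simp [hi]

end IsWt

/-- The uniform weights on `I`. -/
noncomputable def unifWt {α : Type*} (I : Finset α) : α → ℝ :=
  Set.indicator (I : Set α) fun _ => (I.card : ℝ)⁻¹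

lemma unifWt_of_mem {α : Type*} {I : Finset α} {i : α} (hi : i ∈ I) :
    unifWt I i = (I.card : ℝ)⁻¹ := Set.indicator_of_mem (by exact hi) _

lemma unifWt_pos {α : Type*} {I : Finset α} {i : α} (hi : i ∈ I) : 0 < unifWt I i := by
  rw [unifWt_of_mem hi]
  have : 0 < I.card := Finset.card_pos.2 ⟨i, hi⟩
  positivity

lemma isWt_unifWt {α : Type*} {I : Finset α} (hI : I.Nonempty) : IsWt I (unifWt I) where
  nonneg i := Set.indicator_nonneg (fun _ _ => by positivity) _
  supp i hi := Set.indicator_of_notMem (by exact hi) _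
  sum_eq := by
    rw [Finset.sum_congr rfl fun i hi => unifWt_of_mem hi, Finset.sum_const, nsmul_eq_mul]
    have : (I.card : ℝ) ≠ 0 := by exact_mod_cast hI.card_ne_zero
    field_simp

lemma mem_convexHull_image_finset {α M : Type*} [AddCommGroup M] [Module ℝ M] {I : Finset α}
    {v : α → M} {x : M} :
    x ∈ convexHull ℝ (v '' (I : Set α)) ↔ ∃ w, IsWt I w ∧ x = ∑ i ∈ I, w i • v i := by
  classical
  constructor
  · intro hx
    have hconv : Convex ℝ {x : M | ∃ w, IsWt I w ∧ x = ∑ i ∈ I, w i • v i} := by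
      rintro _ ⟨w, hw, rfl⟩ _ ⟨w', hw', rfl⟩ a a' ha ha' haa
      refine ⟨fun i => a * w i + a' * w' i, ⟨fun i => ?_, fun i hi => ?_, ?_⟩, ?_⟩
      · exact add_nonneg (mul_nonneg ha (hw.nonneg i)) (mul_nonneg ha' (hw'.nonneg i))
      · rw [hw.supp i hi, hw'.supp i hi]; simp
      · rw [Finset.sum_add_distrib, ← Finset.mul_sum, ← Finset.mul_sum, hw.sum_eq, hw'.sum_eq]
        linarith
      · simp only [add_smul, Finset.sum_add_distrib, Finset.smul_sum, mul_smul]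
    refine convexHull_min ?_ hconv hx
    rintro _ ⟨i, hi, rfl⟩
    refine ⟨fun j => if j = i then 1 else 0, IsWt.single hi, ?_⟩
    have hi' : i ∈ I := hi
    simp [hi']
  · rintro ⟨w, hw, rfl⟩
    exact (convex_convexHull ℝ _).sum_mem (fun i _ => hw.nonneg i) hw.sum_eq
      fun i hi => subset_convexHull ℝ _ ⟨i, hi, rfl⟩

/-! ### Farkas' lemma and linear programming duality -/

/-- Farkas' lemma, for finitely many linear functionals on a real vector space. -/
theorem farkas {α M : Type*} [AddCommGroup M] [Module ℝ M] (I : Finset α) :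
    ∀ (a : α → M →ₗ[ℝ] ℝ) (f : M →ₗ[ℝ] ℝ), (∀ x, (∀ i ∈ I, a i x ≤ 0) → f x ≤ 0) →
      ∃ l : α → ℝ, (∀ i ∈ I, 0 ≤ l i) ∧ f = ∑ i ∈ I, l i • a i := by
  classical
  induction I using Finset.induction_on with
  | empty =>
    intro a f h
    refine ⟨0, by simp, ?_⟩
    ext x
    have h1 := h x (by simp)
    have h2 := h (-x) (by simp)
    rw [map_neg] at h2
    simpa using le_antisymm h1 (by linarith)
  | insert j I hj ih =>
    intro a f h
    by_cases hI : ∀ x, (∀ i ∈ I, a i x ≤ 0) → f x ≤ 0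
    · obtain ⟨l, hl, hf⟩ := ih a f hI
      have upd : ∀ r, ∀ i ∈ I, Function.update l j r i = l i := fun r i hi =>
        Function.update_of_ne (ne_of_mem_of_not_mem hi hj) _ _
      refine ⟨Function.update l j 0, fun i hi => ?_, ?_⟩
      · rcases Finset.mem_insert.1 hi with rfl | hi
        · simp
        · rw [upd _ i hi]
          exact hl i hi
      · rw [Finset.sum_insert hj, hf]
        simp only [Function.update_self, zero_smul, zero_add]
        exact Finset.sum_congr rfl fun i hi => by
          rw [upd _ i hi]
    · push Not at hI
      obtain ⟨x₁, hx₁, hfx₁⟩ := hI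
      have haj : 0 < a j x₁ := by
        by_contra! hle
        refine absurd (h x₁ fun i hi => ?_) (not_le.2 hfx₁)
        rcases Finset.mem_insert.1 hi with rfl | hi
        · exact hle
        · exact hx₁ i hi
      obtain ⟨x₀, hx₀, hfx₀, hj₀⟩ : ∃ x₀, (∀ i ∈ I, a i x₀ ≤ 0) ∧ 0 < f x₀ ∧ a j x₀ = 1 := by
        refine ⟨(a j x₁)⁻¹ • x₁, fun i hi => ?_, ?_, ?_⟩
        · rw [map_smul, smul_eq_mul]
          exact mul_nonpos_of_nonneg_of_nonpos (inv_nonneg.2 haj.le) (hx₁ i hi)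
        · rw [map_smul, smul_eq_mul]; positivity
        · rw [map_smul, smul_eq_mul, inv_mul_cancel₀ haj.ne']
      -- These are the functionals composed with the projection along `x₀` onto the kernel of `a j`,
      -- where the constraint `j` has disappeared.
      obtain ⟨l, hl, hf⟩ := ih (fun i => a i - a i x₀ • a j) (f - f x₀ • a j) (by
        intro x hx
        have := h (x - a j x • x₀) (fun i hi => by
          rcases Finset.mem_insert.1 hi with rfl | hi
          · simp [hj₀]
          · have := hx i hi
            simp only [LinearMap.sub_apply, LinearMap.smul_apply, smul_eq_mul, map_sub,
              map_smul] at this ⊢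
            linarith)
        simp only [LinearMap.sub_apply, LinearMap.smul_apply, smul_eq_mul, map_sub,
          map_smul] at this ⊢
        linarith)
      have upd : ∀ r, ∀ i ∈ I, Function.update l j r i = l i := fun r i hi =>
        Function.update_of_ne (ne_of_mem_of_not_mem hi hj) _ _
      -- Evaluating the desired identity at `x₀`, where `a j` is `1`, forces this coefficient.
      refine ⟨Function.update l j (f x₀ - ∑ i ∈ I, l i * a i x₀), fun i hi => ?_, ?_⟩
      · rcases Finset.mem_insert.1 hi with rfl | hi
        · rw [Function.update_self]
          have : ∑ k ∈ I, l k * a k x₀ ≤ 0 := Finset.sum_nonpos fun k hk =>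
            mul_nonpos_of_nonneg_of_nonpos (hl k hk) (hx₀ k hk)
          linarith
        · rw [upd _ i hi]
          exact hl i hi
      · rw [Finset.sum_insert hj, Function.update_self]
        rw [Finset.sum_congr rfl fun i hi => congrArg (· • a i) (upd _ i hi)]
        refine (sub_eq_iff_eq_add.1 hf).trans ?_
        simp only [smul_sub, Finset.sum_sub_distrib, smul_smul]
        rw [sub_smul (f x₀) _ (a j), Finset.sum_smul]
        abel

/-- Linear programming duality for the upper hull of finitely many points with heights. -/
theorem exists_supporting {α : Type*} {d : ℕ} (I : Finset α) (v : α → Fin d → ℝ) (h : α → ℝ)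
    (y : Fin d → ℝ) (hy : y ∈ convexHull ℝ (v '' (I : Set α))) :
    ∃ (u : Fin d → ℝ) (c : ℝ) (w : α → ℝ), (∀ i ∈ I, h i ≤ u ⬝ᵥ v i + c) ∧ IsWt I w ∧
      y = ∑ i ∈ I, w i • v i ∧ ∀ i, 0 < w i → h i = u ⬝ᵥ v i + c := by
  classical
  -- a maximizer of the primal problem
  obtain ⟨w, hw, hwy, hmax⟩ : ∃ w, IsWt I w ∧ y = ∑ i ∈ I, w i • v i ∧
      ∀ w', IsWt I w' → y = ∑ i ∈ I, w' i • v i →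
        ∑ i ∈ I, w' i * h i ≤ ∑ i ∈ I, w i * h i := by
    let T : Set (I → ℝ) := stdSimplex ℝ I ∩ {x | ∑ i, x i • v i = y}
    have hT : IsCompact T := by
      refine (isCompact_stdSimplex ℝ I).inter_right (isClosed_eq ?_ continuous_const)
      fun_prop
    have ext_wt : ∀ x ∈ T, IsWt I (fun i => if hi : i ∈ I then x ⟨i, hi⟩ else 0) := by
      rintro x ⟨⟨hx, hx1⟩, -⟩
      refine ⟨fun i => ?_, fun i hi => dif_neg hi, ?_⟩
      · split_ifs with hi
        · exact hx _
        · rfl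
      · rw [← Finset.sum_coe_sort, ← hx1]
        exact Finset.sum_congr rfl fun i _ => by simp
    have res : ∀ w, IsWt I w → y = ∑ i ∈ I, w i • v i → (fun i : I => w i) ∈ T := by
      intro w hw hwy
      refine ⟨⟨fun i => hw.nonneg i, ?_⟩, ?_⟩
      · rw [Finset.sum_coe_sort I w, hw.sum_eq]
      · exact ((Finset.sum_coe_sort I fun i => w i • v i).trans hwy.symm)
    obtain ⟨w₀, hw₀, hwy₀⟩ := mem_convexHull_image_finset.1 hy
    obtain ⟨x, hx, hxmax⟩ := hT.exists_isMaxOn ⟨_, res w₀ hw₀ hwy₀⟩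
      (f := fun x => ∑ i : I, x i * h i) (by fun_prop)
    refine ⟨_, ext_wt x hx, ?_, ?_⟩
    · rw [← Finset.sum_coe_sort, ← hx.2]
      exact Finset.sum_congr rfl fun i _ => by simp
    · intro w' hw' hwy'
      have := hxmax (res w' hw' hwy')
      simp only [Set.mem_ofPred_eq] at this
      rw [← Finset.sum_coe_sort, ← Finset.sum_coe_sort I]
      refine this.trans (le_of_eq (Finset.sum_congr rfl fun i _ => by simp))
  set t := ∑ i ∈ I, w i * h i with ht
  suffices hdual : ∃ (u : Fin d → ℝ) (c : ℝ), (∀ i ∈ I, h i ≤ u ⬝ᵥ v i + c) ∧ u ⬝ᵥ y + c ≤ t by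
    obtain ⟨u, c, h1, h2⟩ := hdual
    refine ⟨u, c, w, h1, hw, hwy, fun i hi => hw.eq_of_sum_le h1 ?_ hi⟩
    rw [hwy, hw.dot_sum] at h2
    exact h2
  by_contra! hno
  -- A third coordinate `s` homogenizes the dual problem. A solution with `s > 0`, divided by `s`,
  -- would be a pair `(u, c)` of the kind excluded by `hno`; so the constraints imply `s ≤ 0` and
  -- Farkas' lemma applies to the functional `s`.
  let dotL : (Fin d → ℝ) → ((Fin d → ℝ) × ℝ × ℝ →ₗ[ℝ] ℝ) := fun x =>
    (dotProductBilin ℝ ℝ x).comp (LinearMap.fst ℝ _ _)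
  let cL : (Fin d → ℝ) × ℝ × ℝ →ₗ[ℝ] ℝ := (LinearMap.fst ℝ _ _).comp (LinearMap.snd ℝ _ _)
  let sL : (Fin d → ℝ) × ℝ × ℝ →ₗ[ℝ] ℝ := (LinearMap.snd ℝ _ _).comp (LinearMap.snd ℝ _ _)
  let a : Option α → (Fin d → ℝ) × ℝ × ℝ →ₗ[ℝ] ℝ := fun o =>
    match o with
    | some i => h i • sL - dotL (v i) - cL
    | none => dotL y + cL - t • sL
  obtain ⟨l, hl, hs⟩ := farkas (Finset.insertNone I) a sL (by
    rintro ⟨u, c, s⟩ hx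
    by_contra! hspos
    have hspos' : 0 < s := hspos
    have hy' := hx none (by simp)
    simp only [a, dotL, cL, sL, LinearMap.sub_apply, LinearMap.add_apply, LinearMap.smul_apply,
      LinearMap.comp_apply, LinearMap.fst_apply, LinearMap.snd_apply, smul_eq_mul,
      dotProductBilin_apply_apply] at hy'
    refine absurd (hno (s⁻¹ • u) (s⁻¹ * c) fun i hi => ?_) (not_lt.2 ?_)
    · have := hx (some i) (by simpa using hi)
      simp only [a, dotL, cL, sL, LinearMap.sub_apply, LinearMap.smul_apply,
        LinearMap.comp_apply, LinearMap.fst_apply, LinearMap.snd_apply, smul_eq_mul,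
        dotProductBilin_apply_apply] at this
      rw [smul_dotProduct, smul_eq_mul, ← mul_add, dotProduct_comm, inv_mul_eq_div,
        le_div_iff₀ hspos']
      linarith
    · rw [smul_dotProduct, smul_eq_mul, ← mul_add, dotProduct_comm, inv_mul_eq_div,
        div_le_iff₀ hspos']
      linarith)
  have key : ∀ (u : Fin d → ℝ) (c s : ℝ), s = l none * (y ⬝ᵥ u + c - t * s) +
      ∑ i ∈ I, l (some i) * (h i * s - v i ⬝ᵥ u - c) := by
    intro u c s
    have := LinearMap.congr_fun hs (u, c, s)
    simpa [a, dotL, cL, sL, dotProductBilin_apply_apply] using this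
  have hμ : 0 ≤ l none := hl none (by simp)
  have hli : ∀ i ∈ I, 0 ≤ l (some i) := fun i hi => hl _ (by simpa using hi)
  have h1 : ∑ i ∈ I, l (some i) = l none := by
    have := key 0 1 0
    simp at this
    linarith
  have h2 : ∑ i ∈ I, l (some i) * h i = 1 + l none * t := by
    have := key 0 0 1
    simp at this
    linarith
  have h3 : l none • y = ∑ i ∈ I, l (some i) • v i := by
    refine sub_eq_zero.1 (dotProduct_eq_zero _ fun u => ?_)
    have := key u 0 0
    simp only [mul_zero, sub_zero, add_zero, zero_sub, mul_neg, Finset.sum_neg_distrib] at this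
    rw [sub_dotProduct, smul_dotProduct, sum_dotProduct, smul_eq_mul]
    simp only [smul_dotProduct, smul_eq_mul]
    linarith
  -- A zero multiplier of `y` turns `h2` into `0 = 1`. A positive one normalizes the certificate to
  -- weights representing `y` with value `t + 1 / l none`, above the maximum `t`.
  rcases hμ.eq_or_lt with h0 | hpos
  · have : ∀ i ∈ I, l (some i) = 0 :=
      (Finset.sum_eq_zero_iff_of_nonneg hli).1 (h1.trans h0.symm)
    rw [Finset.sum_eq_zero fun i hi => by rw [this i hi, zero_mul], ← h0] at h2
    norm_num at h2
  · have hw' : IsWt I (fun i => if i ∈ I then (l none)⁻¹ * l (some i) else 0) := by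
      refine ⟨fun i => ?_, fun i hi => if_neg hi, ?_⟩
      · split_ifs with hi
        · exact mul_nonneg (inv_nonneg.2 hμ) (hli i hi)
        · rfl
      · rw [Finset.sum_congr rfl fun i hi => if_pos hi, ← Finset.mul_sum, h1,
          inv_mul_cancel₀ hpos.ne']
    have := hmax _ hw' (by
      rw [Finset.sum_congr rfl fun i hi => by rw [if_pos hi, mul_smul], ← Finset.smul_sum, ← h3,
        smul_smul, inv_mul_cancel₀ hpos.ne', one_smul])
    rw [Finset.sum_congr rfl fun i hi => by rw [if_pos hi, mul_assoc], ← Finset.mul_sum, h2,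
      inv_mul_le_iff₀ hpos] at this
    linarith

end MixSubdiv
namespace MixSubdiv

/-! ### Simple polytopes with a Minkowski summand -/

lemma exists_least_of_isChain {α : Type*} {C : Finset (Finset α)}
    (hC : IsChain (· ⊆ ·) (C : Set (Finset α))) (hne : C.Nonempty) : ∃ σ ∈ C, ∀ ρ ∈ C, σ ⊆ ρ := by
  obtain ⟨σ, hσ, hmin⟩ := Finset.exists_min_image C Finset.card hne
  refine ⟨σ, hσ, fun ρ hρ => ?_⟩
  by_cases he : σ = ρ
  · exact he.subset
  · rcases hC hσ hρ he with h | h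
    · exact h
    · exact (Finset.eq_of_subset_of_card_le h (hmin ρ hρ)).symm.subset

lemma exists_greatest_of_isChain {α : Type*} {C : Finset (Finset α)}
    (hC : IsChain (· ⊆ ·) (C : Set (Finset α))) (hne : C.Nonempty) : ∃ σ ∈ C, ∀ ρ ∈ C, ρ ⊆ σ := by
  obtain ⟨σ, hσ, hmax⟩ := Finset.exists_max_image C Finset.card hne
  refine ⟨σ, hσ, fun ρ hρ => ?_⟩
  by_cases he : σ = ρ
  · exact he.symm.subset
  · rcases hC hσ hρ he with h | h
    · exact (Finset.eq_of_subset_of_card_le h (hmax ρ hρ)).symm.subset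
    · exact h

open Filter Topology in
lemma eventually_small_mul_lt (a : ℝ) {c : ℝ} (hc : 0 < c) : ∀ᶠ τ in 𝓝[>] (0 : ℝ), τ * a < c := by
  have h : Tendsto (fun τ : ℝ => τ * a) (𝓝[>] 0) (𝓝 0) := by
    have : Tendsto (fun τ : ℝ => τ * a) (𝓝 0) (𝓝 (0 * a)) :=
      (continuous_id.mul continuous_const).tendsto 0
    rw [zero_mul] at this
    exact this.mono_left nhdsWithin_le_nhds
  exact h.eventually (gt_mem_nhds hc)

/-- A polytope `Q` cut out by the inequalities `⟨z, n⟩ ≤ b z`, `z ∈ Z`, such that the active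
inequalities at each point are linearly independent and define a nonempty face of
the lattice polytope `P = {⟨z, x⟩ ≤ 1}`. -/
structure Setup (d : ℕ) where
  Z : Finset (Fin d → ℤ)
  b : (Fin d → ℤ) → ℝ
  B : Finset (Fin d → ℤ)
  Q : Set (Fin d → ℝ)
  P : Set (Fin d → ℝ)
  mem_Q : ∀ n, n ∈ Q ↔ ∀ z ∈ Z, toReal z ⬝ᵥ n ≤ b z
  mem_P : ∀ x, x ∈ P ↔ ∀ z ∈ Z, toReal z ⬝ᵥ x ≤ 1
  mem_B : ∀ t, t ∈ B ↔ toReal t ∈ P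
  hull_B : P = convexHull ℝ (toReal '' (B : Set (Fin d → ℤ)))
  zero_notMem : (0 : Fin d → ℤ) ∉ Z
  Q_nonempty : Q.Nonempty
  exists_pos : ∀ v : Fin d → ℝ, v ≠ 0 → ∃ z ∈ Z, 0 < toReal z ⬝ᵥ v
  indep : ∀ n ∈ Q, ∀ c : (Fin d → ℤ) → ℝ, ∑ z ∈ Z with toReal z ⬝ᵥ n = b z, c z • toReal z = 0 →
    ∀ z ∈ Z, toReal z ⬝ᵥ n = b z → c z = 0
  compat : ∀ n ∈ Q, ∃ x ∈ P, ∀ z ∈ Z, toReal z ⬝ᵥ n = b z → toReal z ⬝ᵥ x = 1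

namespace Setup

variable {d : ℕ} (S : Setup d)

/-- The inequalities that are tight at `n`. -/
noncomputable def act (n : Fin d → ℝ) : Finset (Fin d → ℤ) := S.Z.filter fun z => toReal z ⬝ᵥ n = S.b z

/-- The sets of inequalities that define the faces of `Q`. -/
noncomputable def K : Finset (Finset (Fin d → ℤ)) :=
  open Classical in S.Z.powerset.filter fun σ => ∃ n ∈ S.Q, S.act n = σ

/-- The face of `Q` where the inequalities in `σ` are tight. -/
def face (σ : Finset (Fin d → ℤ)) : Set (Fin d → ℝ) :=
  {n | n ∈ S.Q ∧ ∀ z ∈ σ, toReal z ⬝ᵥ n = S.b z}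

/-- The face of `P` where the inequalities in `σ` are tight. -/
def kap (σ : Finset (Fin d → ℤ)) : Set (Fin d → ℝ) :=
  {x | x ∈ S.P ∧ ∀ z ∈ σ, toReal z ⬝ᵥ x = 1}

variable {S}

lemma mem_act {n : Fin d → ℝ} {z : Fin d → ℤ} :
    z ∈ S.act n ↔ z ∈ S.Z ∧ toReal z ⬝ᵥ n = S.b z := Finset.mem_filter

lemma mem_K {σ : Finset (Fin d → ℤ)} : σ ∈ S.K ↔ ∃ n ∈ S.Q, S.act n = σ := by
  classical
  simp only [K, Finset.mem_filter, Finset.mem_powerset, and_iff_right_iff_imp]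
  rintro ⟨n, -, rfl⟩
  exact Finset.filter_subset _ _

lemma act_mem_K {n : Fin d → ℝ} (hn : n ∈ S.Q) : S.act n ∈ S.K := mem_K.2 ⟨n, hn, rfl⟩

lemma subset_Z {σ : Finset (Fin d → ℤ)} (hσ : σ ∈ S.K) : σ ⊆ S.Z := by
  obtain ⟨n, -, rfl⟩ := mem_K.1 hσ
  exact Finset.filter_subset _ _

lemma kap_anti {σ σ' : Finset (Fin d → ℤ)} (h : σ ⊆ σ') : S.kap σ' ⊆ S.kap σ :=
  fun _ hx => ⟨hx.1, fun z hz => hx.2 z (h hz)⟩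

lemma convex_Q : Convex ℝ S.Q := by
  intro x hx y hy a a' ha ha' haa
  rw [S.mem_Q] at *
  intro z hz
  rw [dotProduct_add, dotProduct_smul, dotProduct_smul, smul_eq_mul, smul_eq_mul]
  have := mul_le_mul_of_nonneg_left (hx z hz) ha
  have := mul_le_mul_of_nonneg_left (hy z hz) ha'
  have : S.b z = a * S.b z + a' * S.b z := by rw [← add_mul, haa, one_mul]
  linarith

lemma convex_P : Convex ℝ S.P := by
  rw [S.hull_B]
  exact convex_convexHull ℝ _

lemma convex_kap (σ : Finset (Fin d → ℤ)) : Convex ℝ (S.kap σ) := by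
  rintro x ⟨hx, hx'⟩ y ⟨hy, hy'⟩ a a' ha ha' haa
  refine ⟨convex_P hx hy ha ha' haa, fun z hz => ?_⟩
  rw [dotProduct_add, dotProduct_smul, dotProduct_smul, hx' z hz, hy' z hz]
  simpa using haa

lemma act_combo {n n' : Fin d → ℝ} (hn : n ∈ S.Q) (hn' : n' ∈ S.Q) {a a' : ℝ} (ha : 0 < a)
    (ha' : 0 < a') (haa : a + a' = 1) :
    S.act (a • n + a' • n') = S.act n ∩ S.act n' := by
  ext z
  rw [Finset.mem_inter, mem_act, mem_act, mem_act]
  rw [S.mem_Q] at hn hn'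
  rw [dotProduct_add, dotProduct_smul, dotProduct_smul, smul_eq_mul, smul_eq_mul]
  have hb : S.b z = a * S.b z + a' * S.b z := by rw [← add_mul, haa, one_mul]
  constructor
  · rintro ⟨hz, h⟩
    have h1 := mul_le_mul_of_nonneg_left (hn z hz) ha.le
    have h2 := mul_le_mul_of_nonneg_left (hn' z hz) ha'.le
    refine ⟨⟨hz, mul_left_cancel₀ ha.ne' ?_⟩, hz, mul_left_cancel₀ ha'.ne' ?_⟩ <;> linarith
  · rintro ⟨⟨hz, h⟩, -, h'⟩
    exact ⟨hz, by rw [h, h', ← hb]⟩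

-- Inequalities that are not tight have positive slack, so short steps only have to respect the
-- tight ones.
open Filter Topology in
lemma small_step {n x : Fin d → ℝ} (hn : n ∈ S.Q) (hx : ∀ z ∈ S.act n, toReal z ⬝ᵥ x ≤ 0) :
    ∀ᶠ τ in 𝓝[>] (0 : ℝ), n + τ • x ∈ S.Q ∧
      S.act (n + τ • x) = (S.act n).filter (toReal · ⬝ᵥ x = 0) := by
  have hn' := (S.mem_Q n).1 hn
  have h1 : ∀ᶠ τ in 𝓝[>] (0 : ℝ), ∀ z ∈ S.Z, z ∉ S.act n →
      τ * (toReal z ⬝ᵥ x) < S.b z - toReal z ⬝ᵥ n := by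
    refine (Finset.eventually_all S.Z).2 fun z hz => ?_
    by_cases hza : z ∈ S.act n
    · exact Eventually.of_forall fun τ h => absurd hza h
    · refine (eventually_small_mul_lt _ (sub_pos.2 ?_)).mono fun τ h _ => h
      exact lt_of_le_of_ne (hn' z hz) fun h => hza (mem_act.2 ⟨hz, h⟩)
  filter_upwards [h1, self_mem_nhdsWithin] with τ h1 hτ
  have hτ' : 0 < τ := hτ
  have hd : ∀ z, toReal z ⬝ᵥ (n + τ • x) = toReal z ⬝ᵥ n + τ * (toReal z ⬝ᵥ x) := fun z => by
    rw [dotProduct_add, dotProduct_smul, smul_eq_mul]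
  constructor
  · rw [S.mem_Q]
    intro z hz
    rw [hd]
    by_cases hza : z ∈ S.act n
    · have := mul_nonpos_of_nonneg_of_nonpos hτ'.le (hx z hza)
      linarith [hn' z hz]
    · linarith [h1 z hz hza]
  · ext z
    rw [Finset.mem_filter, mem_act, hd]
    constructor
    · rintro ⟨hz, h⟩
      have hza : z ∈ S.act n := by
        by_contra hza
        linarith [h1 z hz hza]
      refine ⟨hza, ?_⟩
      have := (mem_act.1 hza).2
      have h0 : τ * (toReal z ⬝ᵥ x) = 0 := by linarith
      exact (mul_eq_zero.1 h0).resolve_left hτ'.ne'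
    · rintro ⟨hza, h⟩
      exact ⟨(mem_act.1 hza).1, by rw [h, (mem_act.1 hza).2]; ring⟩

lemma kap_nonempty {σ : Finset (Fin d → ℤ)} (hσ : σ ∈ S.K) : (S.kap σ).Nonempty := by
  obtain ⟨n, hn, rfl⟩ := mem_K.1 hσ
  obtain ⟨x, hx, h⟩ := S.compat n hn
  exact ⟨x, hx, fun z hz => h z (mem_act.1 hz).1 (mem_act.1 hz).2⟩

lemma mem_kap_of_pos {σ : Finset (Fin d → ℤ)} (hσ : σ ⊆ S.Z) {q : (Fin d → ℤ) → ℝ}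
    (hq : IsWt S.B q) (h : ∑ t ∈ S.B, q t • toReal t ∈ S.kap σ) {t : Fin d → ℤ} (ht : 0 < q t) :
    toReal t ∈ S.kap σ := by
  refine ⟨(S.mem_B t).1 (hq.mem_of_pos ht), fun z hz => ?_⟩
  have h1 := h.2 z hz
  have h2 := hq.dot_sum (toReal z) 0 toReal
  rw [h1] at h2
  simp only [add_zero] at h2
  refine hq.eq_of_sum_le (f := fun t => toReal z ⬝ᵥ toReal t) (g := fun _ => 1)
    (fun i hi => ?_) ?_ ht
  · exact (S.mem_P _).1 ((S.mem_B i).1 hi) z (hσ hz)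
  · rw [← h2, ← Finset.sum_mul, hq.sum_eq, one_mul]

lemma exists_mem_B_kap {σ : Finset (Fin d → ℤ)} (hσ : σ ∈ S.K) :
    ∃ t ∈ S.B, toReal t ∈ S.kap σ := by
  obtain ⟨x, hx⟩ := kap_nonempty hσ
  have hxP := hx.1
  rw [S.hull_B] at hxP
  obtain ⟨q, hq, rfl⟩ := mem_convexHull_image_finset.1 hxP
  obtain ⟨t, ht, hpos⟩ := hq.exists_pos
  exact ⟨t, ht, mem_kap_of_pos (subset_Z hσ) hq hx hpos⟩

variable (S) in
/-- Disjoint scaled copies of the faces `kap σ` of `P`, one inside the relative interior of each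
face of `Q`. -/
structure Copies where
  eps : ℝ
  eps_pos : 0 < eps
  s : Finset (Fin d → ℤ) → (Fin d → ℝ)
  copy_mem : ∀ σ ∈ S.K, ∀ g ∈ S.kap σ, s σ + eps • g ∈ S.Q
  act_copy : ∀ σ ∈ S.K, ∀ g ∈ S.kap σ, S.act (s σ + eps • g) = σ

/-! ### Marked points of the small copies -/

namespace Copies

variable (r : S.Copies)

/-- The point of the copy of `kap σ` corresponding to the lattice point `t`. -/
def pt (p : Finset (Fin d → ℤ) × (Fin d → ℤ)) : Fin d → ℝ := r.s p.1 + r.eps • toReal p.2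

variable (S) in
/-- The index set of the marked points. -/
noncomputable def V : Finset (Finset (Fin d → ℤ) × (Fin d → ℤ)) :=
  open Classical in (S.K ×ˢ S.B).filter fun p => toReal p.2 ∈ S.kap p.1

variable {r}

lemma mem_V {p : Finset (Fin d → ℤ) × (Fin d → ℤ)} :
    p ∈ V S ↔ p.1 ∈ S.K ∧ p.2 ∈ S.B ∧ toReal p.2 ∈ S.kap p.1 := by
  simp [V, and_assoc]

lemma pt_mem {p : Finset (Fin d → ℤ) × (Fin d → ℤ)} (hp : p ∈ V S) : r.pt p ∈ S.Q :=
  r.copy_mem _ (mem_V.1 hp).1 _ (mem_V.1 hp).2.2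

lemma act_pt {p : Finset (Fin d → ℤ) × (Fin d → ℤ)} (hp : p ∈ V S) : S.act (r.pt p) = p.1 :=
  r.act_copy _ (mem_V.1 hp).1 _ (mem_V.1 hp).2.2

variable (r)

/-- Let `q` be a marked point in the relative interior of the smallest face containing `y`. The ray
from `q` through `y` leaves `Q`, by `exists_pos`, at a point where a new inequality is tight; `y`
lies between `q` and this exit point. Induct on the number of inequalities that are not tight. -/
lemma mem_convexHull_pt {y : Fin d → ℝ} (hy : y ∈ S.Q) :
    y ∈ convexHull ℝ (r.pt '' (V S : Set _)) := by
  induction hk : S.Z.card - (S.act y).card using Nat.strong_induction_on generalizing y with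
  | _ k ih =>
  subst hk
  obtain ⟨t, htB, ht⟩ := exists_mem_B_kap (act_mem_K hy)
  have hpV : (S.act y, t) ∈ V S := mem_V.2 ⟨act_mem_K hy, htB, ht⟩
  set q := r.pt (S.act y, t) with hq
  have hqQ : q ∈ S.Q := pt_mem hpV
  have hqa : S.act q = S.act y := act_pt hpV
  have hqh : q ∈ convexHull ℝ (r.pt '' (V S : Set _)) := subset_convexHull ℝ _ ⟨_, hpV, rfl⟩
  by_cases hyq : y = q
  · rwa [hyq]
  have hne : (S.Z.filter fun z => 0 < toReal z ⬝ᵥ (y - q)).Nonempty := by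
    obtain ⟨z, hz, h⟩ := S.exists_pos _ (sub_ne_zero.2 hyq)
    exact ⟨z, Finset.mem_filter.2 ⟨hz, h⟩⟩
  obtain ⟨z₀, hz₀, hmin⟩ := Finset.exists_min_image _
    (fun z => (S.b z - toReal z ⬝ᵥ y) / (toReal z ⬝ᵥ (y - q))) hne
  obtain ⟨hz₀Z, hz₀pos⟩ := Finset.mem_filter.1 hz₀
  set τ := (S.b z₀ - toReal z₀ ⬝ᵥ y) / (toReal z₀ ⬝ᵥ (y - q)) with hτ
  have hyQ := (S.mem_Q y).1 hy
  have hτ0 : 0 ≤ τ := div_nonneg (sub_nonneg.2 (hyQ z₀ hz₀Z)) hz₀pos.le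
  have hd : ∀ z, toReal z ⬝ᵥ (y + τ • (y - q)) =
      toReal z ⬝ᵥ y + τ * (toReal z ⬝ᵥ (y - q)) := fun z => by
    rw [dotProduct_add, dotProduct_smul, smul_eq_mul]
  have hmem : y + τ • (y - q) ∈ S.Q := by
    rw [S.mem_Q]
    intro z hz
    rw [hd]
    by_cases hpos : 0 < toReal z ⬝ᵥ (y - q)
    · have := hmin z (Finset.mem_filter.2 ⟨hz, hpos⟩)
      have := (le_div_iff₀ hpos).1 this
      linarith
    · have := mul_nonpos_of_nonneg_of_nonpos hτ0 (not_lt.1 hpos)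
      linarith [hyQ z hz]
  have hz0 : ∀ z ∈ S.act y, toReal z ⬝ᵥ (y - q) = 0 := by
    intro z hz
    rw [dotProduct_sub, (mem_act.1 hz).2, (mem_act.1 (hqa ▸ hz)).2, sub_self]
  have hsub : S.act y ⊆ S.act (y + τ • (y - q)) := by
    intro z hz
    refine mem_act.2 ⟨(mem_act.1 hz).1, ?_⟩
    rw [hd, hz0 z hz, (mem_act.1 hz).2]
    ring
  have hssub : S.act y ⊂ S.act (y + τ • (y - q)) := by
    refine hsub.ssubset_of_mem_notMem (a := z₀) (mem_act.2 ⟨hz₀Z, ?_⟩) fun h => ?_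
    · rw [hd, hτ, div_mul_cancel₀ _ hz₀pos.ne']
      ring
    · exact hz₀pos.ne' (hz0 z₀ h)
  have hcard := Finset.card_lt_card hssub
  have hle : (S.act (y + τ • (y - q))).card ≤ S.Z.card := Finset.card_filter_le _ _
  have hy' := ih _ (by omega) hmem rfl
  have hy_eq : y = (1 / (1 + τ)) • (y + τ • (y - q)) + (τ / (1 + τ)) • q := by
    have : (1 + τ) ≠ 0 := by positivity
    rw [smul_add, smul_smul, smul_sub]
    have h1 : y = (1 / (1 + τ) + τ / (1 + τ)) • y := by
      rw [← add_div, div_self this, one_smul]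
    rw [show (1 / (1 + τ)) * τ = τ / (1 + τ) by ring]
    nth_rewrite 1 [h1]
    rw [add_smul]
    abel
  rw [hy_eq]
  refine convex_convexHull ℝ _ hy' hqh (by positivity) (by positivity) ?_
  rw [← add_div, div_self (by positivity)]

-- Both `p` and the marked point are in the relative interior of the same face, so the segment
-- joining them extends a little beyond `p`. The positive share `η` of the marked point later bounds
-- supporting functions from below.
open Filter Topology in
lemma exists_eta {p : Fin d → ℝ} (hp : p ∈ S.Q) : ∃ η : ℝ, 0 < η ∧ η < 1 ∧
    ∃ t, (S.act p, t) ∈ V S ∧ ∃ q ∈ S.Q, p = (1 - η) • q + η • r.pt (S.act p, t) := by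
  obtain ⟨t, htB, ht⟩ := exists_mem_B_kap (act_mem_K hp)
  have hpV : (S.act p, t) ∈ V S := mem_V.2 ⟨act_mem_K hp, htB, ht⟩
  have hqa : S.act (r.pt (S.act p, t)) = S.act p := act_pt hpV
  have h0 : ∀ z ∈ S.act p, toReal z ⬝ᵥ (p - r.pt (S.act p, t)) ≤ 0 := by
    intro z hz
    rw [dotProduct_sub, (mem_act.1 hz).2, (mem_act.1 (hqa.symm ▸ hz)).2, sub_self]
  obtain ⟨τ, ⟨hτ, -⟩, hτ0⟩ := ((small_step hp h0).and self_mem_nhdsWithin).exists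
  have hτ0 : 0 < τ := hτ0
  refine ⟨τ / (1 + τ), by positivity, by rw [div_lt_one (by positivity)]; linarith, t, hpV, _, hτ,
    ?_⟩
  have h1 : (1 + τ) ≠ 0 := by positivity
  rw [show 1 - τ / (1 + τ) = 1 / (1 + τ) by field_simp; ring, smul_add, smul_smul, smul_sub]
  have h2 : p = (1 / (1 + τ) + τ / (1 + τ)) • p := by
    rw [← add_div, div_self h1, one_smul]
  rw [show (1 / (1 + τ)) * τ = τ / (1 + τ) by ring]
  nth_rewrite 1 [h2]
  rw [add_smul]
  abel

/-! ### Uniqueness of representations and affine functions on cells -/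

variable {r}

/-- One half of the uniqueness of the representation. -/
lemma weight_le {w w' : Finset (Fin d → ℤ) → ℝ} {g g' : Fin d → ℝ}
    (hw : IsWt S.K w) (hw' : IsWt S.K w') (hc' : IsChain (· ⊆ ·) {σ | 0 < w' σ})
    (hg : ∀ σ, 0 < w σ → g ∈ S.kap σ) (hg' : ∀ σ, 0 < w' σ → g' ∈ S.kap σ)
    (h : ∑ σ ∈ S.K, w σ • r.s σ + r.eps • g = ∑ σ ∈ S.K, w' σ • r.s σ + r.eps • g')
    {σ : Finset (Fin d → ℤ)} (hσ : σ ∈ S.K)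
    (heq : ∀ ρ ∈ S.K, ρ.card < σ.card → w ρ = w' ρ) : w σ ≤ w' σ := by
  classical
  by_contra! hlt
  have hgP : g ∈ S.P := by
    obtain ⟨ρ, -, hρ⟩ := hw.exists_pos
    exact (hg ρ hρ).1
  -- The remaining support of `w'`, beyond the part where the weights already agree and beyond `σ`.
  -- If it is empty, `w' ≤ w` everywhere with strict inequality at `σ`, although both sums are `1`.
  set R := S.K.filter fun ρ => 0 < w' ρ ∧ σ.card ≤ ρ.card ∧ ρ ≠ σ with hR
  rcases R.eq_empty_or_nonempty with hRe | hRne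
  · have h1 : ∀ ρ ∈ S.K, w' ρ ≤ w ρ := by
      intro ρ hρ
      rcases lt_or_ge ρ.card σ.card with hc | hc
      · exact (heq ρ hρ hc).ge
      · by_cases hρσ : ρ = σ
        · rw [hρσ]; exact hlt.le
        · have : ρ ∉ R := by rw [hRe]; simp
          have h0 : w' ρ ≤ 0 := by
            by_contra! h0
            exact this (Finset.mem_filter.2 ⟨hρ, h0, hc, hρσ⟩)
          exact h0.trans (hw.nonneg ρ)
    have := Finset.sum_lt_sum h1 ⟨σ, hσ, hlt⟩
    rw [hw.sum_eq, hw'.sum_eq] at this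
    exact lt_irrefl _ this
  · obtain ⟨ρ₀, hρ₀, hsub⟩ := exists_least_of_isChain
      (hc'.mono fun ρ hρ => (Finset.mem_filter.1 hρ).2.1) hRne
    obtain ⟨hρ₀K, hρ₀w, hρ₀c, hρ₀σ⟩ := Finset.mem_filter.1 hρ₀
    -- The inequality `z` is tight on the copies of all members of `R`, which contain `ρ₀`, but not
    -- on the copy of `σ`. The slack of `z` at the common point is now computed from both
    -- representations.
    obtain ⟨z, hzρ, hzσ⟩ : ∃ z ∈ ρ₀, z ∉ σ := by
      by_contra! hall
      exact hρ₀σ (Finset.eq_of_subset_of_card_le hall hρ₀c)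
    have hzZ : z ∈ S.Z := subset_Z hρ₀K hzρ
    have hzg' : toReal z ⬝ᵥ g' = 1 := (hg' ρ₀ hρ₀w).2 z hzρ
    have hzg : toReal z ⬝ᵥ g ≤ 1 := (S.mem_P g).1 hgP z hzZ
    have hslack : ∀ (v : Finset (Fin d → ℤ) → ℝ), IsWt S.K v → ∀ x : Fin d → ℝ,
        S.b z - toReal z ⬝ᵥ (∑ σ ∈ S.K, v σ • r.s σ + r.eps • x) =
        ∑ ρ ∈ S.K, v ρ * (S.b z - toReal z ⬝ᵥ (r.s ρ + r.eps • x)) := by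
      intro v hv x
      have e1 : ∑ σ ∈ S.K, v σ • r.s σ + r.eps • x = ∑ σ ∈ S.K, v σ • (r.s σ + r.eps • x) := by
        simp only [smul_add, Finset.sum_add_distrib, ← Finset.sum_smul, hv.sum_eq, one_smul]
      rw [e1]
      have := hv.dot_sum (-toReal z) (S.b z) (fun σ => r.s σ + r.eps • x)
      simp only [neg_dotProduct] at this
      rw [sub_eq_neg_add, this]
      exact Finset.sum_congr rfl fun ρ _ => by ring
    have hsum := congrArg (fun y => S.b z - toReal z ⬝ᵥ y) h
    simp only [hslack w hw, hslack w' hw'] at hsum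
    have hd : ∀ ρ x, toReal z ⬝ᵥ (r.s ρ + r.eps • x) =
        toReal z ⬝ᵥ r.s ρ + r.eps * (toReal z ⬝ᵥ x) := fun ρ x => by
      rw [dotProduct_add, dotProduct_smul, smul_eq_mul]
    have heg : r.eps * (toReal z ⬝ᵥ g) ≤ r.eps * (toReal z ⬝ᵥ g') := by
      rw [hzg']
      exact mul_le_mul_of_nonneg_left hzg r.eps_pos.le
    have hslackσ : 0 < S.b z - toReal z ⬝ᵥ (r.s σ + r.eps • g) := by
      have hwσ : 0 < w σ := (hw'.nonneg σ).trans_lt hlt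
      have h1 := (S.mem_Q _).1 (r.copy_mem σ hσ g (hg σ hwσ)) z hzZ
      refine sub_pos.2 (lt_of_le_of_ne h1 fun he => hzσ ?_)
      rw [← r.act_copy σ hσ g (hg σ hwσ)]
      exact mem_act.2 ⟨hzZ, he⟩
    -- Since `⟨z, g⟩ ≤ 1 = ⟨z, g'⟩`, the slack with `g'` never exceeds the one with `g`. Smaller `ρ`
    -- have equal weights, and the members of `R` contribute nothing on the left.
    have hterm : ∀ ρ ∈ S.K, w' ρ * (S.b z - toReal z ⬝ᵥ (r.s ρ + r.eps • g')) ≤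
        w ρ * (S.b z - toReal z ⬝ᵥ (r.s ρ + r.eps • g)) := by
      intro ρ hρ
      have hmono : S.b z - toReal z ⬝ᵥ (r.s ρ + r.eps • g') ≤
          S.b z - toReal z ⬝ᵥ (r.s ρ + r.eps • g) := by
        rw [hd, hd]; linarith
      rcases lt_or_ge ρ.card σ.card with hc | hc
      · rw [heq ρ hρ hc]
        exact mul_le_mul_of_nonneg_left hmono (hw'.nonneg ρ)
      · by_cases hρσ : ρ = σ
        · subst hρσ
          calc _ ≤ w' ρ * (S.b z - toReal z ⬝ᵥ (r.s ρ + r.eps • g)) :=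
                mul_le_mul_of_nonneg_left hmono (hw'.nonneg ρ)
            _ ≤ _ := mul_le_mul_of_nonneg_right hlt.le hslackσ.le
        · have hL : w' ρ * (S.b z - toReal z ⬝ᵥ (r.s ρ + r.eps • g')) = 0 := by
            rcases (hw'.nonneg ρ).eq_or_lt with h0 | h0
            · rw [← h0, zero_mul]
            · have hρR : ρ ∈ R := Finset.mem_filter.2 ⟨hρ, h0, hc, hρσ⟩
              have : z ∈ S.act (r.s ρ + r.eps • g') := by
                rw [r.act_copy ρ hρ g' (hg' ρ h0)]
                exact hsub ρ hρR hzρ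
              rw [(mem_act.1 this).2, sub_self, mul_zero]
          rw [hL]
          rcases (hw.nonneg ρ).eq_or_lt with h0 | h0
          · rw [← h0, zero_mul]
          · exact mul_nonneg h0.le
              (sub_nonneg.2 ((S.mem_Q _).1 (r.copy_mem ρ hρ g (hg ρ h0)) z hzZ))
    have hstrict : w' σ * (S.b z - toReal z ⬝ᵥ (r.s σ + r.eps • g')) <
        w σ * (S.b z - toReal z ⬝ᵥ (r.s σ + r.eps • g)) := by
      have hmono : S.b z - toReal z ⬝ᵥ (r.s σ + r.eps • g') ≤
          S.b z - toReal z ⬝ᵥ (r.s σ + r.eps • g) := by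
        rw [hd, hd]; linarith
      calc _ ≤ w' σ * (S.b z - toReal z ⬝ᵥ (r.s σ + r.eps • g)) :=
            mul_le_mul_of_nonneg_left hmono (hw'.nonneg σ)
        _ < _ := mul_lt_mul_of_pos_right hlt hslackσ
    have := Finset.sum_lt_sum hterm ⟨σ, hσ, hstrict⟩
    exact this.ne hsum.symm

/-- Points of `Q` have at most one representation `∑ w σ • s σ + eps • g`, supported on a chain,
with `g` in the corresponding face of `P`. -/
theorem rep_unique {w w' : Finset (Fin d → ℤ) → ℝ} {g g' : Fin d → ℝ}
    (hw : IsWt S.K w) (hw' : IsWt S.K w') (hc : IsChain (· ⊆ ·) {σ | 0 < w σ})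
    (hc' : IsChain (· ⊆ ·) {σ | 0 < w' σ})
    (hg : ∀ σ, 0 < w σ → g ∈ S.kap σ) (hg' : ∀ σ, 0 < w' σ → g' ∈ S.kap σ)
    (h : ∑ σ ∈ S.K, w σ • r.s σ + r.eps • g = ∑ σ ∈ S.K, w' σ • r.s σ + r.eps • g') :
    w = w' ∧ g = g' := by
  -- Induction from few tight inequalities to many; `weight_le` is applied in both directions.
  have key : ∀ k, ∀ σ ∈ S.K, σ.card = k → w σ = w' σ := by
    intro k
    induction k using Nat.strong_induction_on with
    | _ k ih =>
    rintro σ hσ rfl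
    exact le_antisymm
      (weight_le hw hw' hc' hg hg' h hσ fun ρ hρ hlt => ih _ hlt ρ hρ rfl)
      (weight_le hw' hw hc hg' hg h.symm hσ fun ρ hρ hlt => (ih _ hlt ρ hρ rfl).symm)
  have hww : w = w' := by
    funext σ
    by_cases hσ : σ ∈ S.K
    · exact key _ σ hσ rfl
    · rw [hw.supp σ hσ, hw'.supp σ hσ]
  refine ⟨hww, ?_⟩
  subst hww
  exact smul_right_injective _ r.eps_pos.ne' (add_left_cancel h)

/-- Every `g ∈ kap σm` has `⟨z, g⟩ = 1`, so `⟨z, ·⟩` is constant on `s σ + eps • kap σm`. Equality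
with `b z` there would put `z` into the tight set `σ`. With `dot_s_add` this makes the system in
`exists_coeff` triangular. -/
lemma lt_of_notMem {σ σm : Finset (Fin d → ℤ)} (hσ : σ ∈ S.K) (hσm : σm ∈ S.K) (h : σ ⊆ σm)
    {z : Fin d → ℤ} (hz : z ∈ σm) (hz' : z ∉ σ) : toReal z ⬝ᵥ r.s σ + r.eps < S.b z := by
  obtain ⟨g, hg⟩ := kap_nonempty hσm
  have hg' := kap_anti h hg
  have h1 := (S.mem_Q _).1 (r.copy_mem σ hσ g hg') z (subset_Z hσm hz)
  have h2 : toReal z ⬝ᵥ (r.s σ + r.eps • g) = toReal z ⬝ᵥ r.s σ + r.eps := by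
    rw [dotProduct_add, dotProduct_smul, hg.2 z hz, smul_eq_mul, mul_one]
  rw [h2] at h1
  refine lt_of_le_of_ne h1 fun he => hz' ?_
  rw [← r.act_copy σ hσ g hg']
  exact mem_act.2 ⟨subset_Z hσm hz, by rw [h2, he]⟩

lemma dot_s_add {σ : Finset (Fin d → ℤ)} (hσ : σ ∈ S.K) {z : Fin d → ℤ} (hz : z ∈ σ) :
    toReal z ⬝ᵥ r.s σ + r.eps = S.b z := by
  obtain ⟨g, hg⟩ := kap_nonempty hσ
  have h1 : z ∈ S.act (r.s σ + r.eps • g) := by rw [r.act_copy σ hσ g hg]; exact hz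
  rw [← (mem_act.1 h1).2, dotProduct_add, dotProduct_smul, hg.2 z hz, smul_eq_mul, mul_one]

/-- A triangular system: for consecutive members `σ₁ ⊂ σ₂` of the chain and `z ∈ σ₂ \ σ₁`, the
affine function `⟨z, ·⟩ + eps - b z` vanishes at `s σ` for all later members `σ` and is nonzero at
`s σ₁`. The values are corrected one at a time, the least member last. -/
lemma exists_coeff {σm : Finset (Fin d → ℤ)} (hσm : σm ∈ S.K) (θ : Finset (Fin d → ℤ) → ℝ)
    (C : Finset (Finset (Fin d → ℤ))) (hCK : C ⊆ S.K)
    (hC : IsChain (· ⊆ ·) (C : Set (Finset (Fin d → ℤ)))) (hm : ∀ σ ∈ C, σ ⊆ σm) :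
    ∃ (a : (Fin d → ℤ) → ℝ) (c : ℝ), ∀ σ ∈ C,
      ∑ z ∈ σm, a z * (toReal z ⬝ᵥ r.s σ + r.eps) + c = θ σ := by
  classical
  induction C using Finset.strongInduction with
  | _ C ih =>
  rcases C.eq_empty_or_nonempty with rfl | hne
  · exact ⟨0, 0, by simp⟩
  obtain ⟨σ₁, hσ₁, hsub⟩ := exists_least_of_isChain hC hne
  rcases (C.erase σ₁).eq_empty_or_nonempty with he | hne'
  · refine ⟨0, θ σ₁, fun σ hσ => ?_⟩
    have : σ = σ₁ := by
      by_contra hn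
      have : σ ∈ C.erase σ₁ := Finset.mem_erase.2 ⟨hn, hσ⟩
      rw [he] at this
      simp at this
    simp [this]
  have hCe : IsChain (· ⊆ ·) (C.erase σ₁ : Set (Finset (Fin d → ℤ))) :=
    hC.mono (by exact_mod_cast Finset.erase_subset σ₁ C)
  obtain ⟨a, c, hac⟩ := ih (C.erase σ₁) (Finset.erase_ssubset hσ₁)
    ((Finset.erase_subset _ _).trans hCK) (by exact_mod_cast hCe)
    (fun σ hσ => hm σ (Finset.mem_of_mem_erase hσ))
  obtain ⟨σ₂, hσ₂, hsub₂⟩ := exists_least_of_isChain (by exact_mod_cast hCe) hne'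
  have hσ₂C := Finset.mem_of_mem_erase hσ₂
  obtain ⟨z, hz₂, hz₁⟩ : ∃ z ∈ σ₂, z ∉ σ₁ := by
    by_contra! hall
    exact (Finset.mem_erase.1 hσ₂).1 (Finset.Subset.antisymm hall (hsub _ hσ₂C))
  have hzm : z ∈ σm := hm _ hσ₂C hz₂
  have hm1 : toReal z ⬝ᵥ r.s σ₁ + r.eps - S.b z ≠ 0 :=
    (sub_neg.2 (lt_of_notMem (hCK hσ₁) hσm (hm _ hσ₁) hzm hz₁)).ne
  set e := (θ σ₁ - (∑ z ∈ σm, a z * (toReal z ⬝ᵥ r.s σ₁ + r.eps) + c)) /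
    (toReal z ⬝ᵥ r.s σ₁ + r.eps - S.b z) with hedef
  have hsum : ∀ σ, ∑ x ∈ σm, (a x + if x = z then e else 0) * (toReal x ⬝ᵥ r.s σ + r.eps) =
      ∑ x ∈ σm, a x * (toReal x ⬝ᵥ r.s σ + r.eps) + e * (toReal z ⬝ᵥ r.s σ + r.eps) := by
    intro σ
    simp only [add_mul, Finset.sum_add_distrib, ite_mul, zero_mul, Finset.sum_ite_eq', hzm, if_true]
  refine ⟨fun x => a x + if x = z then e else 0, c - e * S.b z, fun σ hσ => ?_⟩
  rw [hsum]
  by_cases hσσ : σ = σ₁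
  · subst hσσ
    have : e * (toReal z ⬝ᵥ r.s σ + r.eps - S.b z) =
        θ σ - (∑ z ∈ σm, a z * (toReal z ⬝ᵥ r.s σ + r.eps) + c) := div_mul_cancel₀ _ hm1
    linarith
  · have hσe := Finset.mem_erase.2 ⟨hσσ, hσ⟩
    rw [dot_s_add (hCK hσ) (hsub₂ σ hσe hz₂), ← hac σ hσe]
    ring

/-- Affine functions on a cell may be prescribed independently in the two directions. -/
theorem exists_affine {σm : Finset (Fin d → ℤ)} (hσm : σm ∈ S.K) (θ : Finset (Fin d → ℤ) → ℝ)
    (u₀ : Fin d → ℝ) (C : Finset (Finset (Fin d → ℤ))) (hCK : C ⊆ S.K)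
    (hC : IsChain (· ⊆ ·) (C : Set (Finset (Fin d → ℤ)))) (hm : ∀ σ ∈ C, σ ⊆ σm) :
    ∃ (u : Fin d → ℝ) (c : ℝ), ∀ σ ∈ C, ∀ g ∈ S.kap σm,
      u ⬝ᵥ (r.s σ + r.eps • g) + c = θ σ + u₀ ⬝ᵥ g := by
  obtain ⟨a, c, hac⟩ := exists_coeff (r := r) hσm
    (fun σ => θ σ - r.eps⁻¹ * (u₀ ⬝ᵥ r.s σ)) C hCK hC hm
  -- The first summand produces the slope `u₀` along `g`. The second is constant along `kap σm`, so
  -- it adjusts the values at the shifts without disturbing that slope.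
  refine ⟨r.eps⁻¹ • u₀ + ∑ z ∈ σm, a z • toReal z, c, fun σ hσ g hg => ?_⟩
  have h1 : (∑ z ∈ σm, a z • toReal z) ⬝ᵥ (r.s σ + r.eps • g) =
      ∑ z ∈ σm, a z * (toReal z ⬝ᵥ r.s σ + r.eps) := by
    rw [sum_dotProduct]
    refine Finset.sum_congr rfl fun z hz => ?_
    rw [smul_dotProduct, dotProduct_add, dotProduct_smul, hg.2 z hz]
    simp
  have h2 : (r.eps⁻¹ • u₀) ⬝ᵥ (r.s σ + r.eps • g) = r.eps⁻¹ * (u₀ ⬝ᵥ r.s σ) + u₀ ⬝ᵥ g := by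
    rw [smul_dotProduct, dotProduct_add, dotProduct_smul, smul_eq_mul, smul_eq_mul, mul_add,
      inv_mul_cancel_left₀ r.eps_pos.ne']
  rw [add_dotProduct, h1, h2]
  linarith [hac σ hσ]

end Copies
end Setup
end MixSubdiv
namespace MixSubdiv

lemma IsWt.sum_mem_of_pos {α M : Type*} [AddCommGroup M] [Module ℝ M] {I : Finset α} {w : α → ℝ}
    (hw : IsWt I w) {s : Set M} (hs : Convex ℝ s) {v : α → M} (hv : ∀ i, 0 < w i → v i ∈ s) :
    ∑ i ∈ I, w i • v i ∈ s := by
  have hw' : IsWt (I.filter fun i => 0 < w i) w :=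
    hw.restrict fun i hi => Finset.mem_filter.2 ⟨hw.mem_of_pos hi, hi⟩
  rw [hw.sum_smul_restrict hw']
  exact hs.sum_mem (fun i _ => hw.nonneg i) hw'.sum_eq fun i hi => hv i (Finset.mem_filter.1 hi).2

/-! ### Height cells of `P`, and the cells indexed by a chain and a height cell -/

namespace Setup

variable {d : ℕ} {S : Setup d} {ν : (Fin d → ℤ) → ℤ}

lemma subset_B_of_isHeightCell {τ : Finset (Fin d → ℤ)} (h : IsHeightCell S.P ν τ) : τ ⊆ S.B := by
  obtain ⟨-, u, c, -, h⟩ := h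
  exact fun t ht => (S.mem_B t).2 ((h t).1 ht).1

/-- Add to a function supporting the heights at `g` the sum of `1 - ⟨z, ·⟩` over `z ∈ σ`. It is
nonnegative on `P` and vanishes exactly on `kap σ`, so the new function still touches the points
carrying `g` and touches nothing outside `kap σ`. -/
lemma exists_heightCell_kap (ν : (Fin d → ℤ) → ℤ) {σ : Finset (Fin d → ℤ)} (hσ : σ ⊆ S.Z)
    {g : Fin d → ℝ} (hg : g ∈ S.kap σ) :
    ∃ τ q, IsHeightCell S.P ν τ ∧ IsWt τ q ∧ g = ∑ t ∈ τ, q t • toReal t ∧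
      ∀ t ∈ τ, toReal t ∈ S.kap σ := by
  classical
  have hgP := hg.1
  rw [S.hull_B] at hgP
  obtain ⟨u, c, q, hu, hq, hgq, hpos⟩ :=
    exists_supporting S.B toReal (fun t => (ν t : ℝ)) g hgP
  have hle : ∀ t ∈ S.B, 0 ≤ ∑ z ∈ σ, (1 - toReal z ⬝ᵥ toReal t) := fun t ht =>
    Finset.sum_nonneg fun z hz => sub_nonneg.2 ((S.mem_P _).1 ((S.mem_B t).1 ht) z (hσ hz))
  have heval : ∀ t, (u - ∑ z ∈ σ, toReal z) ⬝ᵥ toReal t + (c + σ.card) =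
      u ⬝ᵥ toReal t + c + ∑ z ∈ σ, (1 - toReal z ⬝ᵥ toReal t) := by
    intro t
    rw [sub_dotProduct, sum_dotProduct, Finset.sum_sub_distrib]
    simp
    ring
  have hτ : ∀ t, 0 < q t → t ∈ S.B.filter fun t =>
      (ν t : ℝ) = (u - ∑ z ∈ σ, toReal z) ⬝ᵥ toReal t + (c + σ.card) := by
    intro t ht
    refine Finset.mem_filter.2 ⟨hq.mem_of_pos ht, ?_⟩
    have hk := mem_kap_of_pos hσ hq (hgq ▸ hg) ht
    rw [heval, Finset.sum_eq_zero fun z hz => by rw [hk.2 z hz, sub_self], add_zero, hpos t ht]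
  have hq' := hq.restrict hτ
  refine ⟨_, q, ⟨?_, u - ∑ z ∈ σ, toReal z, c + σ.card, fun z hz => ?_, fun z => ?_⟩, hq', ?_,
    fun t ht => ?_⟩
  · obtain ⟨t, ht, -⟩ := hq'.exists_pos
    exact ⟨t, ht⟩
  · rw [heval]
    have := hle z ((S.mem_B z).2 hz)
    linarith [hu z ((S.mem_B z).2 hz)]
  · rw [Finset.mem_filter, S.mem_B]
  · rw [hgq]
    exact hq.sum_smul_restrict hq' _
  · obtain ⟨htB, ht⟩ := Finset.mem_filter.1 ht
    refine ⟨(S.mem_B t).1 htB, fun z hz => ?_⟩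
    rw [heval] at ht
    have h0 : ∑ z ∈ σ, (1 - toReal z ⬝ᵥ toReal t) = 0 :=
      le_antisymm (by linarith [hu t htB]) (hle t htB)
    have := (Finset.sum_eq_zero_iff_of_nonneg fun z hz =>
      sub_nonneg.2 ((S.mem_P _).1 ((S.mem_B t).1 htB) z (hσ hz))).1 h0 z hz
    linarith

-- A small multiple of the function exposing `τ'` inside `τ` is added to the one exposing `τ`; the
-- finitely many points outside `τ` have positive gap and stay untouched.
open Filter Topology in
lemma heightCell_face {τ τ' : Finset (Fin d → ℤ)} (h : IsHeightCell S.P ν τ) {u' : Fin d → ℝ}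
    {c' : ℝ} (hnn : ∀ t ∈ τ, 0 ≤ u' ⬝ᵥ toReal t + c')
    (hτ' : ∀ t, t ∈ τ' ↔ t ∈ τ ∧ u' ⬝ᵥ toReal t + c' = 0) (hne : τ'.Nonempty) :
    IsHeightCell S.P ν τ' := by
  obtain ⟨-, u, c, hu, hτ⟩ := h
  have hev : ∀ᶠ δ in 𝓝[>] (0 : ℝ), ∀ t ∈ S.B, t ∉ τ →
      δ * -(u' ⬝ᵥ toReal t + c') < u ⬝ᵥ toReal t + c - ν t := by
    refine (Finset.eventually_all S.B).2 fun t ht => ?_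
    by_cases htτ : t ∈ τ
    · exact Eventually.of_forall fun _ h => absurd htτ h
    · refine (eventually_small_mul_lt _ (sub_pos.2 ?_)).mono fun _ h _ => h
      have htP := (S.mem_B t).1 ht
      exact lt_of_le_of_ne (hu t htP) fun h => htτ ((hτ t).2 ⟨htP, h⟩)
  obtain ⟨δ, hδ, hδ0⟩ := (hev.and self_mem_nhdsWithin).exists
  have hδ0 : 0 < δ := hδ0
  have heval : ∀ t, (u + δ • u') ⬝ᵥ toReal t + (c + δ * c') =
      u ⬝ᵥ toReal t + c + δ * (u' ⬝ᵥ toReal t + c') := fun t => by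
    rw [add_dotProduct, smul_dotProduct, smul_eq_mul]; ring
  refine ⟨hne, u + δ • u', c + δ * c', fun z hz => ?_, fun z => ?_⟩
  · rw [heval]
    by_cases hzτ : z ∈ τ
    · have := mul_nonneg hδ0.le (hnn z hzτ)
      linarith [hu z hz]
    · linarith [hδ z ((S.mem_B z).2 hz) hzτ]
  · rw [heval, hτ']
    constructor
    · rintro ⟨hzτ, h0⟩
      obtain ⟨h1, h2⟩ := (hτ z).1 hzτ
      exact ⟨h1, by rw [h0, h2]; ring⟩
    · rintro ⟨hz, he⟩
      have hzτ : z ∈ τ := by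
        by_contra hzτ
        linarith [hδ z ((S.mem_B z).2 hz) hzτ]
      refine ⟨hzτ, ?_⟩
      have h2 := ((hτ z).1 hzτ).2
      have h0 : δ * (u' ⬝ᵥ toReal z + c') = 0 := by linarith
      exact (mul_eq_zero.1 h0).resolve_left hδ0.ne'

variable (S) in
/-- The indices of the cells of the common refinement: chains of faces of `Q` together with a cell
of the coherent subdivision of `P` induced by the heights `ν`. -/
structure IsIdx (ν : (Fin d → ℤ) → ℤ) (C : Finset (Finset (Fin d → ℤ)))
    (τ : Finset (Fin d → ℤ)) : Prop where
  nonempty : C.Nonempty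
  subset_K : C ⊆ S.K
  chain : IsChain (· ⊆ ·) (C : Set (Finset (Fin d → ℤ)))
  heightCell : IsHeightCell S.P ν τ
  mem_kap : ∀ σ ∈ C, ∀ t ∈ τ, toReal t ∈ S.kap σ

namespace Copies

variable {r : S.Copies} {C C' : Finset (Finset (Fin d → ℤ))} {τ τ' : Finset (Fin d → ℤ)}

variable (r) in
/-- The cell with a given index. -/
def cell (C : Finset (Finset (Fin d → ℤ))) (τ : Finset (Fin d → ℤ)) : Set (Fin d → ℝ) :=
  convexHull ℝ (r.s '' (C : Set (Finset (Fin d → ℤ)))) + r.eps • simplex τ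

lemma mem_cell' {y : Fin d → ℝ} : y ∈ r.cell C τ ↔ ∃ w q, IsWt C w ∧ IsWt τ q ∧
    y = ∑ σ ∈ C, w σ • r.s σ + r.eps • ∑ t ∈ τ, q t • toReal t := by
  simp only [cell, Set.mem_add, Set.mem_smul_set, simplex, mem_convexHull_image_finset]
  constructor
  · rintro ⟨_, ⟨w, hw, rfl⟩, _, ⟨_, ⟨q, hq, rfl⟩, rfl⟩, rfl⟩
    exact ⟨w, q, hw, hq, rfl⟩
  · rintro ⟨w, q, hw, hq, rfl⟩
    exact ⟨_, ⟨w, hw, rfl⟩, _, ⟨_, ⟨q, hq, rfl⟩, rfl⟩, rfl⟩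

lemma mem_cell {y : Fin d → ℝ} : y ∈ r.cell C τ ↔ ∃ w q, IsWt C w ∧ IsWt τ q ∧
    y = ∑ p ∈ C ×ˢ τ, (w p.1 * q p.2) • r.pt p := by
  rw [mem_cell']
  refine exists₂_congr fun w q => and_congr_right fun hw => and_congr_right fun hq => ?_
  rw [← hw.prod_sum hq r.s toReal r.eps]
  rfl

lemma _root_.MixSubdiv.Setup.IsIdx.mem_V (h : S.IsIdx ν C τ)
    {p : Finset (Fin d → ℤ) × (Fin d → ℤ)} (hp : p ∈ C ×ˢ τ) : p ∈ V S := by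
  obtain ⟨h1, h2⟩ := Finset.mem_product.1 hp
  exact Copies.mem_V.2 ⟨h.subset_K h1, subset_B_of_isHeightCell h.heightCell h2, h.mem_kap _ h1 _ h2⟩

lemma cell_subset (h : S.IsIdx ν C τ) : r.cell C τ ⊆ S.Q := by
  intro y hy
  obtain ⟨w, q, hw, hq, rfl⟩ := mem_cell.1 hy
  exact (hw.prod hq).sum_mem_of_pos convex_Q fun p hp =>
    pt_mem (h.mem_V ((hw.prod hq).mem_of_pos hp))

/-- Two representations of a point in terms of cells agree. -/
lemma cell_unique {ν' : (Fin d → ℤ) → ℤ} (h : S.IsIdx ν C τ) (h' : S.IsIdx ν' C' τ')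
    {w w' : Finset (Fin d → ℤ) → ℝ}
    {q q' : (Fin d → ℤ) → ℝ} (hw : IsWt C w) (hq : IsWt τ q) (hw' : IsWt C' w') (hq' : IsWt τ' q')
    (he : ∑ σ ∈ C, w σ • r.s σ + r.eps • ∑ t ∈ τ, q t • toReal t =
      ∑ σ ∈ C', w' σ • r.s σ + r.eps • ∑ t ∈ τ', q' t • toReal t) :
    w = w' ∧ ∑ t ∈ τ, q t • toReal t = ∑ t ∈ τ', q' t • toReal t := by
  refine rep_unique (r := r) (hw.mono h.subset_K) (hw'.mono h'.subset_K)
    (h.chain.mono fun σ hσ => hw.mem_of_pos hσ) (h'.chain.mono fun σ hσ => hw'.mem_of_pos hσ)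
    (fun σ hσ => hq.sum_mem_of_pos (convex_kap σ) fun t ht =>
      h.mem_kap σ (hw.mem_of_pos hσ) t (hq.mem_of_pos ht))
    (fun σ hσ => hq'.sum_mem_of_pos (convex_kap σ) fun t ht =>
      h'.mem_kap σ (hw'.mem_of_pos hσ) t (hq'.mem_of_pos ht)) ?_
  rw [hw.sum_smul_eq h.subset_K, hw'.sum_smul_eq h'.subset_K, he]

/-! ### Supporting functions for the heights `δ ^ codim` -/

variable (r) in
/-- The affine function `⟨u, ·⟩ + c` is above the heights `δ ^ codim` at the marked points. -/
def Above (δ : ℝ) (u : Fin d → ℝ) (c : ℝ) : Prop := ∀ p ∈ V S, δ ^ p.1.card ≤ u ⬝ᵥ r.pt p + c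

lemma Above.nonneg {δ : ℝ} (hδ : 0 < δ) {u : Fin d → ℝ} {c : ℝ} (h : r.Above δ u c)
    {y : Fin d → ℝ} (hy : y ∈ S.Q) : 0 ≤ u ⬝ᵥ y + c := by
  obtain ⟨w, hw, rfl⟩ := mem_convexHull_image_finset.1 (r.mem_convexHull_pt hy)
  rw [hw.dot_sum]
  exact Finset.sum_nonneg fun p hp =>
    mul_nonneg (hw.nonneg p) ((pow_pos hδ _).le.trans (h p hp))

-- The constant `η` depends on `y` only, and neither on `δ` nor on the affine function. This is why
-- `δ < η` suffices later to contradict a touching condition on a smaller face.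
variable (r) in
lemma exists_lower_bound {y : Fin d → ℝ} (hy : y ∈ S.Q) : ∃ η : ℝ, 0 < η ∧
    ∀ δ u c, 0 < δ → r.Above δ u c → η * δ ^ (S.act y).card ≤ u ⬝ᵥ y + c := by
  obtain ⟨η, h0, h1, t, ht, q, hq, he⟩ := r.exists_eta hy
  refine ⟨η, h0, fun δ u c hδ h => ?_⟩
  have hq0 := h.nonneg hδ hq
  have ht0 := h _ ht
  have : u ⬝ᵥ y + c = (1 - η) * (u ⬝ᵥ q + c) + η * (u ⬝ᵥ r.pt (S.act y, t) + c) := by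
    conv_lhs => rw [he]
    rw [dotProduct_add, dotProduct_smul, dotProduct_smul, smul_eq_mul, smul_eq_mul]
    ring
  rw [this]
  have h2 := mul_nonneg (sub_nonneg.2 h1.le) hq0
  have h3 := mul_le_mul_of_nonneg_left ht0 h0.le
  linarith

lemma pow_lt_mul_pow {δ η : ℝ} (hδ : 0 < δ) (hδ1 : δ < 1) (hδη : δ < η) {j k : ℕ} (h : j < k) :
    δ ^ k < η * δ ^ j :=
  calc δ ^ k ≤ δ ^ (j + 1) := pow_le_pow_of_le_one hδ.le hδ1.le h
    _ = δ * δ ^ j := pow_succ' _ _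
    _ < η * δ ^ j := mul_lt_mul_of_pos_right hδη (pow_pos hδ _)

-- Passing to a larger face multiplies the height by at least `1 / δ`. If the two touched points lie
-- on incomparable faces, their midpoint lies in the relative interior of a larger face, where the
-- function must exceed both touched values. If `p'.1 ⊆ p.1` but `toReal p'.2 ∉ kap p.1`, moving
-- from `pt p` in the direction `x = toReal p'.2 - toReal p.2` also enters a larger face, so `⟨u, x⟩
-- > 0`; a second marked point over `p'.1` gives the opposite sign.
open Filter Topology in
lemma eventually_compatible {p p' : Finset (Fin d → ℤ) × (Fin d → ℤ)} (hp : p ∈ V S)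
    (hp' : p' ∈ V S) : ∀ᶠ δ in 𝓝[>] (0 : ℝ), ∀ u c, r.Above δ u c →
      δ ^ p.1.card = u ⬝ᵥ r.pt p + c → δ ^ p'.1.card = u ⬝ᵥ r.pt p' + c →
      (p.1 ⊆ p'.1 ∨ p'.1 ⊆ p.1) ∧ toReal p'.2 ∈ S.kap p.1 := by
  have hsmall : ∀ η : ℝ, 0 < η → ∀ᶠ δ in 𝓝[>] (0 : ℝ), 0 < δ ∧ δ < 1 ∧ δ < η := by
    intro η hη
    filter_upwards [self_mem_nhdsWithin, mem_nhdsWithin_of_mem_nhds (gt_mem_nhds one_pos),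
      mem_nhdsWithin_of_mem_nhds (gt_mem_nhds hη)] with δ h1 h2 h3
    exact ⟨h1, h2, h3⟩
  by_cases hcomp : p.1 ⊆ p'.1 ∨ p'.1 ⊆ p.1
  swap
  · -- the midpoint lies in the interior of a larger face
    have hmid : (1 / 2 : ℝ) • r.pt p + (1 / 2 : ℝ) • r.pt p' ∈ S.Q :=
      convex_Q (pt_mem hp) (pt_mem hp') (by norm_num) (by norm_num) (by norm_num)
    obtain ⟨η, hη, hlow⟩ := r.exists_lower_bound hmid
    rw [act_combo (pt_mem hp) (pt_mem hp') (by norm_num) (by norm_num) (by norm_num), act_pt hp,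
      act_pt hp'] at hlow
    rw [not_or] at hcomp
    filter_upwards [hsmall η hη] with δ ⟨h0, h1, h2⟩ u c ha he he'
    exfalso
    have h3 := hlow δ u c h0 ha
    have h4 : (p.1 ∩ p'.1).card < p.1.card := Finset.card_lt_card
      (Finset.inter_subset_left.ssubset_of_ne fun h => hcomp.1 (Finset.inter_eq_left.1 h))
    have h5 : (p.1 ∩ p'.1).card < p'.1.card := Finset.card_lt_card
      (Finset.inter_subset_right.ssubset_of_ne fun h => hcomp.2 (Finset.inter_eq_right.1 h))
    have h6 := pow_lt_mul_pow h0 h1 h2 h4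
    have h7 := pow_lt_mul_pow h0 h1 h2 h5
    rw [dotProduct_add, dotProduct_smul, dotProduct_smul, smul_eq_mul, smul_eq_mul] at h3
    linarith
  by_cases hk : toReal p'.2 ∈ S.kap p.1
  · exact Eventually.of_forall fun _ _ _ _ _ _ => ⟨hcomp, hk⟩
  -- push the two marked points towards each other
  obtain ⟨hpK, hpB, hpk⟩ := mem_V.1 hp
  obtain ⟨hpK', hpB', hpk'⟩ := mem_V.1 hp'
  have hsub : p'.1 ⊆ p.1 := hcomp.resolve_left fun h => hk (kap_anti h hpk')
  set x : Fin d → ℝ := toReal p'.2 - toReal p.2 with hx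
  have hdot : ∀ z ∈ p.1, toReal z ⬝ᵥ x = toReal z ⬝ᵥ toReal p'.2 - 1 := fun z hz => by
    rw [hx, dotProduct_sub, hpk.2 z hz]
  have hxle : ∀ z ∈ S.act (r.pt p), toReal z ⬝ᵥ x ≤ 0 := by
    intro z hz
    rw [act_pt hp] at hz
    rw [hdot z hz, sub_nonpos]
    exact (S.mem_P _).1 hpk'.1 z (subset_Z hpK hz)
  have hlt : ∀ᶠ τ in 𝓝[>] (0 : ℝ), τ < r.eps :=
    mem_nhdsWithin_of_mem_nhds (gt_mem_nhds r.eps_pos)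
  obtain ⟨τ, ⟨⟨hτQ, hτa⟩, hτlt⟩, hτ0⟩ :=
    (((small_step (pt_mem hp) hxle).and hlt).and self_mem_nhdsWithin).exists
  have hτ0 : 0 < τ := hτ0
  obtain ⟨η, hη, hlow⟩ := r.exists_lower_bound hτQ
  have hcard : (S.act (r.pt p + τ • x)).card < p.1.card := by
    rw [hτa, act_pt hp]
    refine Finset.card_lt_card (Finset.filter_ssubset.2 ?_)
    by_contra! hall
    refine hk ⟨hpk'.1, fun z hz => ?_⟩
    have := hall z hz
    rw [hdot z hz] at this
    linarith
  -- This point has the same height as `p'`, and `pt p'` is its translate by `eps • x`. As the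
  -- function touches at `p'`, it cannot increase along `x`.
  have hVnew : (p'.1, p.2) ∈ V S := mem_V.2 ⟨hpK', hpB, kap_anti hsub hpk⟩
  filter_upwards [hsmall η hη] with δ ⟨h0, h1, h2⟩ u c ha he he'
  exfalso
  have h3 := hlow δ u c h0 ha
  have h4 := pow_lt_mul_pow h0 h1 h2 hcard
  have h5 := ha _ hVnew
  have hpt : r.pt p' = r.pt (p'.1, p.2) + r.eps • x := by
    simp only [pt, hx, smul_sub]
    abel
  rw [hpt, dotProduct_add, dotProduct_smul, smul_eq_mul] at he'
  rw [dotProduct_add, dotProduct_smul, smul_eq_mul] at h3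
  have h6 : r.eps * (u ⬝ᵥ x) ≤ 0 := by
    simp only at h5
    linarith
  have h7 : u ⬝ᵥ x ≤ 0 := by
    by_contra! h
    exact absurd (mul_pos r.eps_pos h) (not_lt.2 h6)
  have := mul_nonpos_of_nonneg_of_nonpos hτ0.le h7
  linarith

variable (r) in
/-- Any two marked points that are touched by an affine function above the heights `δ ^ codim`
belong to a common cell. -/
def IsSeparating (δ : ℝ) : Prop := 0 < δ ∧ ∀ u c, r.Above δ u c → ∀ p ∈ V S, ∀ p' ∈ V S,
  δ ^ p.1.card = u ⬝ᵥ r.pt p + c → δ ^ p'.1.card = u ⬝ᵥ r.pt p' + c →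
  (p.1 ⊆ p'.1 ∨ p'.1 ⊆ p.1) ∧ toReal p'.2 ∈ S.kap p.1

open Filter Topology in
variable (r) in
lemma exists_isSeparating : ∃ δ, r.IsSeparating δ := by
  have h : ∀ᶠ δ in 𝓝[>] (0 : ℝ), ∀ p ∈ V S, ∀ p' ∈ V S, ∀ u c, r.Above δ u c →
      δ ^ p.1.card = u ⬝ᵥ r.pt p + c → δ ^ p'.1.card = u ⬝ᵥ r.pt p' + c →
      (p.1 ⊆ p'.1 ∨ p'.1 ⊆ p.1) ∧ toReal p'.2 ∈ S.kap p.1 :=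
    (Finset.eventually_all _).2 fun p hp => (Finset.eventually_all _).2 fun p' hp' =>
      eventually_compatible hp hp'
  obtain ⟨δ, h, h0⟩ := (h.and self_mem_nhdsWithin).exists
  exact ⟨δ, h0, fun u c ha p hp p' hp' => h p hp p' hp' u c ha⟩

/-- Every point of `Q` has a representation, whose value computes a touching affine function. -/
lemma IsSeparating.exists_rep {δ : ℝ} (hδ : r.IsSeparating δ) {y : Fin d → ℝ} (hy : y ∈ S.Q) :
    ∃ w g u c, IsWt S.K w ∧ IsChain (· ⊆ ·) {σ | 0 < w σ} ∧ (∀ σ, 0 < w σ → g ∈ S.kap σ) ∧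
      y = ∑ σ ∈ S.K, w σ • r.s σ + r.eps • g ∧ r.Above δ u c ∧
      u ⬝ᵥ y + c = ∑ σ ∈ S.K, w σ * δ ^ σ.card := by
  obtain ⟨u, c, W, hu, hW, hyW, hpos⟩ :=
    exists_supporting (V S) r.pt (fun p => δ ^ p.1.card) y (r.mem_convexHull_pt hy)
  have hVKB : V S ⊆ S.K ×ˢ S.B := fun p hp =>
    Finset.mem_product.2 ⟨(mem_V.1 hp).1, (mem_V.1 hp).2.1⟩
  have hW' := hW.mono hVKB
  have hw_pos : ∀ σ, 0 < ∑ t ∈ S.B, W (σ, t) → ∃ t, 0 < W (σ, t) := by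
    intro σ hσ
    by_contra! h
    exact absurd hσ (not_lt.2 (Finset.sum_nonpos fun t _ => h t))
  have hq_pos : ∀ t, 0 < ∑ σ ∈ S.K, W (σ, t) → ∃ σ, 0 < W (σ, t) := by
    intro t ht
    by_contra! h
    exact absurd ht (not_lt.2 (Finset.sum_nonpos fun σ _ => h σ))
  -- The optimal weights need not be a product, but their marginals represent the same point.
  -- Pairwise compatibility of the touched marked points makes the first marginal live on a chain
  -- and puts the mean of the second into every `kap σ` involved.
  refine ⟨fun σ => ∑ t ∈ S.B, W (σ, t), ∑ t ∈ S.B, (∑ σ ∈ S.K, W (σ, t)) • toReal t, u, c,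
    hW'.fst, ?_, fun σ hσ => ?_, ?_, hu, ?_⟩
  · intro σ hσ σ' hσ' _
    obtain ⟨t, ht⟩ := hw_pos σ hσ
    obtain ⟨t', ht'⟩ := hw_pos σ' hσ'
    exact (hδ.2 u c hu _ (hW.mem_of_pos ht) _ (hW.mem_of_pos ht') (hpos _ ht) (hpos _ ht')).1
  · obtain ⟨t, ht⟩ := hw_pos σ hσ
    refine hW'.snd.sum_mem_of_pos (convex_kap σ) fun t' ht' => ?_
    obtain ⟨σ', ht'⟩ := hq_pos t' ht'
    exact (hδ.2 u c hu _ (hW.mem_of_pos ht) _ (hW.mem_of_pos ht') (hpos _ ht) (hpos _ ht')).2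
  · rw [← IsWt.fst_snd_sum r.s toReal r.eps, hyW, ← hW.sum_smul_eq hVKB]
    rfl
  · have h1 : u ⬝ᵥ y + c = ∑ p ∈ V S, W p * δ ^ p.1.card := by
      rw [hyW, hW.dot_sum]
      refine Finset.sum_congr rfl fun p hp => ?_
      rcases (hW.nonneg p).eq_or_lt with h0 | h0
      · rw [← h0, zero_mul, zero_mul]
      · rw [hpos p h0]
    have h2 := hW.sum_smul_eq hVKB fun p => (δ ^ p.1.card : ℝ)
    simp only [smul_eq_mul] at h2
    rw [h1, ← h2, Finset.sum_product]
    exact Finset.sum_congr rfl fun σ _ => by rw [Finset.sum_mul]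

variable (r) in
/-- The cells cover `Q`. -/
theorem exists_mem_cell (ν : (Fin d → ℤ) → ℤ) {y : Fin d → ℝ} (hy : y ∈ S.Q) :
    ∃ C τ, S.IsIdx ν C τ ∧ y ∈ r.cell C τ := by
  obtain ⟨δ, hδ⟩ := r.exists_isSeparating
  obtain ⟨w, g, -, -, hw, hc, hg, rfl, -⟩ := hδ.exists_rep hy
  set C := S.K.filter fun σ => 0 < w σ with hC
  have hwC : IsWt C w := hw.restrict fun σ hσ => Finset.mem_filter.2 ⟨hw.mem_of_pos hσ, hσ⟩
  have hCne : C.Nonempty := by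
    obtain ⟨σ, hσ, -⟩ := hwC.exists_pos
    exact ⟨σ, hσ⟩
  have hchain : IsChain (· ⊆ ·) (C : Set (Finset (Fin d → ℤ))) :=
    hc.mono fun σ hσ => (Finset.mem_filter.1 hσ).2
  obtain ⟨σm, hσm, hmax⟩ := exists_greatest_of_isChain hchain hCne
  obtain ⟨hσmK, hσmw⟩ := Finset.mem_filter.1 hσm
  -- The greatest member of the chain has the smallest `kap`, so a height cell inside it fits all
  -- members.
  obtain ⟨τ, q, hτ, hq, rfl, hk⟩ := exists_heightCell_kap ν (subset_Z hσmK) (hg σm hσmw)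
  refine ⟨C, τ, ⟨hCne, Finset.filter_subset _ _, hchain, hτ,
    fun σ hσ t ht => kap_anti (hmax σ hσ) (hk t ht)⟩, mem_cell'.2 ⟨w, q, hwC, hq, ?_⟩⟩
  rw [hw.sum_smul_restrict hwC]

lemma average_mem_cell (hC : C.Nonempty) (hτ : τ.Nonempty) :
    ∑ σ ∈ C, unifWt C σ • r.s σ + r.eps • ∑ t ∈ τ, unifWt τ t • toReal t ∈ r.cell C τ :=
  mem_cell'.2 ⟨_, _, isWt_unifWt hC, isWt_unifWt hτ, rfl⟩

open Filter Topology in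
/-- Each cell of the subdivision by faces of `P` is exposed for the heights `δ ^ codim`. -/
theorem IsSeparating.exists_affine_cell {δ : ℝ} (hδ : r.IsSeparating δ) (h : S.IsIdx 0 C τ) :
    ∃ u c, ∀ p ∈ V S, δ ^ p.1.card ≤ u ⬝ᵥ r.pt p + c ∧
      (δ ^ p.1.card = u ⬝ᵥ r.pt p + c ↔ p ∈ C ×ˢ τ) := by
  classical
  have hτne := h.heightCell.1
  have hw := isWt_unifWt h.nonempty
  have hq := isWt_unifWt hτne
  obtain ⟨w, g, u, c, hw', hc', hg', he, ha, hval⟩ :=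
    hδ.exists_rep (cell_subset h (average_mem_cell (r := r) h.nonempty hτne))
  -- The optimal representation of the center of the cell must be the uniform one. The supporting
  -- function at the center therefore equals the average of the heights over `C ×ˢ τ`, which forces
  -- it to touch all of these marked points.
  have hww : unifWt C = w := (rep_unique (r := r) (hw.mono h.subset_K) hw'
    (h.chain.mono fun σ hσ => hw.mem_of_pos hσ) hc'
    (fun σ hσ => hq.sum_mem_of_pos (convex_kap σ) fun t ht =>
      h.mem_kap σ (hw.mem_of_pos hσ) t (hq.mem_of_pos ht)) hg'
    (by rw [← he, hw.sum_smul_eq h.subset_K])).1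
  subst hww
  have htouch : ∀ p ∈ C ×ˢ τ, δ ^ p.1.card = u ⬝ᵥ r.pt p + c := by
    intro p hp
    refine (hw.prod hq).eq_of_sum_le (f := fun p => δ ^ p.1.card)
      (g := fun p => u ⬝ᵥ r.pt p + c) (fun p hp => ha p (h.mem_V hp)) ?_ ?_
    · rw [← (hw.prod hq).dot_sum]
      have e1 := hw.prod_sum hq r.s toReal r.eps
      change ∑ p ∈ C ×ˢ τ, (unifWt C p.1 * unifWt τ p.2) • r.pt p = _ at e1
      rw [e1, hval]
      have e2 := hw.sum_smul_eq h.subset_K fun σ => (δ ^ σ.card : ℝ)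
      simp only [smul_eq_mul] at e2
      rw [e2, Finset.sum_product]
      refine le_of_eq (Finset.sum_congr rfl fun σ _ => ?_)
      simp only
      rw [← Finset.sum_mul, ← Finset.mul_sum, hq.sum_eq, mul_one]
    · exact mul_pos (unifWt_pos (Finset.mem_product.1 hp).1)
        (unifWt_pos (Finset.mem_product.1 hp).2)
  -- tilt the affine function
  set W := (V S).filter fun p => δ ^ p.1.card = u ⬝ᵥ r.pt p + c with hW
  have hWne : W.Nonempty := by
    obtain ⟨σ, hσ⟩ := h.nonempty
    obtain ⟨t, ht⟩ := hτne
    have hp : (σ, t) ∈ C ×ˢ τ := Finset.mem_product.2 ⟨hσ, ht⟩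
    exact ⟨_, Finset.mem_filter.2 ⟨h.mem_V hp, htouch _ hp⟩⟩
  have hWpair : ∀ p ∈ W, ∀ p' ∈ W, (p.1 ⊆ p'.1 ∨ p'.1 ⊆ p.1) ∧ toReal p'.2 ∈ S.kap p.1 := by
    intro p hp p' hp'
    obtain ⟨h1, h2⟩ := Finset.mem_filter.1 hp
    obtain ⟨h1', h2'⟩ := Finset.mem_filter.1 hp'
    exact hδ.2 u c ha p h1 p' h1' h2 h2'
  obtain ⟨σm, hσm, hmax⟩ := exists_greatest_of_isChain (C := W.image Prod.fst) (by
    intro σ hσ σ' hσ' _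
    obtain ⟨p, hp, rfl⟩ := Finset.mem_image.1 (Finset.mem_coe.1 hσ)
    obtain ⟨p', hp', rfl⟩ := Finset.mem_image.1 (Finset.mem_coe.1 hσ')
    exact (hWpair p hp p' hp').1) (hWne.image _)
  obtain ⟨pm, hpm, rfl⟩ := Finset.mem_image.1 hσm
  have hWV : ∀ p ∈ W, p ∈ V S := fun p hp => (Finset.mem_filter.1 hp).1
  obtain ⟨-, u₀, c₀, hu₀, hτ₀⟩ := h.heightCell
  simp only [Pi.zero_apply, Int.cast_zero] at hu₀ hτ₀
  -- More points than `C ×ˢ τ` may be touched. The tilt is the sum of the indicator of `σ ∉ C` and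
  -- the function exposing the face `τ` of `P`, so among touched points it vanishes exactly on `C ×ˢ
  -- τ`.
  obtain ⟨u₁, c₁, hu₁⟩ := exists_affine (r := r) (mem_V.1 (hWV pm hpm)).1
    (fun σ => (if σ ∈ C then 0 else 1) + c₀) u₀ (W.image Prod.fst)
    (fun σ hσ => by
      obtain ⟨p, hp, rfl⟩ := Finset.mem_image.1 hσ
      exact (mem_V.1 (hWV p hp)).1)
    (by
      intro σ hσ σ' hσ' _
      obtain ⟨p, hp, rfl⟩ := Finset.mem_image.1 (Finset.mem_coe.1 hσ)
      obtain ⟨p', hp', rfl⟩ := Finset.mem_image.1 (Finset.mem_coe.1 hσ')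
      exact (hWpair p hp p' hp').1) hmax
  have hval₁ : ∀ p ∈ W, u₁ ⬝ᵥ r.pt p + c₁ =
      (if p.1 ∈ C then 0 else 1) + (u₀ ⬝ᵥ toReal p.2 + c₀) := by
    intro p hp
    have := hu₁ p.1 (Finset.mem_image_of_mem _ hp) (toReal p.2) (hWpair pm hpm p hp).2
    rw [pt, this]
    ring
  have hnn : ∀ p ∈ W, 0 ≤ u₁ ⬝ᵥ r.pt p + c₁ := by
    intro p hp
    rw [hval₁ p hp]
    have := hu₀ p.2 ((S.mem_B _).1 (mem_V.1 (hWV p hp)).2.1)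
    split_ifs <;> linarith
  have hzero : ∀ p ∈ W, (u₁ ⬝ᵥ r.pt p + c₁ = 0 ↔ p ∈ C ×ˢ τ) := by
    intro p hp
    have hP := (S.mem_B _).1 (mem_V.1 (hWV p hp)).2.1
    have := hu₀ p.2 hP
    rw [hval₁ p hp, Finset.mem_product, hτ₀]
    constructor
    · intro h0
      split_ifs at h0 with hpC
      · exact ⟨hpC, hP, by linarith⟩
      · linarith
    · rintro ⟨hpC, -, h0⟩
      rw [if_pos hpC, ← h0, zero_add]
  have hev : ∀ᶠ η in 𝓝[>] (0 : ℝ), ∀ p ∈ V S, p ∉ W →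
      η * -(u₁ ⬝ᵥ r.pt p + c₁) < u ⬝ᵥ r.pt p + c - δ ^ p.1.card := by
    refine (Finset.eventually_all _).2 fun p hp => ?_
    by_cases hpW : p ∈ W
    · exact Eventually.of_forall fun _ h => absurd hpW h
    · refine (eventually_small_mul_lt _ (sub_pos.2 ?_)).mono fun _ h _ => h
      exact lt_of_le_of_ne (ha p hp) fun h => hpW (Finset.mem_filter.2 ⟨hp, h⟩)
  obtain ⟨η, hη, hη0⟩ := (hev.and self_mem_nhdsWithin).exists
  have hη0 : 0 < η := hη0
  have heval : ∀ x, (u + η • u₁) ⬝ᵥ x + (c + η * c₁) =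
      u ⬝ᵥ x + c + η * (u₁ ⬝ᵥ x + c₁) := fun x => by
    rw [add_dotProduct, smul_dotProduct, smul_eq_mul]; ring
  refine ⟨u + η • u₁, c + η * c₁, fun p hp => ?_⟩
  rw [heval]
  by_cases hpW : p ∈ W
  · have h1 := (Finset.mem_filter.1 hpW).2
    have h2 := mul_nonneg hη0.le (hnn p hpW)
    refine ⟨by linarith, ?_⟩
    rw [← hzero p hpW]
    constructor
    · intro h3
      have h0 : η * (u₁ ⬝ᵥ r.pt p + c₁) = 0 := by linarith
      exact (mul_eq_zero.1 h0).resolve_left hη0.ne'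
    · intro h3
      rw [h3, h1]
      ring
  · have h1 := hη p hp hpW
    refine ⟨by linarith, fun h2 => by linarith, fun h2 => ?_⟩
    exact absurd (Finset.mem_filter.2 ⟨hp, htouch p h2⟩) hpW

/-! ### Recognizing a coherent subdivision -/

/-- A function `F` on `Q` that is affine on each cell, where the affine function is above given
heights `H` on the marked points with equality precisely at the marked points of the cell, induces
the subdivision into cells. -/
theorem coherent_of_supporting (H : Finset (Fin d → ℤ) × (Fin d → ℤ) → ℝ)
    (F : (Fin d → ℝ) → ℝ)
    (hsup : ∀ C τ, S.IsIdx ν C τ → ∃ u c, (∀ p ∈ V S, H p ≤ u ⬝ᵥ r.pt p + c ∧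
      (H p = u ⬝ᵥ r.pt p + c ↔ p ∈ C ×ˢ τ)) ∧ ∀ y ∈ r.cell C τ, F y = u ⬝ᵥ y + c) :
    IsPLConcaveOn S.Q F ∧
      coherentCells S.Q F = {X | ∃ C τ, S.IsIdx ν C τ ∧ X = r.cell C τ} := by
  classical
  choose! u c hH hF using hsup
  have hFsum : ∀ C τ, S.IsIdx ν C τ → ∀ w q, IsWt C w → IsWt τ q →
      F (∑ p ∈ C ×ˢ τ, (w p.1 * q p.2) • r.pt p) = ∑ p ∈ C ×ˢ τ, (w p.1 * q p.2) * H p := by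
    intro C τ h w q hw hq
    rw [hF C τ h _ (mem_cell.2 ⟨w, q, hw, hq, rfl⟩), (hw.prod hq).dot_sum]
    refine Finset.sum_congr rfl fun p hp => ?_
    rw [((hH C τ h p (h.mem_V hp)).2).2 hp]
  have habove : ∀ C τ, S.IsIdx ν C τ → ∀ y ∈ S.Q, F y ≤ u C τ ⬝ᵥ y + c C τ := by
    intro C τ h y hy
    obtain ⟨C', τ', h', hy'⟩ := r.exists_mem_cell ν hy
    obtain ⟨w, q, hw, hq, rfl⟩ := mem_cell.1 hy'
    rw [hFsum C' τ' h' w q hw hq, (hw.prod hq).dot_sum]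
    exact (hw.prod hq).sum_le fun p hp => (hH C τ h p (h'.mem_V hp)).1
  have hFH : ∀ p ∈ V S, H p ≤ F (r.pt p) := by
    intro p hp
    obtain ⟨C', τ', h', hy'⟩ := r.exists_mem_cell ν (pt_mem (r := r) hp)
    rw [hF C' τ' h' _ hy']
    exact (hH C' τ' h' p hp).1
  -- points where an affine function touches `F`
  have htouch : ∀ (v : Fin d → ℝ) (e : ℝ), (∀ p ∈ V S, H p ≤ v ⬝ᵥ r.pt p + e) →
      ∀ y ∈ S.Q, F y = v ⬝ᵥ y + e → ∃ C τ w q, S.IsIdx ν C τ ∧ IsWt C w ∧ IsWt τ q ∧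
        y = ∑ p ∈ C ×ˢ τ, (w p.1 * q p.2) • r.pt p ∧
        ∀ σ t, 0 < w σ → 0 < q t → H (σ, t) = v ⬝ᵥ r.pt (σ, t) + e := by
    intro v e hv y hy hye
    obtain ⟨C', τ', h', hy'⟩ := r.exists_mem_cell ν hy
    obtain ⟨w, q, hw, hq, rfl⟩ := mem_cell.1 hy'
    refine ⟨C', τ', w, q, h', hw, hq, rfl, fun σ t hσ ht => ?_⟩
    refine (hw.prod hq).eq_of_sum_le (f := H) (g := fun p => v ⬝ᵥ r.pt p + e)
      (fun p hp => hv p (h'.mem_V hp)) ?_ (i := (σ, t)) (mul_pos hσ ht)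
    rw [← (hw.prod hq).dot_sum, ← hye, hFsum C' τ' h' w q hw hq]
  have htouch_cell : ∀ (v : Fin d → ℝ) (e : ℝ) C τ, (∀ p ∈ V S, H p ≤ v ⬝ᵥ r.pt p + e) →
      (∀ p ∈ V S, H p = v ⬝ᵥ r.pt p + e → p ∈ C ×ˢ τ) →
      ∀ y ∈ S.Q, F y = v ⬝ᵥ y + e → y ∈ r.cell C τ := by
    intro v e C τ hv hCτ y hy hye
    obtain ⟨C', τ', w, q, h', hw, hq, rfl, hpos⟩ := htouch v e hv y hy hye
    have hmem : ∀ σ t, 0 < w σ → 0 < q t → (σ, t) ∈ C ×ˢ τ := fun σ t hσ ht =>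
      hCτ _ (h'.mem_V (Finset.mem_product.2 ⟨hw.mem_of_pos hσ, hq.mem_of_pos ht⟩))
        (hpos σ t hσ ht)
    obtain ⟨σ₀, -, hσ₀⟩ := hw.exists_pos
    obtain ⟨t₀, -, ht₀⟩ := hq.exists_pos
    have hw' : IsWt C w := hw.restrict fun σ hσ => (Finset.mem_product.1 (hmem σ t₀ hσ ht₀)).1
    have hq' : IsWt τ q := hq.restrict fun t ht => (Finset.mem_product.1 (hmem σ₀ t hσ₀ ht)).2
    exact mem_cell.2 ⟨w, q, hw', hq', (hw.prod hq).sum_smul_restrict (hw'.prod hq') _⟩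
  constructor
  · obtain ⟨y₀, hy₀⟩ := S.Q_nonempty
    obtain ⟨C₀, τ₀, h₀, -⟩ := r.exists_mem_cell ν hy₀
    set I := (S.K.powerset ×ˢ S.B.powerset).filter fun i => S.IsIdx ν i.1 i.2
    have hI : ∀ C τ, (C, τ) ∈ I ↔ S.IsIdx ν C τ := by
      intro C τ
      simp only [I, Finset.mem_filter, Finset.mem_product, Finset.mem_powerset,
        and_iff_right_iff_imp]
      exact fun h => ⟨h.subset_K, subset_B_of_isHeightCell h.heightCell⟩
    refine ⟨I.image fun i => (u i.1 i.2, c i.1 i.2),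
      ⟨_, Finset.mem_image_of_mem _ ((hI C₀ τ₀).2 h₀)⟩, fun x hx => ?_⟩
    refine le_antisymm ((Finset.le_inf'_iff _ _).2 fun l hl => ?_) ?_
    · obtain ⟨⟨C, τ⟩, hi, rfl⟩ := Finset.mem_image.1 hl
      exact habove C τ ((hI C τ).1 hi) x hx
    · obtain ⟨C, τ, h, hxc⟩ := r.exists_mem_cell ν hx
      rw [hF C τ h x hxc]
      exact Finset.inf'_le (fun p : (Fin d → ℝ) × ℝ => p.1 ⬝ᵥ x + p.2)
        (Finset.mem_image_of_mem _ ((hI C τ).2 h))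
  · ext X
    constructor
    · rintro ⟨⟨x, hx⟩, v, e, hv, rfl⟩
      have hvH : ∀ p ∈ V S, H p ≤ v ⬝ᵥ r.pt p + e := fun p hp =>
        (hFH p hp).trans (hv _ (pt_mem hp))
      set W := (V S).filter fun p => H p = v ⬝ᵥ r.pt p + e with hW
      have hWne : W.Nonempty := by
        obtain ⟨C', τ', w, q, h', hw, hq, -, hpos⟩ := htouch v e hvH x hx.1 hx.2
        obtain ⟨σ, hσC, hσ⟩ := hw.exists_pos
        obtain ⟨t, htτ, ht⟩ := hq.exists_pos
        exact ⟨(σ, t), Finset.mem_filter.2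
          ⟨h'.mem_V (Finset.mem_product.2 ⟨hσC, htτ⟩), hpos σ t hσ ht⟩⟩
      have hWV : ∀ p ∈ W, p ∈ V S := fun p hp => (Finset.mem_filter.1 hp).1
      have hwt := isWt_unifWt hWne
      have hy₀ : ∑ p ∈ W, unifWt W p • r.pt p ∈ S.Q :=
        hwt.sum_mem_of_pos convex_Q fun p hp => pt_mem (hWV p (hwt.mem_of_pos hp))
      -- The average of all touched marked points lies in one cell. There `F` equals that cell's
      -- affine function, and complementary slackness makes every touched marked point a marked
      -- point of this cell.
      obtain ⟨C', τ', h', hy'⟩ := r.exists_mem_cell ν hy₀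
      have hWsub : W ⊆ C' ×ˢ τ' := by
        intro p hp
        rw [← (hH C' τ' h' p (hWV p hp)).2]
        refine hwt.eq_of_sum_le (f := H) (g := fun p => u C' τ' ⬝ᵥ r.pt p + c C' τ')
          (fun p hp => (hH C' τ' h' p (hWV p hp)).1) ?_ (unifWt_pos hp)
        rw [← hwt.dot_sum, ← hF C' τ' h' _ hy']
        refine (hv _ hy₀).trans (le_of_eq ?_)
        rw [hwt.dot_sum]
        exact Finset.sum_congr rfl fun p hp => by rw [(Finset.mem_filter.1 hp).2]
      have hWmem : ∀ p, p ∈ W ↔ p ∈ C' ×ˢ τ' ∧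
          v ⬝ᵥ r.pt p + e = u C' τ' ⬝ᵥ r.pt p + c C' τ' := by
        intro p
        constructor
        · intro hp
          have hp' := hWsub hp
          exact ⟨hp', by rw [← (Finset.mem_filter.1 hp).2, (hH C' τ' h' p (hWV p hp)).2.2 hp']⟩
        · rintro ⟨hp, he⟩
          have hpV := h'.mem_V hp
          exact Finset.mem_filter.2 ⟨hpV, by rw [he, (hH C' τ' h' p hpV).2.2 hp]⟩
      have hge : ∀ p ∈ C' ×ˢ τ', u C' τ' ⬝ᵥ r.pt p + c C' τ' ≤ v ⬝ᵥ r.pt p + e := by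
        intro p hp
        rw [← (hH C' τ' h' p (h'.mem_V hp)).2.2 hp]
        exact hvH p (h'.mem_V hp)
      -- Marked points form parallelograms, as `pt (σ, t)` is a sum of a term in `σ` and a term in
      -- `t`. The gap between the two affine functions is nonnegative on `C' ×ˢ τ'`; if it vanishes
      -- at two opposite corners it vanishes at the others. Hence the touched set is a product.
      have hexch : ∀ (a : Fin d → ℝ) (b : ℝ) σ t σ' t', a ⬝ᵥ r.pt (σ, t) + b +
          (a ⬝ᵥ r.pt (σ', t') + b) = a ⬝ᵥ r.pt (σ, t') + b + (a ⬝ᵥ r.pt (σ', t) + b) := by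
        intro a b σ t σ' t'
        simp only [pt, dotProduct_add]
        ring
      have hprod : ∀ σ t σ' t', (σ, t) ∈ W → (σ', t') ∈ W → (σ, t') ∈ W := by
        intro σ t σ' t' hp hp'
        obtain ⟨h1, h2⟩ := (hWmem _).1 hp
        obtain ⟨h1', h2'⟩ := (hWmem _).1 hp'
        obtain ⟨hσ, ht⟩ := Finset.mem_product.1 h1
        obtain ⟨hσ', ht'⟩ := Finset.mem_product.1 h1'
        have h3 : (σ, t') ∈ C' ×ˢ τ' := Finset.mem_product.2 ⟨hσ, ht'⟩
        have h4 : (σ', t) ∈ C' ×ˢ τ' := Finset.mem_product.2 ⟨hσ', ht⟩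
        refine (hWmem _).2 ⟨h3, le_antisymm ?_ (hge _ h3)⟩
        have e1 := hexch v e σ t σ' t'
        have e2 := hexch (u C' τ') (c C' τ') σ t σ' t'
        linarith [hge _ h4]
      obtain ⟨⟨σ₀, t₀⟩, hp₀⟩ := hWne
      have hWeq : W = W.image Prod.fst ×ˢ W.image Prod.snd := by
        ext ⟨σ, t⟩
        rw [Finset.mem_product, Finset.mem_image, Finset.mem_image]
        constructor
        · exact fun hp => ⟨⟨_, hp, rfl⟩, ⟨_, hp, rfl⟩⟩
        · rintro ⟨⟨⟨σ', t'⟩, hp, h1⟩, ⟨⟨σ'', t''⟩, hp', h2⟩⟩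
          simp only at h1 h2
          subst h1 h2
          exact hprod _ _ _ _ hp hp'
      have hCC' : W.image Prod.fst ⊆ C' := by
        intro σ hσ
        obtain ⟨p, hp, rfl⟩ := Finset.mem_image.1 hσ
        exact (Finset.mem_product.1 (hWsub hp)).1
      have hττ' : W.image Prod.snd ⊆ τ' := by
        intro σ hσ
        obtain ⟨p, hp, rfl⟩ := Finset.mem_image.1 hσ
        exact (Finset.mem_product.1 (hWsub hp)).2
      have hσ₀ := (Finset.mem_product.1 (hWsub hp₀)).1
      -- With `σ₀` fixed, the gap is an affine function of `t` that exposes the second factor of `W`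
      -- inside `τ'`.
      have heval : ∀ t, (r.eps • (v - u C' τ')) ⬝ᵥ toReal t +
          ((v - u C' τ') ⬝ᵥ r.s σ₀ + (e - c C' τ')) =
          v ⬝ᵥ r.pt (σ₀, t) + e - (u C' τ' ⬝ᵥ r.pt (σ₀, t) + c C' τ') := by
        intro t
        simp only [pt, dotProduct_add, dotProduct_smul, smul_dotProduct, sub_dotProduct,
          smul_eq_mul]
        ring
      have hidx : S.IsIdx ν (W.image Prod.fst) (W.image Prod.snd) := by
        refine ⟨⟨σ₀, Finset.mem_image_of_mem Prod.fst hp₀⟩, hCC'.trans h'.subset_K,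
          h'.chain.mono (by exact_mod_cast hCC'), ?_,
          fun σ hσ t ht => h'.mem_kap σ (hCC' hσ) t (hττ' ht)⟩
        refine heightCell_face h'.heightCell (u' := r.eps • (v - u C' τ'))
          (c' := (v - u C' τ') ⬝ᵥ r.s σ₀ + (e - c C' τ')) (fun t ht => ?_) (fun t => ?_)
          ⟨t₀, Finset.mem_image_of_mem Prod.snd hp₀⟩
        · rw [heval]
          exact sub_nonneg.2 (hge _ (Finset.mem_product.2 ⟨hσ₀, ht⟩))
        · rw [heval, sub_eq_zero]
          constructor
          · intro ht
            obtain ⟨⟨σ, t'⟩, hp, rfl⟩ := Finset.mem_image.1 ht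
            have := (hWmem _).1 (hprod _ _ _ _ hp₀ hp)
            exact ⟨(Finset.mem_product.1 this.1).2, this.2⟩
          · rintro ⟨ht, he⟩
            exact Finset.mem_image.2
              ⟨(σ₀, t), (hWmem _).2 ⟨Finset.mem_product.2 ⟨hσ₀, ht⟩, he⟩, rfl⟩
      refine ⟨_, _, hidx, ?_⟩
      ext y
      constructor
      · rintro ⟨hy, hye⟩
        refine htouch_cell v e _ _ hvH (fun p hp he => ?_) y hy hye
        rw [← hWeq]
        exact Finset.mem_filter.2 ⟨hp, he⟩
      · intro hy
        refine ⟨cell_subset hidx hy, ?_⟩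
        obtain ⟨w, q, hw, hq, rfl⟩ := mem_cell.1 hy
        rw [hFsum _ _ hidx w q hw hq, (hw.prod hq).dot_sum]
        refine Finset.sum_congr rfl fun p hp => ?_
        rw [← hWeq] at hp
        rw [(Finset.mem_filter.1 hp).2]
    · rintro ⟨C, τ, h, rfl⟩
      refine ⟨⟨_, average_mem_cell h.nonempty h.heightCell.1⟩, u C τ, c C τ, habove C τ h, ?_⟩
      ext y
      constructor
      · exact fun hy => ⟨cell_subset h hy, hF C τ h y hy⟩
      · rintro ⟨hy, hye⟩
        exact htouch_cell (u C τ) (c C τ) C τ (fun p hp => (hH C τ h p hp).1)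
          (fun p hp he => (hH C τ h p hp).2.1 he) y hy hye

end Copies
end Setup
end MixSubdiv
namespace MixSubdiv

/-! ### The concave envelope on its cells -/

lemma heightFun_of_isHeightCell {d : ℕ} {P : Set (Fin d → ℝ)} {ν : (Fin d → ℤ) → ℤ}
    {τ : Finset (Fin d → ℤ)} {u : Fin d → ℝ} {c : ℝ}
    (hu : ∀ z, toReal z ∈ P → (ν z : ℝ) ≤ u ⬝ᵥ toReal z + c)
    (hτ : ∀ z, z ∈ τ ↔ toReal z ∈ P ∧ (ν z : ℝ) = u ⬝ᵥ toReal z + c)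
    {q : (Fin d → ℤ) → ℝ} (hq : IsWt τ q) :
    heightFun P ν (∑ t ∈ τ, q t • toReal t) = u ⬝ᵥ (∑ t ∈ τ, q t • toReal t) + c := by
  refine IsLeast.csInf_eq ⟨⟨u, c, hu, rfl⟩, ?_⟩
  rintro _ ⟨u', c', hu', rfl⟩
  rw [hq.dot_sum, hq.dot_sum]
  refine hq.sum_le fun t ht => ?_
  rw [← ((hτ t).1 ht).2]
  exact hu' t ((hτ t).1 ht).1

/-- A height cell that contains a convex combination of another height cell contains all marked
points with positive weight. -/
lemma IsHeightCell.mem_of_pos {d : ℕ} {P : Set (Fin d → ℝ)} {ν : (Fin d → ℤ) → ℤ}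
    {τ τ' : Finset (Fin d → ℤ)} (h : IsHeightCell P ν τ) (h' : IsHeightCell P ν τ')
    {q q' : (Fin d → ℤ) → ℝ} (hq : IsWt τ q) (hq' : IsWt τ' q')
    (he : ∑ t ∈ τ, q t • toReal t = ∑ t ∈ τ', q' t • toReal t) {t : Fin d → ℤ} (ht : 0 < q t) :
    t ∈ τ' := by
  obtain ⟨-, u, c, hu, hτ⟩ := h
  obtain ⟨-, u', c', hu', hτ'⟩ := h'
  have h1 := heightFun_of_isHeightCell hu hτ hq
  have h2 := heightFun_of_isHeightCell hu' hτ' hq'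
  rw [he] at h1
  rw [h1, ← he, hq.dot_sum, hq.dot_sum] at h2
  have htP := ((hτ t).1 (hq.mem_of_pos ht)).1
  refine (hτ' t).2 ⟨htP, ?_⟩
  refine hq.eq_of_sum_le (f := fun t => (ν t : ℝ)) (g := fun t => u' ⬝ᵥ toReal t + c')
    (fun t ht => hu' t ((hτ t).1 ht).1) ?_ ht
  rw [← h2]
  exact le_of_eq (Finset.sum_congr rfl fun t ht => by rw [((hτ t).1 ht).2])

lemma IsHeightCell.subset_of_simplex_subset {d : ℕ} {P : Set (Fin d → ℝ)}
    {ν : (Fin d → ℤ) → ℤ} {τ τ' : Finset (Fin d → ℤ)} (h : IsHeightCell P ν τ)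
    (h' : IsHeightCell P ν τ') (hs : simplex τ ⊆ simplex τ') : τ ⊆ τ' := by
  have hq := isWt_unifWt h.1
  obtain ⟨q', hq', he⟩ := mem_convexHull_image_finset.1
    (hs (mem_convexHull_image_finset.2 ⟨_, hq, rfl⟩))
  exact fun t ht => h.mem_of_pos h' hq hq' he (unifWt_pos ht)

namespace Setup

variable {d : ℕ} {S : Setup d} {ν : (Fin d → ℤ) → ℤ}

/-! ### Faces of `Q` and `P` -/

lemma exists_act_eq {σ : Finset (Fin d → ℤ)} (hσ : σ ∈ S.K) :
    ∃ n ∈ S.face σ, S.act n = σ := by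
  obtain ⟨n, hn, rfl⟩ := mem_K.1 hσ
  exact ⟨n, ⟨hn, fun z hz => (mem_act.1 hz).2⟩, rfl⟩

lemma subset_act {σ : Finset (Fin d → ℤ)} (hσ : σ ∈ S.K) {n : Fin d → ℝ} (hn : n ∈ S.face σ) :
    σ ⊆ S.act n := fun z hz => mem_act.2 ⟨subset_Z hσ hz, hn.2 z hz⟩

lemma face_subset_face {σ σ' : Finset (Fin d → ℤ)} (hσ : σ ∈ S.K) (hσ' : σ' ∈ S.K) :
    S.face σ ⊆ S.face σ' ↔ σ' ⊆ σ := by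
  constructor
  · intro h
    obtain ⟨n, hn, hna⟩ := exists_act_eq hσ
    rw [← hna]
    exact subset_act hσ' (h hn)
  · exact fun h n hn => ⟨hn.1, fun z hz => hn.2 z (h hz)⟩

lemma face_inj {σ σ' : Finset (Fin d → ℤ)} (hσ : σ ∈ S.K) (hσ' : σ' ∈ S.K)
    (h : S.face σ = S.face σ') : σ = σ' :=
  Finset.Subset.antisymm ((face_subset_face hσ' hσ).1 h.symm.subset)
    ((face_subset_face hσ hσ').1 h.subset)

/-- The locus in a set where finitely many bounded linear functions attain their bounds. -/
lemma maxFace_sum {X : Set (Fin d → ℝ)} {σ : Finset (Fin d → ℤ)} {b : (Fin d → ℤ) → ℝ}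
    (hX : ∀ x ∈ X, ∀ z ∈ σ, toReal z ⬝ᵥ x ≤ b z) (hne : ∃ x ∈ X, ∀ z ∈ σ, toReal z ⬝ᵥ x = b z) :
    maxFace X (∑ z ∈ σ, toReal z) = {x | x ∈ X ∧ ∀ z ∈ σ, toReal z ⬝ᵥ x = b z} := by
  obtain ⟨x₀, hx₀, h₀⟩ := hne
  ext x
  simp only [maxFace, sum_dotProduct, Set.mem_ofPred_eq]
  refine and_congr_right fun hx => ⟨fun h => ?_, fun h y hy => ?_⟩
  · refine (Finset.sum_eq_sum_iff_of_le (hX x hx)).1 (le_antisymm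
      (Finset.sum_le_sum (hX x hx)) ?_)
    rw [← Finset.sum_congr rfl h₀]
    exact h x₀ hx₀
  · rw [Finset.sum_congr rfl h]
    exact Finset.sum_le_sum (hX y hy)

lemma maxFace_Q {σ : Finset (Fin d → ℤ)} (hσ : σ ∈ S.K) :
    maxFace S.Q (∑ z ∈ σ, toReal z) = S.face σ := by
  obtain ⟨n, hn, -⟩ := exists_act_eq hσ
  exact maxFace_sum (fun x hx z hz => (S.mem_Q x).1 hx z (subset_Z hσ hz)) ⟨n, hn⟩

lemma maxFace_P {σ : Finset (Fin d → ℤ)} (hσ : σ ∈ S.K) :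
    maxFace S.P (∑ z ∈ σ, toReal z) = S.kap σ := by
  obtain ⟨x, hx⟩ := kap_nonempty hσ
  exact maxFace_sum (b := fun _ => 1)
    (fun x hx z hz => (S.mem_P x).1 hx z (subset_Z hσ hz)) ⟨x, hx⟩

lemma isFace_kap {σ : Finset (Fin d → ℤ)} (hσ : σ ∈ S.K) : IsFace S.P (S.kap σ) :=
  ⟨kap_nonempty hσ, _, (maxFace_P hσ).symm⟩

-- Among the maximizers of `u` choose `x` with the fewest tight inequalities. The midpoint with any
-- other maximizer has only the common tight ones, so all tight inequalities of `x` hold with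
-- equality on the whole maximal face. Conversely, for `y` in the face of `act x`, one can move from
-- `x` a little away from `y` inside `Q`, so maximality at `x` forces it at `y`.
open Filter Topology in
lemma isFace_Q_iff {F : Set (Fin d → ℝ)} : IsFace S.Q F ↔ ∃ σ ∈ S.K, F = S.face σ := by
  constructor
  · rintro ⟨hne, u, rfl⟩
    obtain ⟨k, hk⟩ : ∃ k, ∃ x ∈ maxFace S.Q u, (S.act x).card = k := by
      obtain ⟨x, hx⟩ := hne
      exact ⟨_, x, hx, rfl⟩
    classical
    obtain ⟨x, hx, hxk⟩ := Nat.find_spec (⟨k, hk⟩ : ∃ k, ∃ x ∈ maxFace S.Q u, (S.act x).card = k)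
    have hmin : ∀ y ∈ maxFace S.Q u, (S.act x).card ≤ (S.act y).card := by
      intro y hy
      rw [hxk]
      exact Nat.find_min' _ ⟨y, hy, rfl⟩
    refine ⟨S.act x, act_mem_K hx.1, ?_⟩
    ext y
    constructor
    · intro hy
      refine ⟨hy.1, fun z hz => ?_⟩
      have hmid : (1 / 2 : ℝ) • x + (1 / 2 : ℝ) • y ∈ maxFace S.Q u := by
        refine ⟨convex_Q hx.1 hy.1 (by norm_num) (by norm_num) (by norm_num), fun w hw => ?_⟩
        rw [dotProduct_add, dotProduct_smul, dotProduct_smul, smul_eq_mul, smul_eq_mul]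
        linarith [hx.2 w hw, hy.2 w hw]
      have hcard := hmin _ hmid
      rw [act_combo hx.1 hy.1 (by norm_num) (by norm_num) (by norm_num)] at hcard
      have := Finset.eq_of_subset_of_card_le Finset.inter_subset_left hcard
      exact (mem_act.1 (Finset.mem_of_mem_inter_right (this.symm ▸ hz))).2
    · intro hy
      refine ⟨hy.1, fun w hw => (hx.2 w hw).trans ?_⟩
      have h0 : ∀ z ∈ S.act x, toReal z ⬝ᵥ (x - y) ≤ 0 := by
        intro z hz
        rw [dotProduct_sub, (mem_act.1 hz).2, hy.2 z hz, sub_self]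
      obtain ⟨τ, ⟨hτ, -⟩, hτ0⟩ := ((small_step hx.1 h0).and self_mem_nhdsWithin).exists
      have hτ0 : 0 < τ := hτ0
      have h1 := hx.2 _ hτ
      rw [dotProduct_add, dotProduct_smul, smul_eq_mul, dotProduct_sub] at h1
      have h2 : τ * (u ⬝ᵥ x - u ⬝ᵥ y) ≤ 0 := by linarith
      by_contra! h3
      exact absurd (mul_pos hτ0 (sub_pos.2 h3)) (not_lt.2 h2)
  · rintro ⟨σ, hσ, rfl⟩
    obtain ⟨n, hn, -⟩ := exists_act_eq hσ
    exact ⟨⟨n, hn⟩, _, (maxFace_Q hσ).symm⟩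

-- A functional maximal at a point whose tight set is `σ` is, by Farkas' lemma on the feasible
-- directions, a nonnegative combination of the normals in `σ`. Each of these attains its maximum
-- `1` over `P` on `kap σ`.
open Filter Topology in
lemma kappa_face {σ : Finset (Fin d → ℤ)} (hσ : σ ∈ S.K) : kappa S.Q S.P (S.face σ) = S.kap σ := by
  ext x
  constructor
  · rintro ⟨-, h⟩
    have := h _ (maxFace_Q hσ)
    rwa [maxFace_P hσ] at this
  · refine fun hx => ⟨hx.1, fun u hu => ⟨hx.1, fun y hy => ?_⟩⟩
    obtain ⟨n, hn, hna⟩ := exists_act_eq hσ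
    have hmax : n ∈ maxFace S.Q u := hu ▸ hn
    obtain ⟨l, hl, hul⟩ := farkas σ (fun z => dotProductBilin ℝ ℝ (toReal z))
      (dotProductBilin ℝ ℝ u) (by
        intro v hv
        obtain ⟨τ, ⟨hτ, -⟩, hτ0⟩ := ((small_step hn.1 (x := v) (by
          rw [hna]; exact hv)).and self_mem_nhdsWithin).exists
        have hτ0 : 0 < τ := hτ0
        have h1 := hmax.2 _ hτ
        rw [dotProduct_add, dotProduct_smul, smul_eq_mul] at h1
        by_contra! h3
        have h3 : 0 < u ⬝ᵥ v := h3
        linarith [mul_pos hτ0 h3])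
    have hu' : ∀ v, u ⬝ᵥ v = ∑ z ∈ σ, l z * (toReal z ⬝ᵥ v) := by
      intro v
      have := LinearMap.congr_fun hul v
      simpa [dotProductBilin_apply_apply] using this
    rw [hu', hu']
    refine Finset.sum_le_sum fun z hz => mul_le_mul_of_nonneg_left ?_ (hl z hz)
    rw [hx.2 z hz]
    exact (S.mem_P y).1 hy z (subset_Z hσ hz)

open Filter Topology in
lemma mem_intrinsicInterior_face {σ : Finset (Fin d → ℤ)} (hσ : σ ∈ S.K) {x : Fin d → ℝ} :
    x ∈ intrinsicInterior ℝ (S.face σ) ↔ x ∈ S.Q ∧ S.act x = σ := by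
  constructor
  · intro hx
    have hxf := intrinsicInterior_subset hx
    refine ⟨hxf.1, Finset.Subset.antisymm (fun z hz => ?_) (subset_act hσ hxf)⟩
    obtain ⟨n, hn, hna⟩ := exists_act_eq hσ
    by_contra hzσ
    have hzZ := (mem_act.1 hz).1
    have hlt : toReal z ⬝ᵥ n < S.b z := by
      refine lt_of_le_of_ne ((S.mem_Q n).1 hn.1 z hzZ) fun h => hzσ ?_
      rw [← hna]
      exact mem_act.2 ⟨hzZ, h⟩
    obtain ⟨y, hy, rfl⟩ := mem_intrinsicInterior.1 hx
    let f : ℝ → affineSpan ℝ (S.face σ) := fun t =>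
      ⟨AffineMap.lineMap (y : Fin d → ℝ) n t,
        AffineMap.lineMap_mem t y.2 (subset_affineSpan ℝ _ hn)⟩
    have hf : Continuous f := by
      refine Continuous.subtype_mk ?_ _
      exact AffineMap.lineMap_continuous
    have hf0 : f 0 = y := by
      ext1
      simp [f]
    have hev : ∀ᶠ t in 𝓝 (0 : ℝ), f t ∈ ((↑) ⁻¹' S.face σ : Set (affineSpan ℝ (S.face σ))) := by
      refine hf.continuousAt.eventually ?_
      rw [hf0]
      exact mem_interior_iff_mem_nhds.1 hy
    -- A negative parameter goes past `y`, away from `n`. If `z` were tight at `y` but not at `n`,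
    -- it would be violated there.
    obtain ⟨t, ht, ht0⟩ := ((hev.filter_mono nhdsWithin_le_nhds).and
      (self_mem_nhdsWithin (s := Set.Iio (0 : ℝ)))).exists
    have ht0 : t < 0 := ht0
    have hft : AffineMap.lineMap (y : Fin d → ℝ) n t ∈ S.Q := ht.1
    have h1 := (S.mem_Q _).1 hft z hzZ
    rw [AffineMap.lineMap_apply_module', dotProduct_add, dotProduct_smul, smul_eq_mul,
      dotProduct_sub, (mem_act.1 hz).2] at h1
    have := mul_pos_of_neg_of_neg ht0 (sub_neg.2 hlt)
    linarith
  · rintro ⟨hxQ, hxa⟩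
    have hxf : x ∈ S.face σ := ⟨hxQ, fun z hz => by
      rw [← hxa] at hz
      exact (mem_act.1 hz).2⟩
    refine mem_intrinsicInterior.2 ⟨⟨x, subset_affineSpan ℝ _ hxf⟩,
      mem_interior_iff_mem_nhds.2 ?_, rfl⟩
    have heq : ∀ y ∈ affineSpan ℝ (S.face σ), ∀ z ∈ σ, toReal z ⬝ᵥ y = S.b z := by
      intro y hy z hz
      refine affineSpan_induction hy (fun y hy => hy.2 z hz) fun c u v w hu hv hw => ?_
      rw [vsub_eq_sub, vadd_eq_add, dotProduct_add, dotProduct_smul, dotProduct_sub, hu, hv, hw]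
      simp
    have hev : ∀ᶠ y in 𝓝 x, ∀ z ∈ S.Z, z ∉ σ → toReal z ⬝ᵥ y < S.b z := by
      refine (Finset.eventually_all S.Z).2 fun z hz => ?_
      by_cases hzσ : z ∈ σ
      · exact Eventually.of_forall fun _ h => absurd hzσ h
      · have hlt : toReal z ⬝ᵥ x < S.b z := by
          refine lt_of_le_of_ne ((S.mem_Q x).1 hxQ z hz) fun h => hzσ ?_
          rw [← hxa]
          exact mem_act.2 ⟨hz, h⟩
        have hcont : Continuous fun y : Fin d → ℝ => toReal z ⬝ᵥ y := by fun_prop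
        exact (hcont.continuousAt.eventually (gt_mem_nhds hlt)).mono fun _ h _ => h
    have hev' := (continuous_subtype_val (p := fun y => y ∈ affineSpan ℝ (S.face σ))).continuousAt
      (x := ⟨x, subset_affineSpan ℝ _ hxf⟩) |>.eventually hev
    filter_upwards [hev'] with y hy
    refine ⟨(S.mem_Q _).2 fun z hz => ?_, heq _ y.2⟩
    by_cases hzσ : z ∈ σ
    · exact (heq _ y.2 z hzσ).le
    · exact (hy z hz hzσ).le

/-- The faces of `P` are the cells of the trivial subdivision. -/
lemma isFace_P_iff {G : Set (Fin d → ℝ)} :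
    IsFace S.P G ↔ ∃ τ, IsHeightCell S.P 0 τ ∧ G = simplex τ := by
  constructor
  · rintro ⟨⟨x₀, hx₀⟩, u, rfl⟩
    set τ := S.B.filter fun t => u ⬝ᵥ toReal t = u ⬝ᵥ x₀ with hτ
    have hsimp : maxFace S.P u = simplex τ := by
      ext x
      constructor
      · intro hx
        have hxP := hx.1
        rw [S.hull_B] at hxP
        obtain ⟨q, hq, rfl⟩ := mem_convexHull_image_finset.1 hxP
        have hpos : ∀ t, 0 < q t → t ∈ τ := by
          intro t ht
          refine Finset.mem_filter.2 ⟨hq.mem_of_pos ht, ?_⟩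
          refine hq.eq_of_sum_le (f := fun t => u ⬝ᵥ toReal t) (g := fun _ => u ⬝ᵥ x₀)
            (fun t ht => hx₀.2 _ ((S.mem_B t).1 ht)) ?_ ht
          have h1 := hq.dot_sum u 0 toReal
          simp only [add_zero] at h1
          rw [← h1, ← Finset.sum_mul, hq.sum_eq, one_mul]
          exact hx.2 _ hx₀.1
        have hq' := hq.restrict hpos
        exact mem_convexHull_image_finset.2 ⟨q, hq', hq.sum_smul_restrict hq' _⟩
      · intro hx
        obtain ⟨q, hq, rfl⟩ := mem_convexHull_image_finset.1 hx
        refine ⟨hq.sum_mem_of_pos convex_P fun t ht =>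
          (S.mem_B t).1 (Finset.mem_filter.1 (hq.mem_of_pos ht)).1, fun y hy => ?_⟩
        have h1 := hq.dot_sum u 0 toReal
        simp only [add_zero] at h1
        rw [h1, Finset.sum_congr rfl fun t ht => by rw [(Finset.mem_filter.1 ht).2],
          ← Finset.sum_mul, hq.sum_eq, one_mul]
        exact hx₀.2 y hy
    refine ⟨τ, ⟨?_, -u, u ⬝ᵥ x₀, fun z hz => ?_, fun z => ?_⟩, hsimp⟩
    · have : x₀ ∈ simplex τ := hsimp ▸ hx₀
      obtain ⟨q, hq, -⟩ := mem_convexHull_image_finset.1 this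
      obtain ⟨t, ht, -⟩ := hq.exists_pos
      exact ⟨t, ht⟩
    · simp only [Pi.zero_apply, Int.cast_zero, neg_dotProduct]
      linarith [hx₀.2 _ hz]
    · simp only [hτ, Finset.mem_filter, S.mem_B, Pi.zero_apply, Int.cast_zero, neg_dotProduct]
      refine and_congr_right fun _ => ⟨fun h => by rw [h]; ring, fun h => by linarith⟩
  · rintro ⟨τ, ⟨hne, u, c, hu, hτ⟩, rfl⟩
    simp only [Pi.zero_apply, Int.cast_zero] at hu hτ
    have hP : ∀ x ∈ S.P, 0 ≤ u ⬝ᵥ x + c := by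
      intro x hx
      rw [S.hull_B] at hx
      obtain ⟨q, hq, rfl⟩ := mem_convexHull_image_finset.1 hx
      rw [hq.dot_sum]
      exact Finset.sum_nonneg fun t ht => mul_nonneg (hq.nonneg t) (hu t ((S.mem_B t).1 ht))
    obtain ⟨t₀, ht₀⟩ := hne
    refine ⟨⟨_, subset_convexHull ℝ _ ⟨t₀, ht₀, rfl⟩⟩, -u, ?_⟩
    ext x
    constructor
    · intro hx
      obtain ⟨q, hq, rfl⟩ := mem_convexHull_image_finset.1 hx
      refine ⟨hq.sum_mem_of_pos convex_P fun t ht => ((hτ t).1 (hq.mem_of_pos ht)).1,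
        fun y hy => ?_⟩
      have h0 : ∑ t ∈ τ, q t * (u ⬝ᵥ toReal t + c) = 0 :=
        Finset.sum_eq_zero fun t ht => by rw [← ((hτ t).1 ht).2, mul_zero]
      have h1 := (hq.dot_sum u c toReal).trans h0
      rw [neg_dotProduct, neg_dotProduct]
      linarith [hP y hy]
    · intro hx
      have h0 : u ⬝ᵥ x + c ≤ 0 := by
        have := hx.2 _ ((hτ t₀).1 ht₀).1
        rw [neg_dotProduct, neg_dotProduct] at this
        linarith [((hτ t₀).1 ht₀).2]
      have hxP := hx.1
      rw [S.hull_B] at hxP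
      obtain ⟨q, hq, rfl⟩ := mem_convexHull_image_finset.1 hxP
      have hpos : ∀ t, 0 < q t → t ∈ τ := by
        intro t ht
        have htP := (S.mem_B t).1 (hq.mem_of_pos ht)
        refine (hτ t).2 ⟨htP, ?_⟩
        refine hq.eq_of_sum_le (f := fun _ => 0) (g := fun t => u ⬝ᵥ toReal t + c)
          (fun t ht => hu t ((S.mem_B t).1 ht)) ?_ ht
        rw [← hq.dot_sum]
        simpa using h0
      have hq' := hq.restrict hpos
      exact mem_convexHull_image_finset.2 ⟨q, hq', hq.sum_smul_restrict hq' _⟩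

/-! ### Placements -/

open Filter Topology in
lemma nonempty_placement (S : Setup d) : Nonempty (Placement S.Q S.P) := by
  classical
  choose! n hn hna using fun σ (hσ : σ ∈ S.K) => exists_act_eq hσ
  let cQ : Set (Fin d → ℝ) → (Fin d → ℝ) := fun F =>
    if h : ∃ σ ∈ S.K, F = S.face σ then n h.choose else 0
  let cP : Set (Fin d → ℝ) → (Fin d → ℝ) := fun G => if h : G.Nonempty then h.some else 0
  have hcQ : ∀ σ ∈ S.K, cQ (S.face σ) = n σ := by
    intro σ hσ
    have h : ∃ σ' ∈ S.K, S.face σ = S.face σ' := ⟨σ, hσ, rfl⟩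
    have : h.choose = σ := (face_inj hσ h.choose_spec.1 h.choose_spec.2).symm
    simp only [cQ]
    rw [dif_pos h, this]
  have hcP : ∀ G : Set (Fin d → ℝ), G.Nonempty → cP G ∈ G := by
    intro G hG
    simp only [cP, dif_pos hG]
    exact hG.some_mem
  -- The worst case `⟨z, g⟩ = 1` over `P` reduces the requirement on the whole copy of `kap σ` to
  -- finitely many strict inequalities for `ε`.
  have hev : ∀ᶠ ε in 𝓝[>] (0 : ℝ), ∀ σ ∈ S.K, ∀ z ∈ S.Z, z ∉ σ →
      ε * (1 - toReal z ⬝ᵥ cP (S.kap σ)) < S.b z - toReal z ⬝ᵥ n σ := by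
    refine (Finset.eventually_all _).2 fun σ hσ => (Finset.eventually_all _).2 fun z hz => ?_
    by_cases hzσ : z ∈ σ
    · exact Eventually.of_forall fun _ h => absurd hzσ h
    · refine (eventually_small_mul_lt _ (sub_pos.2 ?_)).mono fun _ h _ => h
      refine lt_of_le_of_ne ((S.mem_Q _).1 (hn σ hσ).1 z hz) fun h => hzσ ?_
      rw [← hna σ hσ]
      exact mem_act.2 ⟨hz, h⟩
  obtain ⟨ε, hε, hε0⟩ := (hev.and self_mem_nhdsWithin).exists
  have hε0 : 0 < ε := hε0
  refine ⟨⟨ε, hε0, cQ, cP, fun G hG => hcP G hG.1, fun F hF g hg => ?_⟩⟩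
  obtain ⟨σ, hσ, rfl⟩ := isFace_Q_iff.1 hF
  rw [kappa_face hσ] at hg ⊢
  rw [hcQ σ hσ, mem_intrinsicInterior_face hσ]
  have hg₀ := hcP _ (kap_nonempty hσ)
  have hd : ∀ z, toReal z ⬝ᵥ (n σ + ε • (g - cP (S.kap σ))) =
      toReal z ⬝ᵥ n σ + ε * (toReal z ⬝ᵥ g - toReal z ⬝ᵥ cP (S.kap σ)) := fun z => by
    rw [dotProduct_add, dotProduct_smul, dotProduct_sub, smul_eq_mul]
  have hin : ∀ z ∈ σ, toReal z ⬝ᵥ (n σ + ε • (g - cP (S.kap σ))) = S.b z := by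
    intro z hz
    rw [hd, (hn σ hσ).2 z hz, hg.2 z hz, hg₀.2 z hz]
    ring
  have hout : ∀ z ∈ S.Z, z ∉ σ → toReal z ⬝ᵥ (n σ + ε • (g - cP (S.kap σ))) < S.b z := by
    intro z hz hzσ
    rw [hd]
    have h1 := hε σ hσ z hz hzσ
    have h2 := mul_le_mul_of_nonneg_left
      (sub_le_sub_right ((S.mem_P g).1 hg.1 z hz) (toReal z ⬝ᵥ cP (S.kap σ))) hε0.le
    linarith
  refine ⟨(S.mem_Q _).2 fun z hz => ?_, ?_⟩
  · by_cases hzσ : z ∈ σ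
    · exact (hin z hzσ).le
    · exact (hout z hz hzσ).le
  · ext z
    rw [mem_act]
    constructor
    · rintro ⟨hz, he⟩
      by_contra hzσ
      exact (hout z hz hzσ).ne he
    · exact fun hz => ⟨subset_Z hσ hz, hin z hz⟩

/-- The small copies of faces of `P` given by a placement. -/
def copies (r : Placement S.Q S.P) : S.Copies where
  eps := r.eps
  eps_pos := r.eps_pos
  s σ := r.shift (S.face σ)
  copy_mem σ hσ g hg := by
    have := r.copy_subset _ (isFace_Q_iff.2 ⟨σ, hσ, rfl⟩) g (by rwa [kappa_face hσ])
    rw [mem_intrinsicInterior_face hσ, smul_sub, add_sub_left_comm, add_comm] at this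
    exact this.1
  act_copy σ hσ g hg := by
    have := r.copy_subset _ (isFace_Q_iff.2 ⟨σ, hσ, rfl⟩) g (by rwa [kappa_face hσ])
    rw [mem_intrinsicInterior_face hσ, smul_sub, add_sub_left_comm, add_comm] at this
    exact this.2

variable {r : Placement S.Q S.P}

lemma isBsdIndex_iff {D : Set (Set (Fin d → ℝ))} {G : Set (Fin d → ℝ)} :
    IsBsdIndex S.Q S.P D G ↔ ∃ C τ, S.IsIdx 0 C τ ∧
      D = S.face '' (C : Set (Finset (Fin d → ℤ))) ∧ G = simplex τ := by
  classical
  constructor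
  · rintro ⟨hne, hface, hchain, hG, hsub⟩
    obtain ⟨τ, hτ, rfl⟩ := isFace_P_iff.1 hG
    have hD : D = S.face '' ((S.K.filter fun σ => S.face σ ∈ D : Finset _) :
        Set (Finset (Fin d → ℤ))) := by
      ext F
      constructor
      · intro hF
        obtain ⟨σ, hσ, rfl⟩ := isFace_Q_iff.1 (hface F hF)
        exact ⟨σ, Finset.mem_filter.2 ⟨hσ, hF⟩, rfl⟩
      · rintro ⟨σ, hσ, rfl⟩
        exact (Finset.mem_filter.1 hσ).2
    refine ⟨S.K.filter fun σ => S.face σ ∈ D, τ,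
      ⟨?_, Finset.filter_subset _ _, ?_, hτ, ?_⟩, hD, rfl⟩
    · obtain ⟨F, hF⟩ := hne
      rw [hD] at hF
      obtain ⟨σ, hσ, -⟩ := hF
      exact ⟨σ, hσ⟩
    · intro σ hσ σ' hσ' hne'
      obtain ⟨hσK, hσ⟩ := Finset.mem_filter.1 hσ
      obtain ⟨hσK', hσ'⟩ := Finset.mem_filter.1 hσ'
      have : S.face σ ⊆ S.face σ' ∨ S.face σ' ⊆ S.face σ :=
        hchain hσ hσ' fun h => hne' (face_inj hσK hσK' h)
      rw [face_subset_face hσK hσK', face_subset_face hσK' hσK] at this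
      exact this.symm
    · intro σ hσ t ht
      obtain ⟨hσK, hσ⟩ := Finset.mem_filter.1 hσ
      rw [← kappa_face hσK]
      exact hsub _ hσ (subset_convexHull ℝ _ ⟨t, ht, rfl⟩)
  · rintro ⟨C, τ, h, rfl, rfl⟩
    refine ⟨(Finset.coe_nonempty.2 h.nonempty).image _, ?_, ?_,
      isFace_P_iff.2 ⟨τ, h.heightCell, rfl⟩, ?_⟩
    · rintro _ ⟨σ, hσ, rfl⟩
      exact isFace_Q_iff.2 ⟨σ, h.subset_K hσ, rfl⟩
    · rintro _ ⟨σ, hσ, rfl⟩ _ ⟨σ', hσ', rfl⟩ hne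
      have := h.chain hσ hσ' fun he => hne (he ▸ rfl)
      change S.face σ ⊆ S.face σ' ∨ S.face σ' ⊆ S.face σ
      rw [face_subset_face (h.subset_K hσ) (h.subset_K hσ'),
        face_subset_face (h.subset_K hσ') (h.subset_K hσ)]
      exact this.symm
    · rintro _ ⟨σ, hσ, rfl⟩
      rw [kappa_face (h.subset_K hσ)]
      refine convexHull_min ?_ (convex_kap σ)
      rintro _ ⟨t, ht, rfl⟩
      exact h.mem_kap σ hσ t ht

lemma cell_copies (C : Finset (Finset (Fin d → ℤ))) (τ : Finset (Fin d → ℤ)) :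
    (copies r).cell C τ = convexHull ℝ (r.shift '' (S.face '' (C : Set (Finset (Fin d → ℤ))))) +
      r.eps • simplex τ := by
  rw [Set.image_image]
  rfl

lemma bsdCells_eq : bsdCells r = {X | ∃ C τ, S.IsIdx 0 C τ ∧ X = (copies r).cell C τ} := by
  ext X
  constructor
  · rintro ⟨D, G, h, rfl⟩
    obtain ⟨C, τ, h', rfl, rfl⟩ := isBsdIndex_iff.1 h
    exact ⟨C, τ, h', (cell_copies C τ).symm⟩
  · rintro ⟨C, τ, h, rfl⟩
    exact ⟨_, _, isBsdIndex_iff.2 ⟨C, τ, h, rfl, rfl⟩, cell_copies C τ⟩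

/-- The subdivision `bsd(Q; P)` is coherent. -/
theorem exists_isAdapted (r : Placement S.Q S.P) : ∃ ψ, IsAdapted r ψ := by
  classical
  obtain ⟨δ, hδ⟩ := (copies r).exists_isSeparating
  choose! u c huc using fun C τ (h : S.IsIdx 0 C τ) => hδ.exists_affine_cell h
  set I := (S.K.powerset ×ˢ S.B.powerset).filter fun i => S.IsIdx 0 i.1 i.2
  have hI : ∀ C τ, (C, τ) ∈ I ↔ S.IsIdx 0 C τ := by
    intro C τ
    simp only [I, Finset.mem_filter, Finset.mem_product, Finset.mem_powerset,
      and_iff_right_iff_imp]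
    exact fun h => ⟨h.subset_K, subset_B_of_isHeightCell h.heightCell⟩
  have hIne : I.Nonempty := by
    obtain ⟨y₀, hy₀⟩ := S.Q_nonempty
    obtain ⟨C₀, τ₀, h₀, -⟩ := (copies r).exists_mem_cell 0 hy₀
    exact ⟨_, (hI C₀ τ₀).2 h₀⟩
  -- On each cell its own exposing function is the least one: it touches the heights at the marked
  -- points of the cell, where all the others lie above.
  refine ⟨fun y => I.inf' hIne fun i => u i.1 i.2 ⬝ᵥ y + c i.1 i.2, ?_⟩
  rw [IsAdapted, bsdCells_eq]
  refine Copies.coherent_of_supporting (fun p => δ ^ p.1.card) _ fun C τ h =>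
    ⟨u C τ, c C τ, huc C τ h, fun y hy => ?_⟩
  refine le_antisymm (Finset.inf'_le (fun i : Finset (Finset (Fin d → ℤ)) × Finset (Fin d → ℤ) =>
    u i.1 i.2 ⬝ᵥ y + c i.1 i.2) ((hI C τ).2 h)) ((Finset.le_inf'_iff _ _).2 ?_)
  rintro ⟨C', τ'⟩ hi
  have h' := (hI C' τ').1 hi
  obtain ⟨w, q, hw, hq, rfl⟩ := Copies.mem_cell.1 hy
  rw [(hw.prod hq).dot_sum, (hw.prod hq).dot_sum]
  refine (hw.prod hq).sum_le fun p hp => ?_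
  rw [← ((huc C τ h p (h.mem_V hp)).2).2 hp]
  exact (huc C' τ' h' p (h.mem_V hp)).1

/-! ### The function `N ψ + ν̃` -/

/-- Enlarging `τ` to all of `kap σm`, for the greatest member `σm` of the chain, gives a cell of
`bsd(Q; P)` that contains the fine cell. -/
lemma exists_idx_zero {C : Finset (Finset (Fin d → ℤ))} {τ : Finset (Fin d → ℤ)}
    (h : S.IsIdx ν C τ) : ∃ σm ∈ C, (∀ σ ∈ C, σ ⊆ σm) ∧ ∃ τ₀, S.IsIdx 0 C τ₀ ∧
      simplex τ₀ = S.kap σm := by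
  obtain ⟨σm, hσm, hmax⟩ := exists_greatest_of_isChain h.chain h.nonempty
  obtain ⟨τ₀, hτ₀, he⟩ := isFace_P_iff.1 (isFace_kap (h.subset_K hσm))
  refine ⟨σm, hσm, hmax, τ₀, ⟨h.nonempty, h.subset_K, h.chain, hτ₀, fun σ hσ t ht => ?_⟩, he.symm⟩
  refine kap_anti (hmax σ hσ) ?_
  rw [he]
  exact subset_convexHull ℝ _ ⟨t, ht, rfl⟩

/-- Uniqueness of representations makes the set in `tildeFun` a singleton, so its supremum is the
intended value. -/
lemma tildeFun_eq {C : Finset (Finset (Fin d → ℤ))} {τ : Finset (Fin d → ℤ)}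
    (h : S.IsIdx ν C τ) (f : (Fin d → ℝ) → ℝ) {w : Finset (Fin d → ℤ) → ℝ} {q : (Fin d → ℤ) → ℝ}
    (hw : IsWt C w) (hq : IsWt τ q) :
    tildeFun r f (∑ σ ∈ C, w σ • (copies r).s σ + r.eps • ∑ t ∈ τ, q t • toReal t) =
      f (∑ t ∈ τ, q t • toReal t) := by
  rw [tildeFun]
  refine (congrArg sSup ?_).trans (csSup_singleton (f (∑ t ∈ τ, q t • toReal t)))
  ext a
  rw [Set.mem_singleton_iff]
  constructor
  · rintro ⟨D, G, hDG, x, hx, g, hg, hy, rfl⟩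
    obtain ⟨C', τ', h', rfl, rfl⟩ := isBsdIndex_iff.1 hDG
    rw [Set.image_image, mem_convexHull_image_finset] at hx
    obtain ⟨w', hw', rfl⟩ := hx
    obtain ⟨q', hq', rfl⟩ := mem_convexHull_image_finset.1 hg
    rw [(Copies.cell_unique (r := copies r) h h' hw hq hw' hq' hy).2]
  · rintro rfl
    obtain ⟨σm, hσm, hmax, τ₀, h₀, he⟩ := exists_idx_zero h
    refine ⟨_, _, isBsdIndex_iff.2 ⟨C, τ₀, h₀, rfl, rfl⟩, ∑ σ ∈ C, w σ • (copies r).s σ, ?_,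
      ∑ t ∈ τ, q t • toReal t, ?_, rfl, rfl⟩
    · rw [Set.image_image, mem_convexHull_image_finset]
      exact ⟨w, hw, rfl⟩
    · rw [he]
      exact hq.sum_mem_of_pos (convex_kap σm) fun t ht => h.mem_kap σm hσm t (hq.mem_of_pos ht)

lemma of_pt_mem_cell {r : S.Copies} {C : Finset (Finset (Fin d → ℤ))} {τ : Finset (Fin d → ℤ)}
    (h : S.IsIdx ν C τ) {p : Finset (Fin d → ℤ) × (Fin d → ℤ)} (hp : p ∈ Copies.V S)
    (hmem : r.pt p ∈ r.cell C τ) : p.1 ∈ C ∧ toReal p.2 ∈ simplex τ := by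
  classical
  obtain ⟨hpK, hpB, hpk⟩ := Copies.mem_V.1 hp
  obtain ⟨w, q, hw, hq, he⟩ := Copies.mem_cell'.1 hmem
  have hsing := IsWt.single hpK
  have hpos : ∀ σ, 0 < (if σ = p.1 then (1 : ℝ) else 0) → σ = p.1 := by
    intro σ hσ
    by_contra hn
    rw [if_neg hn] at hσ
    exact lt_irrefl _ hσ
  obtain ⟨h1, h2⟩ := Copies.rep_unique (r := r) hsing (hw.mono h.subset_K)
    (g := toReal p.2) (g' := ∑ t ∈ τ, q t • toReal t)
    (fun σ hσ σ' hσ' hne => absurd ((hpos σ hσ).trans (hpos σ' hσ').symm) hne)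
    (h.chain.mono fun σ hσ => hw.mem_of_pos hσ)
    (fun σ hσ => by rwa [hpos σ hσ])
    (fun σ hσ => hq.sum_mem_of_pos (convex_kap σ) fun t ht =>
      h.mem_kap σ (hw.mem_of_pos hσ) t (hq.mem_of_pos ht)) (by
    rw [hw.sum_smul_eq h.subset_K, ← he]
    simp [hpK, Copies.pt])
  refine ⟨hw.mem_of_pos ?_, ?_⟩
  · rw [← h1]
    simp
  · rw [h2]
    exact mem_convexHull_image_finset.2 ⟨q, hq, rfl⟩

open Filter Topology in
/-- For large `N`, the function `N ψ + ν̃` induces the common refinement. -/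
theorem eventually_coherentCells {ψ : (Fin d → ℝ) → ℝ} (hψ : IsAdapted r ψ)
    (ν : (Fin d → ℤ) → ℤ) : ∀ᶠ N in (atTop : Filter ℝ),
      IsPLConcaveOn S.Q (fun x => N * ψ x + tildeFun r (heightFun S.P ν) x) ∧
      coherentCells S.Q (fun x => N * ψ x + tildeFun r (heightFun S.P ν) x) =
        {X | ∃ C τ, S.IsIdx ν C τ ∧ X = (copies r).cell C τ} := by
  classical
  have key : ∀ C τ, S.IsIdx ν C τ → ∀ᶠ N in (atTop : Filter ℝ), ∃ u c,
      (∀ p ∈ Copies.V S, N * ψ ((copies r).pt p) + ν p.2 ≤ u ⬝ᵥ (copies r).pt p + c ∧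
        (N * ψ ((copies r).pt p) + ν p.2 = u ⬝ᵥ (copies r).pt p + c ↔ p ∈ C ×ˢ τ)) ∧
      ∀ y ∈ (copies r).cell C τ,
        N * ψ y + tildeFun r (heightFun S.P ν) y = u ⬝ᵥ y + c := by
    intro C τ h
    obtain ⟨σm, hσm, hmax, τ₀, h₀, he⟩ := exists_idx_zero h
    have hcell : (copies r).cell C τ₀ ∈ coherentCells S.Q ψ := by
      rw [hψ.2, bsdCells_eq]
      exact ⟨C, τ₀, h₀, rfl⟩
    obtain ⟨-, u₀, c₀, hle, hcell⟩ := hcell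
    obtain ⟨-, uτ, cτ, hu, hτ⟩ := h.heightCell
    -- This function copies the one exposing `τ` in the direction of `P` and is constant along the
    -- chain. On the coarse cell it separates `C ×ˢ τ` from the other marked points; at marked
    -- points off the coarse cell its sign is unknown.
    obtain ⟨u₁, c₁, hu₁⟩ := Copies.exists_affine (r := copies r) (h.subset_K hσm)
      (fun _ => cτ) uτ C h.subset_K h.chain hmax
    have hstrict : ∀ p ∈ Copies.V S, (copies r).pt p ∉ (copies r).cell C τ₀ →
        0 < u₀ ⬝ᵥ (copies r).pt p + c₀ - ψ ((copies r).pt p) := by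
      intro p hp hpc
      have hpQ := Copies.pt_mem (r := copies r) hp
      refine sub_pos.2 (lt_of_le_of_ne (hle _ hpQ) fun h => hpc ?_)
      rw [hcell]
      exact ⟨hpQ, h⟩
    -- Off the coarse cell the gap of `ψ` is strictly positive, and `N` times it outweighs the error
    -- of `u₁` at the finitely many marked points.
    have hev : ∀ᶠ N in (atTop : Filter ℝ), ∀ p ∈ Copies.V S,
        (copies r).pt p ∉ (copies r).cell C τ₀ → ν p.2 - (u₁ ⬝ᵥ (copies r).pt p + c₁) <
          N * (u₀ ⬝ᵥ (copies r).pt p + c₀ - ψ ((copies r).pt p)) := by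
      refine (Finset.eventually_all _).2 fun p hp => ?_
      by_cases hpc : (copies r).pt p ∈ (copies r).cell C τ₀
      · exact Eventually.of_forall fun _ h => absurd hpc h
      · exact ((tendsto_id.atTop_mul_const (hstrict p hp hpc)).eventually_gt_atTop _).mono
          fun _ h _ => h
    filter_upwards [hev] with N hN
    have heval : ∀ x, (N • u₀ + u₁) ⬝ᵥ x + (N * c₀ + c₁) =
        N * (u₀ ⬝ᵥ x + c₀) + (u₁ ⬝ᵥ x + c₁) := fun x => by
      rw [add_dotProduct, smul_dotProduct, smul_eq_mul]; ring
    have hsub : ∀ p ∈ C ×ˢ τ, (copies r).pt p ∈ (copies r).cell C τ₀ := by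
      intro p hp
      obtain ⟨h1, h2⟩ := Finset.mem_product.1 hp
      refine Set.add_mem_add (subset_convexHull ℝ _ ⟨p.1, h1, rfl⟩)
        (Set.smul_mem_smul_set ?_)
      rw [he]
      exact h.mem_kap σm hσm _ h2
    refine ⟨N • u₀ + u₁, N * c₀ + c₁, fun p hp => ?_, fun y hy => ?_⟩
    · rw [heval]
      by_cases hpc : (copies r).pt p ∈ (copies r).cell C τ₀
      · obtain ⟨hpC, hps⟩ := of_pt_mem_cell h₀ hp hpc
        rw [he] at hps
        have hψp : ψ ((copies r).pt p) = u₀ ⬝ᵥ (copies r).pt p + c₀ := by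
          rw [hcell] at hpc
          exact hpc.2
        have h₁ : u₁ ⬝ᵥ (copies r).pt p + c₁ = uτ ⬝ᵥ toReal p.2 + cτ :=
          (hu₁ p.1 hpC _ hps).trans (add_comm _ _)
        rw [hψp, h₁]
        refine ⟨by linarith [hu p.2 hps.1], ?_⟩
        rw [add_right_inj, Finset.mem_product, hτ]
        exact ⟨fun h => ⟨hpC, hps.1, h⟩, fun h => h.2.2⟩
      · have := hN p hp hpc
        rw [mul_sub] at this
        exact ⟨by linarith, fun h => by linarith, fun h => absurd (hsub p h) hpc⟩
    · rw [heval]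
      obtain ⟨w, q, hw, hq, rfl⟩ := Copies.mem_cell'.1 hy
      have hyc : ∑ σ ∈ C, w σ • (copies r).s σ + (copies r).eps • ∑ t ∈ τ, q t • toReal t ∈
          (copies r).cell C τ₀ := by
        refine Set.add_mem_add (mem_convexHull_image_finset.2 ⟨w, hw, rfl⟩)
          (Set.smul_mem_smul_set ?_)
        rw [he]
        exact hq.sum_mem_of_pos (convex_kap σm) fun t ht =>
          h.mem_kap σm hσm t (hq.mem_of_pos ht)
      rw [hcell] at hyc
      rw [hyc.2]
      congr 1
      refine (tildeFun_eq h _ hw hq).trans ?_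
      rw [heightFun_of_isHeightCell hu hτ hq, hq.dot_sum,
        ← hw.prod_sum hq (copies r).s toReal (copies r).eps, (hw.prod hq).dot_sum,
        Finset.sum_product]
      have : ∀ σ ∈ C, ∑ t ∈ τ, w σ * q t *
          (u₁ ⬝ᵥ ((copies r).s σ + (copies r).eps • toReal t) + c₁) =
          w σ * ∑ t ∈ τ, q t * (uτ ⬝ᵥ toReal t + cτ) := by
        intro σ hσ
        rw [Finset.mul_sum]
        refine Finset.sum_congr rfl fun t ht => ?_
        rw [hu₁ σ hσ _ (h.mem_kap σm hσm t ht)]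
        ring
      rw [Finset.sum_congr rfl this, ← Finset.sum_mul, hw.sum_eq, one_mul]
  have hall : ∀ᶠ N in (atTop : Filter ℝ), ∀ i ∈ S.K.powerset ×ˢ S.B.powerset,
      S.IsIdx ν i.1 i.2 → ∃ u c,
      (∀ p ∈ Copies.V S, N * ψ ((copies r).pt p) + ν p.2 ≤ u ⬝ᵥ (copies r).pt p + c ∧
        (N * ψ ((copies r).pt p) + ν p.2 = u ⬝ᵥ (copies r).pt p + c ↔ p ∈ i.1 ×ˢ i.2)) ∧
      ∀ y ∈ (copies r).cell i.1 i.2,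
        N * ψ y + tildeFun r (heightFun S.P ν) y = u ⬝ᵥ y + c := by
    refine (Finset.eventually_all _).2 fun i _ => ?_
    by_cases h : S.IsIdx ν i.1 i.2
    · exact (key _ _ h).mono fun _ hN _ => hN
    · exact Eventually.of_forall fun _ h' => absurd h' h
  filter_upwards [hall] with N hN
  refine Copies.coherent_of_supporting (fun p => N * ψ ((copies r).pt p) + ν p.2) _
    fun C τ h => hN (C, τ) ?_ h
  exact Finset.mem_product.2 ⟨Finset.mem_powerset.2 h.subset_K,
    Finset.mem_powerset.2 (subset_B_of_isHeightCell h.heightCell)⟩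

end Setup
end MixSubdiv
namespace MixSubdiv

/-! ### Interior, frontier and lattice points of sets bounded by linear inequalities -/

lemma toReal_zero {d : ℕ} : toReal (0 : Fin d → ℤ) = 0 := by
  ext i
  simp [toReal]

lemma toReal_ne_zero {d : ℕ} {z : Fin d → ℤ} (hz : z ≠ 0) : toReal z ≠ 0 := by
  intro h
  refine hz (funext fun i => ?_)
  have := congrFun h i
  simpa [toReal] using this

lemma dotProduct_self_pos' {d : ℕ} {v : Fin d → ℝ} (hv : v ≠ 0) : 0 < v ⬝ᵥ v := by
  refine lt_of_le_of_ne (Finset.sum_nonneg fun i _ => mul_self_nonneg _) fun h => hv ?_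
  exact dotProduct_self_eq_zero.1 h.symm

open Filter Topology in
/-- A point where a nonzero linear function is maximal is not an interior point. -/
lemma notMem_interior {d : ℕ} {X : Set (Fin d → ℝ)} {m x : Fin d → ℝ} {c : ℝ}
    (hX : ∀ y ∈ X, m ⬝ᵥ y ≤ c) (hm : m ≠ 0) (hx : m ⬝ᵥ x = c) : x ∉ interior X := by
  intro hint
  have hcont : Continuous fun t : ℝ => x + t • m := by fun_prop
  have hev : ∀ᶠ t in 𝓝 (0 : ℝ), x + t • m ∈ X := by
    refine hcont.continuousAt.eventually (p := fun y => y ∈ X) ?_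
    simpa using mem_interior_iff_mem_nhds.1 hint
  obtain ⟨t, ht, ht0⟩ := ((hev.filter_mono nhdsWithin_le_nhds).and
    (self_mem_nhdsWithin (s := Set.Ioi (0 : ℝ)))).exists
  have ht0 : 0 < t := ht0
  have := hX _ ht
  rw [dotProduct_add, dotProduct_smul, smul_eq_mul, hx] at this
  linarith [mul_pos ht0 (dotProduct_self_pos' hm)]

lemma mem_frontier_of_dot_eq {d : ℕ} {X : Set (Fin d → ℝ)} {m x : Fin d → ℝ} {c : ℝ}
    (hX : ∀ y ∈ X, m ⬝ᵥ y ≤ c) (hm : m ≠ 0) (hxX : x ∈ X) (hx : m ⬝ᵥ x = c) : x ∈ frontier X :=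
  ⟨subset_closure hxX, notMem_interior hX hm hx⟩

lemma mem_interior_of_dot_lt {α : Type*} {d : ℕ} {X : Set (Fin d → ℝ)} {I : Finset α}
    {m : α → Fin d → ℝ} {c : α → ℝ} (hX : ∀ y, (∀ i ∈ I, m i ⬝ᵥ y ≤ c i) → y ∈ X) {x : Fin d → ℝ}
    (hx : ∀ i ∈ I, m i ⬝ᵥ x < c i) : x ∈ interior X := by
  refine mem_interior_iff_mem_nhds.2 ?_
  have : ∀ᶠ y in nhds x, ∀ i ∈ I, m i ⬝ᵥ y < c i := by
    refine (Finset.eventually_all I).2 fun i hi => ?_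
    have hcont : Continuous fun y : Fin d → ℝ => m i ⬝ᵥ y := by fun_prop
    exact hcont.continuousAt.eventually (gt_mem_nhds (hx i hi))
  filter_upwards [this] with y hy
  exact hX y fun i hi => (hy i hi).le

lemma finite_lattice_points {d : ℕ} {X : Set (Fin d → ℝ)} (hX : Bornology.IsBounded X) :
    {z : Fin d → ℤ | toReal z ∈ X}.Finite := by
  obtain ⟨R, hR⟩ := hX.subset_closedBall 0
  refine (Set.finite_Icc (fun _ : Fin d => -⌈R⌉) (fun _ => ⌈R⌉)).subset fun z hz => ?_
  have h1 : ‖toReal z‖ ≤ R := by simpa using hR hz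
  have h2 : ∀ i, |(z i : ℝ)| ≤ R := fun i => (norm_le_pi_norm (toReal z) i).trans h1
  constructor
  · intro i
    have : -((⌈R⌉ : ℤ) : ℝ) ≤ z i := by linarith [(abs_le.1 (h2 i)).1, Int.le_ceil R]
    exact_mod_cast this
  · intro i
    have : (z i : ℝ) ≤ ((⌈R⌉ : ℤ) : ℝ) := (abs_le.1 (h2 i)).2.trans (Int.le_ceil R)
    exact_mod_cast this

/-! ### Reflexive polytopes -/

namespace IsReflexive

variable {d : ℕ} {P : Set (Fin d → ℝ)}

lemma isCompact (hP : IsReflexive P) : IsCompact P := by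
  obtain ⟨A, rfl⟩ := hP.isLatticePolytope
  exact (A.finite_toSet.image _).isCompact_convexHull ℝ

lemma convex (hP : IsReflexive P) : Convex ℝ P := by
  obtain ⟨A, rfl⟩ := hP.isLatticePolytope
  exact convex_convexHull ℝ _

lemma zero_mem (hP : IsReflexive P) : (0 : Fin d → ℝ) ∈ P := interior_subset hP.zero_mem_interior

lemma mem_dual_iff {A : Finset (Fin d → ℤ)}
    (hA : P = convexHull ℝ (toReal '' (A : Set (Fin d → ℤ)))) {m : Fin d → ℝ} :
    m ∈ dualPolytope P ↔ ∀ a ∈ A, toReal a ⬝ᵥ m ≤ 1 := by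
  constructor
  · intro hm a ha
    rw [dotProduct_comm]
    exact hm _ (hA ▸ subset_convexHull ℝ _ ⟨a, ha, rfl⟩)
  · intro hm n hn
    rw [hA] at hn
    obtain ⟨q, hq, rfl⟩ := mem_convexHull_image_finset.1 hn
    have h1 := hq.dot_sum m 0 toReal
    simp only [add_zero] at h1
    rw [h1]
    calc _ ≤ ∑ a ∈ A, q a * 1 := hq.sum_le fun a ha => by rw [dotProduct_comm]; exact hm a ha
      _ = 1 := by rw [← Finset.sum_mul, hq.sum_eq, one_mul]

lemma isBounded_dual (hP : IsReflexive P) : Bornology.IsBounded (dualPolytope P) := by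
  obtain ⟨ε, hε, hball⟩ := Metric.isOpen_iff.1 isOpen_interior 0 hP.zero_mem_interior
  refine (Metric.isBounded_closedBall (x := (0 : Fin d → ℝ)) (r := 2 / ε)).subset fun m hm => ?_
  have hmem : ∀ i (s : ℝ), |s| < ε → m i * s ≤ 1 := by
    intro i s hs
    have : Pi.single i s ∈ P := by
      refine interior_subset (hball ?_)
      rw [mem_ball_zero_iff, Pi.norm_single]
      exact hs
    have := hm _ this
    rwa [dotProduct_single] at this
  rw [mem_closedBall_zero_iff, pi_norm_le_iff_of_nonneg (by positivity)]
  intro i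
  rw [Real.norm_eq_abs, abs_le]
  have h1 := hmem i (ε / 2) (by rw [abs_of_pos (by positivity)]; linarith)
  have h2 := hmem i (-(ε / 2)) (by rw [abs_neg, abs_of_pos (by positivity)]; linarith)
  constructor
  · rw [neg_le, le_div_iff₀ hε]; linarith
  · rw [le_div_iff₀ hε]; linarith

lemma convex_dual : Convex ℝ (dualPolytope P) := by
  intro x hx y hy a a' ha ha' haa n hn
  rw [add_dotProduct, smul_dotProduct, smul_dotProduct, smul_eq_mul, smul_eq_mul]
  have h1 := mul_le_mul_of_nonneg_left (hx n hn) ha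
  have h2 := mul_le_mul_of_nonneg_left (hy n hn) ha'
  linarith

lemma isClosed_dual : IsClosed (dualPolytope P) := by
  have : dualPolytope P = ⋂ n ∈ P, {m | m ⬝ᵥ n ≤ 1} := by
    ext m
    simp [dualPolytope]
  rw [this]
  refine isClosed_biInter fun n _ => isClosed_le ?_ continuous_const
  fun_prop

lemma isCompact_dual (hP : IsReflexive P) : IsCompact (dualPolytope P) :=
  Metric.isCompact_of_isClosed_isBounded isClosed_dual hP.isBounded_dual

/-- The dual of a reflexive polytope is the convex hull of its lattice points. -/
lemma dual_eq_convexHull (hP : IsReflexive P) {Z : Finset (Fin d → ℤ)}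
    (hZ : ∀ z, z ∈ Z ↔ toReal z ∈ dualPolytope P) :
    dualPolytope P = convexHull ℝ (toReal '' (Z : Set (Fin d → ℤ))) := by
  refine Set.Subset.antisymm ?_ (convexHull_min ?_ convex_dual)
  -- By Krein–Milman the dual is the closed hull of its extreme points, which are lattice points by
  -- reflexivity.
  · rw [← closure_convexHull_extremePoints hP.isCompact_dual convex_dual]
    refine closure_minimal (convexHull_mono ?_)
      ((Z.finite_toSet.image _).isClosed_convexHull ℝ)
    intro m hm
    obtain ⟨z, rfl⟩ := hP.dual_vertices hm
    exact ⟨z, (hZ z).2 hm.1, rfl⟩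
  · rintro _ ⟨z, hz, rfl⟩
    exact (hZ z).1 hz

/-- The bipolar theorem: a separating functional is positive on its bound because `0 ∈ P`, so it can
be scaled into the dual. -/
lemma mem_iff_forall_dual (hP : IsReflexive P) {x : Fin d → ℝ} :
    x ∈ P ↔ ∀ m ∈ dualPolytope P, m ⬝ᵥ x ≤ 1 := by
  refine ⟨fun hx m hm => hm x hx, fun h => ?_⟩
  by_contra hx
  obtain ⟨f, s, hf, hs⟩ := geometric_hahn_banach_closed_point hP.convex hP.isCompact.isClosed hx
  have hs0 : 0 < s := by simpa using hf 0 hP.zero_mem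
  have hdot : ∀ y, f y = (fun i => f (Pi.single i 1)) ⬝ᵥ y := by
    intro y
    have h1 : y = ∑ i, y i • (Pi.single i (1 : ℝ) : Fin d → ℝ) := by
      ext j
      simp [Finset.sum_apply, Pi.single_apply]
    conv_lhs => rw [h1]
    rw [map_sum]
    simp only [map_smul, smul_eq_mul, dotProduct]
    exact Finset.sum_congr rfl fun i _ => mul_comm _ _
  have hm : s⁻¹ • (fun i => f (Pi.single i 1)) ∈ dualPolytope P := by
    intro n hn
    rw [smul_dotProduct, ← hdot, smul_eq_mul, inv_mul_le_iff₀ hs0, mul_one]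
    exact (hf n hn).le
  have := h _ hm
  rw [smul_dotProduct, ← hdot, smul_eq_mul, inv_mul_le_iff₀ hs0, mul_one] at this
  linarith

lemma zero_mem_dual : (0 : Fin d → ℝ) ∈ dualPolytope P := fun n _ => by simp

lemma zero_mem_interior_dual (hP : IsReflexive P) :
    (0 : Fin d → ℝ) ∈ interior (dualPolytope P) := by
  obtain ⟨A, hA⟩ := hP.isLatticePolytope
  exact mem_interior_of_dot_lt (fun y hy => (mem_dual_iff hA).2 hy) fun a _ => by simp

-- A small multiple of `v` lies in the dual and is a convex combination of its lattice points. As it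
-- pairs positively with `v`, so does one of them. For the height polytope this gives boundedness.
open Filter Topology in
lemma exists_lattice_point_pos (hP : IsReflexive P) {Z : Finset (Fin d → ℤ)}
    (hZ : ∀ z, z ∈ Z ↔ toReal z ∈ dualPolytope P) {v : Fin d → ℝ} (hv : v ≠ 0) :
    ∃ z ∈ Z, 0 < toReal z ⬝ᵥ v := by
  obtain ⟨A, hA⟩ := hP.isLatticePolytope
  have hev : ∀ᶠ t in 𝓝[>] (0 : ℝ), ∀ a ∈ A, t * (toReal a ⬝ᵥ v) < 1 :=
    (Finset.eventually_all A).2 fun a _ => eventually_small_mul_lt _ one_pos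
  obtain ⟨t, ht, ht0⟩ := (hev.and self_mem_nhdsWithin).exists
  have ht0 : 0 < t := ht0
  have hmem : t • v ∈ dualPolytope P := (mem_dual_iff hA).2 fun a ha => by
    rw [dotProduct_smul, smul_eq_mul]
    exact (ht a ha).le
  rw [hP.dual_eq_convexHull hZ] at hmem
  obtain ⟨q, hq, he⟩ := mem_convexHull_image_finset.1 hmem
  by_contra! hall
  have h1 := hq.dot_sum v 0 toReal
  simp only [add_zero] at h1
  rw [← he, dotProduct_smul, smul_eq_mul] at h1
  have h2 : ∑ z ∈ Z, q z * (v ⬝ᵥ toReal z) ≤ 0 := Finset.sum_nonpos fun z hz => by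
    rw [dotProduct_comm]
    exact mul_nonpos_of_nonneg_of_nonpos (hq.nonneg z) (hall z hz)
  linarith [mul_pos ht0 (dotProduct_self_pos' hv)]

end IsReflexive

/-! ### Central triangulations -/

section Central

variable {d : ℕ} {P : Set (Fin d → ℝ)} {w : (Fin d → ℤ) → ℤ}

/-- The dictionary between cells and points of `Q`: an affine function supporting `w` and touching
at the origin has constant term `w 0`, and its slope is minus a point of the height polytope.
`isHeightCell_insert_zero` is the converse. -/
lemma IsHeightCell.neg_mem_heightPolytope {σ : Finset (Fin d → ℤ)} {u : Fin d → ℝ} {c : ℝ}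
    (hu : ∀ z, toReal z ∈ P → (w z : ℝ) ≤ u ⬝ᵥ toReal z + c)
    (hσ : ∀ z, z ∈ σ ↔ toReal z ∈ P ∧ (w z : ℝ) = u ⬝ᵥ toReal z + c) (h0 : 0 ∈ σ) :
    c = w 0 ∧ -u ∈ heightPolytope P w := by
  have hc : c = w 0 := by
    have := ((hσ 0).1 h0).2
    rw [toReal_zero, dotProduct_zero] at this
    linarith
  refine ⟨hc, fun z hz => ?_⟩
  have := hu z hz
  rw [dotProduct_neg, dotProduct_comm]
  linarith

/-- The inequalities that are tight at a point of the height polytope form, together with the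
origin, a height cell. -/
lemma isHeightCell_insert_zero [DecidableEq (Fin d → ℤ)] (hP : (0 : Fin d → ℝ) ∈ P)
    {n : Fin d → ℝ} (hn : n ∈ heightPolytope P w) {σ : Finset (Fin d → ℤ)}
    (hσ : ∀ z, z ∈ σ ↔ (toReal z ∈ P ∧ z ≠ 0) ∧ toReal z ⬝ᵥ n = (w 0 : ℝ) - w z) :
    IsHeightCell P w (insert 0 σ) := by
  refine ⟨Finset.insert_nonempty _ _, -n, w 0, fun z hz => ?_, fun z => ?_⟩
  · have := hn z hz
    rw [neg_dotProduct, dotProduct_comm]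
    linarith
  · rw [Finset.mem_insert, hσ, neg_dotProduct, dotProduct_comm n]
    constructor
    · rintro (rfl | ⟨⟨hz, -⟩, he⟩)
      · rw [toReal_zero, zero_dotProduct]
        exact ⟨hP, by ring⟩
      · exact ⟨hz, by linarith⟩
    · rintro ⟨hz, he⟩
      by_cases hz0 : z = 0
      · exact Or.inl hz0
      · exact Or.inr ⟨⟨hz, hz0⟩, by linarith⟩

lemma exists_heightCell_weights {Z : Finset (Fin d → ℤ)} (hZ : ∀ z, z ∈ Z ↔ toReal z ∈ P)
    (w : (Fin d → ℤ) → ℤ) {y : Fin d → ℝ}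
    (hy : y ∈ convexHull ℝ (toReal '' (Z : Set (Fin d → ℤ)))) :
    ∃ τ q, IsHeightCell P w τ ∧ IsWt τ q ∧ y = ∑ t ∈ τ, q t • toReal t := by
  obtain ⟨u, c, q, hu, hq, hyq, hpos⟩ := exists_supporting Z toReal (fun t => (w t : ℝ)) y hy
  have hq' := hq.restrict (J := Z.filter fun t => (w t : ℝ) = u ⬝ᵥ toReal t + c)
    fun t ht => Finset.mem_filter.2 ⟨hq.mem_of_pos ht, hpos t ht⟩
  refine ⟨_, q, ⟨?_, u, c, fun z hz => hu z ((hZ z).2 hz), fun z => ?_⟩, hq',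
    hyq.trans (hq.sum_smul_restrict hq' _)⟩
  · obtain ⟨t, ht, -⟩ := hq'.exists_pos
    exact ⟨t, ht⟩
  · rw [Finset.mem_filter, hZ]

lemma heightPolytope_nonempty (hw : InducesCentralTriangulation P w) {Z : Finset (Fin d → ℤ)}
    (hZ : ∀ z, z ∈ Z ↔ toReal z ∈ P) (hP : (0 : Fin d → ℝ) ∈ P) :
    (heightPolytope P w).Nonempty := by
  obtain ⟨τ, -, hτ, -⟩ := exists_heightCell_weights (P := P) hZ w
    (subset_convexHull ℝ _ ⟨0, (hZ 0).2 (by rwa [toReal_zero]), rfl⟩)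
  obtain ⟨σ, ⟨-, u, c, hu, hσ⟩, -, h0⟩ := hw.isCentral τ hτ
  exact ⟨_, (IsHeightCell.neg_mem_heightPolytope hu hσ h0).2⟩

/-- Affine independence together with the origin is linear independence: the coefficient of the
origin is free to make the sum zero. -/
lemma indep_of_isHeightCell [DecidableEq (Fin d → ℤ)] (hw : InducesCentralTriangulation P w)
    {σ : Finset (Fin d → ℤ)} (h0 : 0 ∉ σ) (hσ : IsHeightCell P w (insert 0 σ))
    {c : (Fin d → ℤ) → ℝ} (hc : ∑ z ∈ σ, c z • toReal z = 0) : ∀ z ∈ σ, c z = 0 := by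
  have hind := affineIndependent_iff.1 (hw.isTriangulation _ hσ)
  set e : (Fin d → ℤ) → ℝ := fun z => if z = 0 then -∑ x ∈ σ, c x else c z with he
  have heσ : ∀ z ∈ σ, e z = c z := fun z hz => if_neg (ne_of_mem_of_not_mem hz h0)
  intro z hz
  have := hind Finset.univ (fun x => e x) ?_ ?_ ⟨z, Finset.mem_insert_of_mem hz⟩
    (Finset.mem_univ _)
  · rw [← heσ z hz]
    exact this
  · rw [Finset.sum_coe_sort (insert 0 σ) e, Finset.sum_insert h0, Finset.sum_congr rfl heσ]
    simp [he]
  · rw [Finset.sum_coe_sort (insert 0 σ) fun x => e x • toReal x, Finset.sum_insert h0,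
      Finset.sum_congr rfl fun x hx => by rw [heσ x hx], hc, toReal_zero]
    simp

end Central

namespace IsReflexive

variable {d : ℕ} {P : Set (Fin d → ℝ)} {lam : (Fin d → ℤ) → ℤ}

open Filter Topology in
/-- Lattice points that form a height cell together with the origin lie in a common facet. -/
lemma exists_common_facet (hP : IsReflexive P)
    (hlam : InducesCentralTriangulation (dualPolytope P) lam)
    {Z : Finset (Fin d → ℤ)} (hZ : ∀ z, z ∈ Z ↔ toReal z ∈ dualPolytope P)
    {n : Fin d → ℝ} (hn : n ∈ heightPolytope (dualPolytope P) lam) {σ : Finset (Fin d → ℤ)}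
    (hσ : ∀ z, z ∈ σ ↔ (toReal z ∈ dualPolytope P ∧ z ≠ 0) ∧
      toReal z ⬝ᵥ n = (lam 0 : ℝ) - lam z) :
    ∃ x ∈ P, ∀ z ∈ σ, toReal z ⬝ᵥ x = 1 := by
  classical
  have h0σ : 0 ∉ σ := fun h => ((hσ 0).1 h).1.2 rfl
  rcases σ.eq_empty_or_nonempty with rfl | hne
  · exact ⟨0, hP.zero_mem, by simp⟩
  obtain ⟨A, hA⟩ := hP.isLatticePolytope
  have hun := isWt_unifWt hne
  set x := ∑ z ∈ σ, unifWt σ z • toReal z with hx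
  have hxD : x ∈ dualPolytope P :=
    hun.sum_mem_of_pos convex_dual fun z hz => ((hσ z).1 (hun.mem_of_pos hz)).1.1
  by_cases hfac : ∃ a ∈ A, toReal a ⬝ᵥ x = 1
  · obtain ⟨a, ha, hax⟩ := hfac
    refine ⟨toReal a, hA ▸ subset_convexHull ℝ _ ⟨a, ha, rfl⟩, fun z hz => ?_⟩
    rw [dotProduct_comm]
    refine hun.eq_of_sum_le (f := fun z => toReal a ⬝ᵥ toReal z) (g := fun _ => 1)
      (fun z hz => (mem_dual_iff hA).1 ((hσ z).1 hz).1.1 a ha) ?_ (unifWt_pos hz)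
    have h1 := hun.dot_sum (toReal a) 0 toReal
    simp only [add_zero] at h1
    rw [← h1, ← hx, hax, ← Finset.sum_mul, hun.sum_eq, one_mul]
  -- If no vertex inequality is tight at the center `x` of `σ`, then `(1 + t) • x` is still in the
  -- dual. A central cell contains it, and linearity along the ray from the origin will show that it
  -- is also carried by `insert 0 σ`.
  exfalso
  have hlt : ∀ a ∈ A, 0 < 1 - toReal a ⬝ᵥ x := fun a ha =>
    sub_pos.2 (lt_of_le_of_ne ((mem_dual_iff hA).1 hxD a ha) fun h => hfac ⟨a, ha, h⟩)
  have hev : ∀ᶠ t in 𝓝[>] (0 : ℝ), ∀ a ∈ A, t * (toReal a ⬝ᵥ x) < 1 - toReal a ⬝ᵥ x :=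
    (Finset.eventually_all A).2 fun a ha => eventually_small_mul_lt _ (hlt a ha)
  obtain ⟨t, ht, ht0⟩ := (hev.and self_mem_nhdsWithin).exists
  have ht0 : 0 < t := ht0
  have hx' : (1 + t) • x ∈ dualPolytope P := (mem_dual_iff hA).2 fun a ha => by
    rw [dotProduct_smul, smul_eq_mul]
    linarith [ht a ha]
  rw [hP.dual_eq_convexHull hZ] at hx'
  obtain ⟨τ, q, hτ, hq, he⟩ := exists_heightCell_weights (P := dualPolytope P) hZ lam hx'
  obtain ⟨ρ, ⟨-, u, c, hu, hρ⟩, hτρ, h0ρ⟩ := hlam.isCentral τ hτ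
  obtain ⟨rfl, -⟩ := IsHeightCell.neg_mem_heightPolytope hu hρ h0ρ
  -- the affine function given by `n` also touches the cell `τ`
  have hnx : u ⬝ᵥ x ≥ -n ⬝ᵥ x := by
    have h1 := hun.dot_sum u (lam 0) toReal
    have h2 := hun.dot_sum (-n) (lam 0) toReal
    rw [← hx] at h1 h2
    have h3 : ∑ z ∈ σ, unifWt σ z * (-n ⬝ᵥ toReal z + lam 0) ≤
        ∑ z ∈ σ, unifWt σ z * (u ⬝ᵥ toReal z + lam 0) := by
      refine hun.sum_le fun z hz => ?_
      have h4 := ((hσ z).1 hz).2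
      have h5 := hu z ((hσ z).1 hz).1.1
      rw [neg_dotProduct, dotProduct_comm n]
      linarith
    linarith
  have hmem : ∀ z, 0 < q z → z ∈ insert 0 σ := by
    intro z hz
    have hzD := ((hρ z).1 (hτρ (hq.mem_of_pos hz))).1
    have htouch : (lam z : ℝ) = -n ⬝ᵥ toReal z + lam 0 := by
      refine hq.eq_of_sum_le (f := fun z => (lam z : ℝ)) (g := fun z => -n ⬝ᵥ toReal z + lam 0)
        (fun z hz => ?_) ?_ hz
      · have := hn z ((hρ z).1 (hτρ hz)).1
        rw [neg_dotProduct, dotProduct_comm n]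
        linarith
      · rw [← hq.dot_sum, ← he]
        have h1 : ∑ z ∈ τ, q z * (lam z : ℝ) = u ⬝ᵥ ((1 + t) • x) + lam 0 := by
          rw [he, hq.dot_sum]
          exact Finset.sum_congr rfl fun z hz => by rw [((hρ z).1 (hτρ hz)).2]
        rw [h1, dotProduct_smul, dotProduct_smul, smul_eq_mul, smul_eq_mul]
        have := mul_le_mul_of_nonneg_left hnx (by positivity : 0 ≤ 1 + t)
        linarith
    rw [Finset.mem_insert, hσ]
    by_cases hz0 : z = 0
    · exact Or.inl hz0
    · rw [neg_dotProduct, dotProduct_comm n] at htouch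
      exact Or.inr ⟨⟨hzD, hz0⟩, by linarith⟩
  have hq' := hq.restrict hmem
  rw [hq.sum_smul_restrict hq', Finset.sum_insert h0σ, toReal_zero, smul_zero, zero_add, hx,
    Finset.smul_sum] at he
  have hcell := isHeightCell_insert_zero zero_mem_dual hn hσ
  -- Independence identifies the weights with `1 + t` times the uniform ones, so their sum exceeds
  -- `1`.
  have hind := indep_of_isHeightCell hlam h0σ hcell
    (c := fun z => q z - (1 + t) * unifWt σ z) (by
      simp only [sub_smul, Finset.sum_sub_distrib, mul_smul]
      rw [he, sub_self])
  have hsum : ∑ z ∈ σ, q z = 1 + t := by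
    rw [Finset.sum_congr rfl fun z hz => sub_eq_zero.1 (hind z hz), ← Finset.mul_sum, hun.sum_eq,
      mul_one]
  have := hq'.sum_eq
  rw [Finset.sum_insert h0σ, hsum] at this
  linarith [hq.nonneg 0]

end IsReflexive

/-! ### Simplicity of `Q`, and its faces as simplices of `S` -/

namespace Setup

variable {d : ℕ} {S : Setup d} {ν : (Fin d → ℤ) → ℤ}

-- The tight normals are independent, so some direction keeps all of them tight except `z₀`, which
-- it decreases; a short step in that direction drops only `z₀`. If no such direction existed, the
-- common kernel of the other normals would lie in that of `z₀`, and `z₀` would be in their span.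
open Filter Topology in
lemma erase_mem_K [DecidableEq (Fin d → ℤ)] {σ : Finset (Fin d → ℤ)} (hσ : σ ∈ S.K)
    {z₀ : Fin d → ℤ} (hz₀ : z₀ ∈ σ) : σ.erase z₀ ∈ S.K := by
  obtain ⟨n, hn, hna⟩ := mem_K.1 hσ
  obtain ⟨v, hv, hv₀⟩ : ∃ v : Fin d → ℝ, (∀ z ∈ σ.erase z₀, toReal z ⬝ᵥ v = 0) ∧
      toReal z₀ ⬝ᵥ v < 0 := by
    by_contra! hno
    have hker : ⨅ z : σ.erase z₀, (dotProductBilin ℝ ℝ (toReal (z : Fin d → ℤ))).ker ≤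
        (dotProductBilin ℝ ℝ (toReal z₀)).ker := by
      intro v hv
      have hv' : ∀ z ∈ σ.erase z₀, toReal z ⬝ᵥ v = 0 := fun z hz =>
        (Submodule.mem_iInf _).1 hv ⟨z, hz⟩
      have h1 := hno v hv'
      have h2 := hno (-v) fun z hz => by rw [dotProduct_neg, hv' z hz, neg_zero]
      rw [dotProduct_neg] at h2
      have h3 : toReal z₀ ⬝ᵥ v = 0 := le_antisymm (by linarith) h1
      exact h3
    obtain ⟨c, hc⟩ := (Submodule.mem_span_range_iff_exists_fun ℝ).1
      (mem_span_of_iInf_ker_le_ker hker)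
    set e : (Fin d → ℤ) → ℝ := fun z => if h : z ∈ σ.erase z₀ then c ⟨z, h⟩ else -1 with he
    have hsum : ∑ z ∈ σ, e z • toReal z = 0 := by
      rw [← Finset.sum_erase_add _ _ hz₀, ← Finset.sum_coe_sort]
      refine dotProduct_eq_zero _ fun v => ?_
      have := LinearMap.congr_fun hc v
      simp only [LinearMap.sum_apply, LinearMap.smul_apply, dotProductBilin_apply_apply,
        smul_eq_mul] at this
      have hz₀e : e z₀ = -1 := dif_neg (Finset.notMem_erase z₀ σ)
      rw [add_dotProduct, sum_dotProduct, smul_dotProduct, hz₀e, ← this]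
      have : ∀ z : σ.erase z₀, (e z • toReal (z : Fin d → ℤ)) ⬝ᵥ v =
          c z * (toReal (z : Fin d → ℤ) ⬝ᵥ v) := fun z => by
        rw [smul_dotProduct, he]
        simp only [z.2, dif_pos, smul_eq_mul]
      simp only [this]
      simp
    have := S.indep n hn e (by
      change ∑ z ∈ S.act n, _ = _
      rw [hna]
      exact hsum) z₀ (subset_Z hσ hz₀) (mem_act.1 (hna ▸ hz₀)).2
    rw [he] at this
    simp at this
  have hle : ∀ z ∈ S.act n, toReal z ⬝ᵥ v ≤ 0 := by
    intro z hz
    rw [hna] at hz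
    by_cases hzz : z = z₀
    · rw [hzz]; exact hv₀.le
    · exact (hv z (Finset.mem_erase.2 ⟨hzz, hz⟩)).le
  obtain ⟨τ, hτQ, hτa⟩ := (small_step hn hle).exists
  refine mem_K.2 ⟨_, hτQ, ?_⟩
  rw [hτa, hna]
  ext z
  rw [Finset.mem_filter, Finset.mem_erase]
  constructor
  · rintro ⟨hz, h0⟩
    exact ⟨fun h => hv₀.ne (h ▸ h0), hz⟩
  · rintro ⟨hzz, hz⟩
    exact ⟨hz, hv z (Finset.mem_erase.2 ⟨hzz, hz⟩)⟩

lemma mem_K_of_subset {σ σ' : Finset (Fin d → ℤ)} (hσ : σ ∈ S.K) (h : σ' ⊆ σ) : σ' ∈ S.K := by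
  classical
  induction hk : (σ \ σ').card generalizing σ with
  | zero =>
    have : σ ⊆ σ' := Finset.sdiff_eq_empty_iff_subset.1 (Finset.card_eq_zero.1 hk)
    rwa [Finset.Subset.antisymm h this]
  | succ k ih =>
    obtain ⟨z, hz⟩ : (σ \ σ').Nonempty := Finset.card_pos.1 (by omega)
    obtain ⟨hzσ, hzσ'⟩ := Finset.mem_sdiff.1 hz
    refine ih (erase_mem_K hσ hzσ)
      (fun x hx => Finset.mem_erase.2 ⟨ne_of_mem_of_not_mem hx hzσ', h hx⟩) ?_
    rw [Finset.erase_sdiff_comm, Finset.card_erase_of_mem hz, hk]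
    rfl

end Setup

/-- The height polytope of a central triangulation of the dual of a reflexive polytope is a simple
polytope with Minkowski summand `P`, whose proper faces correspond to the boundary triangulation. -/
theorem exists_setup {d : ℕ} {P : Set (Fin d → ℝ)} (hP : IsReflexive P) {lam : (Fin d → ℤ) → ℤ}
    (hlam : InducesCentralTriangulation (dualPolytope P) lam) :
    ∃ S : Setup d, S.P = P ∧ S.Q = heightPolytope (dualPolytope P) lam ∧
      ∀ σ, σ ∈ boundaryTriangulation (dualPolytope P) lam ↔ σ ∈ S.K ∧ σ.Nonempty := by
  classical
  set D := dualPolytope P with hD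
  set Z₀ := (finite_lattice_points hP.isBounded_dual).toFinset with hZ₀
  have hZ : ∀ z, z ∈ Z₀ ↔ toReal z ∈ D := fun z => Set.Finite.mem_toFinset _
  set B := (finite_lattice_points hP.isCompact.isBounded).toFinset with hB
  have hBm : ∀ t, t ∈ B ↔ toReal t ∈ P := fun t => Set.Finite.mem_toFinset _
  have hZe : ∀ z, z ∈ Z₀.erase 0 ↔ toReal z ∈ D ∧ z ≠ 0 := fun z => by
    rw [Finset.mem_erase, hZ, and_comm]
  have hact : ∀ n z, z ∈ (Z₀.erase 0).filter
      (fun z => toReal z ⬝ᵥ n = (lam 0 : ℝ) - lam z) ↔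
      (toReal z ∈ D ∧ z ≠ 0) ∧ toReal z ⬝ᵥ n = (lam 0 : ℝ) - lam z := fun n z => by
    rw [Finset.mem_filter, hZe]
  let S : Setup d :=
  { Z := Z₀.erase 0
    b := fun z => (lam 0 : ℝ) - lam z
    B := B
    Q := heightPolytope D lam
    P := P
    mem_Q := fun n => by
      constructor
      · exact fun h z hz => h z ((hZe z).1 hz).1
      · intro h z hz
        by_cases hz0 : z = 0
        · rw [hz0, toReal_zero]
          simp
        · exact h z ((hZe z).2 ⟨hz, hz0⟩)
    mem_P := fun x => by
      constructor
      · intro hx z hz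
        exact ((hZe z).1 hz).1 x hx
      · intro h
        rw [hP.mem_iff_forall_dual]
        intro m hm
        rw [hP.dual_eq_convexHull hZ] at hm
        obtain ⟨q, hq, rfl⟩ := mem_convexHull_image_finset.1 hm
        have h1 := hq.dot_sum x 0 toReal
        simp only [add_zero] at h1
        rw [dotProduct_comm, h1]
        calc _ ≤ ∑ z ∈ Z₀, q z * 1 := hq.sum_le fun z hz => by
              rw [dotProduct_comm]
              by_cases hz0 : z = 0
              · rw [hz0, toReal_zero]
                simp
              · exact h z (Finset.mem_erase.2 ⟨hz0, hz⟩)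
          _ = 1 := by rw [← Finset.sum_mul, hq.sum_eq, one_mul]
    mem_B := hBm
    hull_B := by
      refine Set.Subset.antisymm ?_ (convexHull_min ?_ hP.convex)
      · obtain ⟨A, hA⟩ := hP.isLatticePolytope
        conv_lhs => rw [hA]
        refine convexHull_mono (Set.image_mono fun a ha => (hBm a).2 ?_)
        exact hA ▸ subset_convexHull ℝ _ ⟨a, ha, rfl⟩
      · rintro _ ⟨t, ht, rfl⟩
        exact (hBm t).1 ht
    zero_notMem := Finset.notMem_erase 0 Z₀
    Q_nonempty := heightPolytope_nonempty hlam hZ IsReflexive.zero_mem_dual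
    exists_pos := fun v hv => by
      obtain ⟨z, hz, hpos⟩ := hP.exists_lattice_point_pos hZ hv
      refine ⟨z, Finset.mem_erase.2 ⟨fun h => ?_, hz⟩, hpos⟩
      rw [h, toReal_zero, zero_dotProduct] at hpos
      exact lt_irrefl _ hpos
    indep := fun n hn c hc z hz he => by
      refine indep_of_isHeightCell hlam (fun h => ((hact n 0).1 h).1.2 rfl)
        (isHeightCell_insert_zero IsReflexive.zero_mem_dual hn (hact n)) hc z
        (Finset.mem_filter.2 ⟨hz, he⟩)
    compat := fun n hn => by
      obtain ⟨x, hx, h⟩ := hP.exists_common_facet hlam hZ hn (hact n)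
      exact ⟨x, hx, fun z hz he => h z (Finset.mem_filter.2 ⟨hz, he⟩)⟩ }
  refine ⟨S, rfl, rfl, fun σ => ⟨?_, ?_⟩⟩
  · rintro ⟨hσ, hfr⟩
    refine ⟨?_, hσ.1⟩
    -- The central cell containing `σ` corresponds to a point of `Q` at which all of `σ` is tight.
    -- By simplicity every subset of a tight set defines a face.
    obtain ⟨ρ, ⟨-, u, c, hu, hρ⟩, hσρ, h0ρ⟩ := hlam.isCentral σ hσ
    obtain ⟨rfl, hn⟩ := IsHeightCell.neg_mem_heightPolytope hu hρ h0ρ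
    have h0σ : 0 ∉ σ := fun h0 => (hfr (subset_convexHull ℝ _ ⟨0, h0, toReal_zero⟩)).2
      hP.zero_mem_interior_dual
    refine Setup.mem_K_of_subset (Setup.act_mem_K (S := S) hn) fun z hz => ?_
    obtain ⟨hzD, he⟩ := (hρ z).1 (hσρ hz)
    refine (hact (-u) z).2 ⟨⟨hzD, ne_of_mem_of_not_mem hz h0σ⟩, ?_⟩
    rw [dotProduct_neg, dotProduct_comm]
    linarith
  · rintro ⟨hσ, hne⟩
    obtain ⟨p, hp⟩ := Setup.kap_nonempty hσ
    obtain ⟨n, hn, hna⟩ := Setup.mem_K.1 hσ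
    have hmemσ : ∀ z, z ∈ σ ↔ (toReal z ∈ D ∧ z ≠ 0) ∧
        toReal z ⬝ᵥ n = (lam 0 : ℝ) - lam z := fun z => by
      rw [← hact n z, ← hna]
      rfl
    have hD1 : ∀ m ∈ D, p ⬝ᵥ m ≤ 1 := fun m hm => by
      rw [dotProduct_comm]
      exact hm p hp.1
    obtain ⟨z₁, hz₁⟩ := hne
    have hp0 : p ≠ 0 := by
      rintro rfl
      have := hp.2 z₁ hz₁
      simp at this
    -- The point `n` gives the cell `insert 0 σ`. Adding `1 - ⟨p, ·⟩`, which is nonnegative on the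
    -- dual, zero on `σ` and `1` at the origin, removes the origin and keeps `σ`.
    refine ⟨⟨⟨z₁, hz₁⟩, -n - p, lam 0 + 1, fun z hz => ?_, fun z => ?_⟩, fun x hx => ?_⟩
    · have h1 := hn z hz
      have h2 := hD1 _ hz
      rw [sub_dotProduct, neg_dotProduct, dotProduct_comm n]
      linarith
    · rw [sub_dotProduct, neg_dotProduct, dotProduct_comm n]
      constructor
      · intro hz
        obtain ⟨⟨hzD, -⟩, he⟩ := (hmemσ z).1 hz
        refine ⟨hzD, ?_⟩
        rw [dotProduct_comm p, hp.2 z hz]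
        linarith
      · rintro ⟨hz, he⟩
        have h1 := hn z hz
        have h2 := hD1 _ hz
        refine (hmemσ z).2 ⟨⟨hz, ?_⟩, by linarith⟩
        rintro rfl
        rw [toReal_zero, dotProduct_zero, zero_dotProduct] at he
        linarith
    · obtain ⟨q, hq, rfl⟩ := mem_convexHull_image_finset.1 hx
      refine mem_frontier_of_dot_eq hD1 hp0 (hq.sum_mem_of_pos IsReflexive.convex_dual
        fun z hz => ((hmemσ z).1 (hq.mem_of_pos hz)).1.1) ?_
      have h1 := hq.dot_sum p 0 toReal
      simp only [add_zero] at h1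
      rw [h1, Finset.sum_congr rfl fun z hz => by rw [dotProduct_comm p, hp.2 z hz],
        ← Finset.sum_mul, hq.sum_eq, one_mul]

end MixSubdiv
namespace MixSubdiv

/-! ### Comparison of the boundary cells with the restricted product -/

lemma combIso_range {I α β : Type*} [PartialOrder I] {f : I → Set α} {g : I → Set β}
    (hf : ∀ i j, f i ⊆ f j ↔ i ≤ j) (hg : ∀ i j, g i ⊆ g j ↔ i ≤ j) :
    CombIso (Set.range f) (Set.range g) :=
  ⟨(OrderEmbedding.orderIso (f := OrderEmbedding.ofMapLEIff f hf)).symm.trans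
    (OrderEmbedding.orderIso (f := OrderEmbedding.ofMapLEIff g hg))⟩

lemma barycenter_eq {d : ℕ} (σ : Finset (Fin d → ℤ)) :
    barycenter σ = ∑ z ∈ σ, unifWt σ z • toReal z := by
  rw [barycenter, Finset.smul_sum]
  exact Finset.sum_congr rfl fun z hz => by rw [unifWt_of_mem hz]

/-- The simplices of a barycentric subdivision determine their chains. -/
lemma chain_subset_of_convexHull_subset {d : ℕ} {P : Set (Fin d → ℝ)} {w : (Fin d → ℤ) → ℤ}
    {C C' : Finset (Finset (Fin d → ℤ))} (hC : ∀ σ ∈ C, IsHeightCell P w σ)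
    (hC' : ∀ σ ∈ C', IsHeightCell P w σ)
    (hchain : IsChain (· ⊆ ·) (C' : Set (Finset (Fin d → ℤ))))
    (h : convexHull ℝ (barycenter '' (C : Set (Finset (Fin d → ℤ)))) ⊆
      convexHull ℝ (barycenter '' (C' : Set (Finset (Fin d → ℤ))))) : C ⊆ C' := by
  intro σ hσ
  obtain ⟨v, hv, he⟩ := mem_convexHull_image_finset.1 (h (subset_convexHull ℝ _ ⟨σ, hσ, rfl⟩))
  have hv' := hv.restrict (J := C'.filter fun ρ => 0 < v ρ)
    fun ρ hρ => Finset.mem_filter.2 ⟨hv.mem_of_pos hρ, hρ⟩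
  obtain ⟨ρ₁, hρ₁, -⟩ := hv'.exists_pos
  obtain ⟨ρm, hρm, hmax⟩ := exists_greatest_of_isChain (C := C'.filter fun ρ => 0 < v ρ)
    (hchain.mono fun ρ hρ => (Finset.mem_filter.1 hρ).1) ⟨ρ₁, hρ₁⟩
  obtain ⟨hρmC, hρmv⟩ := Finset.mem_filter.1 hρm
  rw [hv.sum_smul_restrict hv', barycenter_eq] at he
  -- The barycenter of `σ` rewritten in the vertices of `ρm`, the greatest simplex with positive
  -- weight. All vertices of `ρm` get positive weight, so `σ` and `ρm` are height cells with a
  -- common point carried by all vertices of each, hence equal.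
  set e : (Fin d → ℤ) → ℝ := fun z => ∑ ρ ∈ C'.filter fun ρ => 0 < v ρ, v ρ * unifWt ρ z with hedef
  have hun : ∀ ρ ∈ C', IsWt ρ (unifWt ρ) := fun ρ hρ => isWt_unifWt (hC' ρ hρ).1
  have heW : IsWt ρm e := by
    refine ⟨fun z => Finset.sum_nonneg fun ρ hρ => mul_nonneg (hv.nonneg ρ)
      ((hun ρ (Finset.mem_filter.1 hρ).1).nonneg z), fun z hz => Finset.sum_eq_zero fun ρ hρ => ?_,
      ?_⟩
    · rw [(hun ρ (Finset.mem_filter.1 hρ).1).supp z fun h => hz (hmax ρ hρ h), mul_zero]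
    · rw [Finset.sum_comm, ← hv'.sum_eq]
      refine Finset.sum_congr rfl fun ρ hρ => ?_
      rw [← Finset.mul_sum, ((hun ρ (Finset.mem_filter.1 hρ).1).mono (hmax ρ hρ)).sum_eq, mul_one]
  have hsum : ∑ z ∈ σ, unifWt σ z • toReal z = ∑ z ∈ ρm, e z • toReal z := by
    rw [he]
    simp only [hedef, Finset.sum_smul]
    rw [Finset.sum_comm]
    refine Finset.sum_congr rfl fun ρ hρ => ?_
    rw [barycenter_eq, ← (hun ρ (Finset.mem_filter.1 hρ).1).sum_smul_eq (hmax ρ hρ),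
      Finset.smul_sum]
    exact Finset.sum_congr rfl fun z _ => smul_smul _ _ _
  have hσw := isWt_unifWt (hC σ hσ).1
  have h1 : σ ⊆ ρm := fun z hz =>
    (hC σ hσ).mem_of_pos (hC' ρm hρmC) hσw heW hsum (unifWt_pos hz)
  have h2 : ρm ⊆ σ := by
    intro z hz
    refine (hC' ρm hρmC).mem_of_pos (hC σ hσ) heW hσw hsum.symm ?_
    refine Finset.sum_pos' (fun ρ hρ => mul_nonneg (hv.nonneg ρ)
      ((hun ρ (Finset.mem_filter.1 hρ).1).nonneg z)) ⟨ρm, hρm, mul_pos hρmv (unifWt_pos hz)⟩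
  rw [Finset.Subset.antisymm h1 h2]
  exact hρmC

namespace Setup

variable {d : ℕ} {S : Setup d} {ν lam : (Fin d → ℤ) → ℤ}

variable (S ν) in
/-- The indices of the cells in the boundary. -/
def BoundaryIdx : Type := {i : Finset (Finset (Fin d → ℤ)) × Finset (Fin d → ℤ) //
  S.IsIdx ν i.1 i.2 ∧ ∅ ∉ i.1}

instance : PartialOrder (BoundaryIdx S ν) := inferInstanceAs (PartialOrder {_i // _})

lemma toReal_ne_zero_of_mem {z : Fin d → ℤ} (hz : z ∈ S.Z) : toReal z ≠ 0 :=
  toReal_ne_zero (ne_of_mem_of_not_mem hz S.zero_notMem)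

/-- The uniformly weighted point of a cell detects its whole index, by uniqueness of representations
for the chain and by `IsHeightCell.mem_of_pos` for `τ`. -/
lemma cell_subset_cell_iff {r : S.Copies} {C C' : Finset (Finset (Fin d → ℤ))}
    {τ τ' : Finset (Fin d → ℤ)} (h : S.IsIdx ν C τ) (h' : S.IsIdx ν C' τ') :
    r.cell C τ ⊆ r.cell C' τ' ↔ C ⊆ C' ∧ τ ⊆ τ' := by
  constructor
  · intro hsub
    obtain ⟨w', q', hw', hq', he⟩ := Copies.mem_cell'.1
      (hsub (Copies.average_mem_cell h.nonempty h.heightCell.1))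
    have hw := isWt_unifWt h.nonempty
    have hq := isWt_unifWt h.heightCell.1
    obtain ⟨h1, h2⟩ := Copies.cell_unique h h' hw hq hw' hq' he
    refine ⟨fun σ hσ => hw'.mem_of_pos ?_,
      fun t ht => h.heightCell.mem_of_pos h'.heightCell hq hq' h2 (unifWt_pos ht)⟩
    rw [← h1]
    exact unifWt_pos hσ
  · rintro ⟨hC, hτ⟩
    refine Set.add_subset_add (convexHull_mono (Set.image_mono (by exact_mod_cast hC)))
      (Set.smul_set_mono (convexHull_mono (Set.image_mono (by exact_mod_cast hτ))))

/-- The empty set stands for `Q` itself, and its marked points have no tight inequality, hence are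
interior. Otherwise an inequality in the least member of the chain is tight on the whole cell. -/
lemma cell_subset_frontier_iff {r : S.Copies} {C : Finset (Finset (Fin d → ℤ))}
    {τ : Finset (Fin d → ℤ)} (h : S.IsIdx ν C τ) : r.cell C τ ⊆ frontier S.Q ↔ ∅ ∉ C := by
  constructor
  · intro hsub hC
    obtain ⟨t, ht⟩ := h.heightCell.1
    have hp : (∅, t) ∈ C ×ˢ τ := Finset.mem_product.2 ⟨hC, ht⟩
    have hmem : r.pt (∅, t) ∈ r.cell C τ :=
      Set.add_mem_add (subset_convexHull ℝ _ ⟨∅, hC, rfl⟩)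
        (Set.smul_mem_smul_set (subset_convexHull ℝ _ ⟨t, ht, rfl⟩))
    refine (hsub hmem).2 (mem_interior_of_dot_lt (fun y hy => (S.mem_Q y).2 hy) fun z hz => ?_)
    have hV := h.mem_V hp
    refine lt_of_le_of_ne ((S.mem_Q _).1 (Copies.pt_mem (r := r) hV) z hz) fun he => ?_
    have : z ∈ S.act (r.pt (∅, t)) := mem_act.2 ⟨hz, he⟩
    rw [Copies.act_pt hV] at this
    simp at this
  · intro hC y hy
    have hyQ := Copies.cell_subset h hy
    obtain ⟨σ, hσ, hmin⟩ := exists_least_of_isChain h.chain h.nonempty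
    obtain ⟨z, hz⟩ : σ.Nonempty := Finset.nonempty_iff_ne_empty.2 fun h => hC (h ▸ hσ)
    have hzZ := subset_Z (h.subset_K hσ) hz
    refine mem_frontier_of_dot_eq (fun y hy => (S.mem_Q y).1 hy z hzZ)
      (toReal_ne_zero_of_mem hzZ) hyQ ?_
    obtain ⟨w, q, hw, hq, rfl⟩ := Copies.mem_cell.1 hy
    have h1 := (hw.prod hq).dot_sum (toReal z) 0 r.pt
    simp only [add_zero] at h1
    rw [h1, Finset.sum_congr rfl fun p hp => ?_, ← Finset.sum_mul, (hw.prod hq).sum_eq, one_mul]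
    have hza : z ∈ S.act (r.pt p) := by
      rw [Copies.act_pt (h.mem_V hp)]
      exact hmin _ (Finset.mem_product.1 hp).1 hz
    rw [(mem_act.1 hza).2]

/-- The pairing of a barycenter of `σ` with a point of `P` is an average of numbers `⟨z, ·⟩ ≤ 1`. It
equals `1` exactly when all of them do, so lying in `|Σ|` means that `τ` lies in `kap σ` for every
`σ` in the chain. -/
lemma restrictedProductCells_eq
    (hbd : ∀ σ, σ ∈ boundaryTriangulation (dualPolytope S.P) lam ↔ σ ∈ S.K ∧ σ.Nonempty) :
    restrictedProductCells S.P lam ν = Set.range fun i : BoundaryIdx S ν =>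
      convexHull ℝ (barycenter '' (i.1.1 : Set (Finset (Fin d → ℤ)))) ×ˢ simplex i.1.2 := by
  classical
  have hmemD : ∀ σ ∈ boundaryTriangulation (dualPolytope S.P) lam, ∀ z ∈ σ,
      toReal z ∈ dualPolytope S.P := by
    rintro σ ⟨⟨-, u, c, -, h⟩, -⟩ z hz
    exact ((h z).1 hz).1
  have hbary : ∀ σ : Finset (Fin d → ℤ), ∀ y, barycenter σ ⬝ᵥ y =
      ∑ z ∈ σ, unifWt σ z * (toReal z ⬝ᵥ y) := by
    intro σ y
    rw [barycenter_eq, sum_dotProduct]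
    exact Finset.sum_congr rfl fun z _ => smul_dotProduct _ _ _
  ext Y
  constructor
  · rintro ⟨⟨X, ⟨c, hcne, hcS, hchain, rfl⟩, τ, hτ, rfl⟩, hY⟩
    have hcK : c ⊆ S.K := fun σ hσ => ((hbd σ).1 (hcS hσ)).1
    have hcoe : ((S.K.filter fun σ => σ ∈ c : Finset _) : Set (Finset (Fin d → ℤ))) = c := by
      ext σ
      simp only [Finset.coe_filter, Set.mem_ofPred_eq, and_iff_right_iff_imp]
      exact fun h => hcK h
    refine ⟨⟨(S.K.filter fun σ => σ ∈ c, τ), ⟨?_, Finset.filter_subset _ _, by rwa [hcoe], hτ.1, ?_⟩,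
      ?_⟩, by simp only [hcoe]⟩
    · obtain ⟨σ, hσ⟩ := hcne
      exact ⟨σ, Finset.mem_filter.2 ⟨hcK hσ, hσ⟩⟩
    · intro σ hσ t ht
      have hσc := (Finset.mem_filter.1 hσ).2
      have h1 := hY (Set.mk_mem_prod (subset_convexHull ℝ _ ⟨σ, hσc, rfl⟩)
        (subset_convexHull ℝ _ ⟨t, ht, rfl⟩))
      have hdot : barycenter σ ⬝ᵥ toReal t = 1 := h1.2.2
      have htP : toReal t ∈ S.P := h1.2.1
      have hne := ((hbd σ).1 (hcS hσc)).2
      refine ⟨htP, fun z hz => ?_⟩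
      refine (isWt_unifWt hne).eq_of_sum_le (f := fun z => toReal z ⬝ᵥ toReal t)
        (g := fun _ => 1) (fun z hz => hmemD σ (hcS hσc) z hz _ htP) ?_ (unifWt_pos hz)
      rw [← hbary, hdot, ← Finset.sum_mul, (isWt_unifWt hne).sum_eq, one_mul]
    · intro h
      obtain ⟨z, hz⟩ := ((hbd ∅).1 (hcS (Finset.mem_filter.1 h).2)).2
      simp at hz
  · rintro ⟨⟨⟨C, τ⟩, h, h0⟩, rfl⟩
    simp only at h h0 ⊢
    have hne : ∀ σ ∈ C, σ.Nonempty := fun σ hσ =>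
      Finset.nonempty_iff_ne_empty.2 fun he => h0 (he ▸ hσ)
    have hCbd : ∀ σ ∈ C, σ ∈ boundaryTriangulation (dualPolytope S.P) lam := fun σ hσ =>
      (hbd σ).2 ⟨h.subset_K hσ, hne σ hσ⟩
    have hkap : ∀ σ ∈ C, simplex τ ⊆ S.kap σ := by
      intro σ hσ
      refine convexHull_min ?_ (convex_kap σ)
      rintro _ ⟨t, ht, rfl⟩
      exact h.mem_kap σ hσ t ht
    refine ⟨⟨_, ⟨C, h.nonempty, hCbd, h.chain, rfl⟩, τ, ⟨h.heightCell, fun x hx => ?_⟩, rfl⟩, ?_⟩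
    · obtain ⟨σ, hσ⟩ := h.nonempty
      obtain ⟨z, hz⟩ := hne σ hσ
      have hzZ := subset_Z (h.subset_K hσ) hz
      exact mem_frontier_of_dot_eq (fun y hy => (S.mem_P y).1 hy z hzZ)
        (toReal_ne_zero_of_mem hzZ) (hkap σ hσ hx).1 ((hkap σ hσ hx).2 z hz)
    · rintro ⟨x, y⟩ ⟨hx, hy⟩
      have hx' : x ∈ {x | x ∈ dualPolytope S.P ∧ x ⬝ᵥ y = 1} := by
        refine convexHull_min ?_ ?_ hx
        · rintro _ ⟨σ, hσ, rfl⟩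
          have hun := isWt_unifWt (hne σ hσ)
          refine ⟨?_, ?_⟩
          · rw [barycenter_eq]
            exact hun.sum_mem_of_pos IsReflexive.convex_dual fun z hz =>
              hmemD σ (hCbd σ hσ) z (hun.mem_of_pos hz)
          · rw [hbary, Finset.sum_congr rfl fun z hz => by rw [(hkap σ hσ hy).2 z hz],
              ← Finset.sum_mul, hun.sum_eq, one_mul]
        · rintro x ⟨hx, hx1⟩ x' ⟨hx', hx1'⟩ a a' ha ha' haa
          refine ⟨IsReflexive.convex_dual hx hx' ha ha' haa, ?_⟩
          rw [add_dotProduct, smul_dotProduct, smul_dotProduct, hx1, hx1']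
          simpa using haa
      obtain ⟨σ, hσ⟩ := h.nonempty
      exact ⟨hx'.1, (hkap σ hσ hy).1, hx'.2⟩

lemma prod_subset_prod_iff_idx
    (hbd : ∀ σ, σ ∈ boundaryTriangulation (dualPolytope S.P) lam ↔ σ ∈ S.K ∧ σ.Nonempty)
    (i j : BoundaryIdx S ν) :
    convexHull ℝ (barycenter '' (i.1.1 : Set (Finset (Fin d → ℤ)))) ×ˢ simplex i.1.2 ⊆
      convexHull ℝ (barycenter '' (j.1.1 : Set (Finset (Fin d → ℤ)))) ×ˢ simplex j.1.2 ↔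
    i ≤ j := by
  have hcell : ∀ i : BoundaryIdx S ν, ∀ σ ∈ i.1.1, IsHeightCell (dualPolytope S.P) lam σ :=
    fun i σ hσ => ((hbd σ).2 ⟨i.2.1.subset_K hσ,
      Finset.nonempty_iff_ne_empty.2 fun he => i.2.2 (he ▸ hσ)⟩).1
  have hne : (convexHull ℝ (barycenter '' (i.1.1 : Set (Finset (Fin d → ℤ)))) ×ˢ
      simplex i.1.2).Nonempty :=
    Set.Nonempty.prod (((Finset.coe_nonempty.2 i.2.1.nonempty).image _).convexHull)
      (((Finset.coe_nonempty.2 i.2.1.heightCell.1).image _).convexHull)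
  rw [Set.prod_subset_prod_iff' hne]
  constructor
  · rintro ⟨h1, h2⟩
    exact ⟨chain_subset_of_convexHull_subset (hcell i) (hcell j) j.2.1.chain h1,
      i.2.1.heightCell.subset_of_simplex_subset j.2.1.heightCell h2⟩
  · rintro ⟨h1, h2⟩
    exact ⟨convexHull_mono (Set.image_mono (by exact_mod_cast h1)),
      convexHull_mono (Set.image_mono (by exact_mod_cast h2))⟩

lemma boundaryCoherentCells_eq {r : S.Copies} {F : (Fin d → ℝ) → ℝ}
    (hF : coherentCells S.Q F = {X | ∃ C τ, S.IsIdx ν C τ ∧ X = r.cell C τ}) :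
    boundaryCoherentCells S.Q F = Set.range fun i : BoundaryIdx S ν => r.cell i.1.1 i.1.2 := by
  ext X
  rw [boundaryCoherentCells, hF]
  constructor
  · rintro ⟨⟨C, τ, h, rfl⟩, hfr⟩
    exact ⟨⟨(C, τ), h, (cell_subset_frontier_iff h).1 hfr⟩, rfl⟩
  · rintro ⟨⟨⟨C, τ⟩, h, h0⟩, rfl⟩
    exact ⟨⟨C, τ, h, rfl⟩, (cell_subset_frontier_iff h).2 h0⟩

/-- The boundary of the common refinement is combinatorially the restricted product. -/
theorem combIso_boundary {r : S.Copies} {F : (Fin d → ℝ) → ℝ}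
    (hF : coherentCells S.Q F = {X | ∃ C τ, S.IsIdx ν C τ ∧ X = r.cell C τ})
    (hbd : ∀ σ, σ ∈ boundaryTriangulation (dualPolytope S.P) lam ↔ σ ∈ S.K ∧ σ.Nonempty) :
    CombIso (boundaryCoherentCells S.Q F) (restrictedProductCells S.P lam ν) := by
  rw [boundaryCoherentCells_eq hF, restrictedProductCells_eq hbd]
  exact combIso_range (fun i j => cell_subset_cell_iff i.2.1 j.2.1) (prod_subset_prod_iff_idx hbd)

end Setup
end MixSubdiv

theorem mainTheorem3 {d : ℕ} (P : Set (Fin d → ℝ)) (hP : MixSubdiv.IsReflexive P)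
    (lam nu : (Fin d → ℤ) → ℤ)
    (hlam : MixSubdiv.InducesCentralTriangulation (MixSubdiv.dualPolytope P) lam)
    (hnu : MixSubdiv.InducesCentralTriangulation P nu)
    (Q : Set (Fin d → ℝ)) (hQ : Q = MixSubdiv.heightPolytope (MixSubdiv.dualPolytope P) lam) :
    (∃ f : (Fin d → ℝ) → ℝ, MixSubdiv.IsPLConcaveOn Q f ∧
      MixSubdiv.CombIso (MixSubdiv.boundaryCoherentCells Q f)
        (MixSubdiv.restrictedProductCells P lam nu)) ∧
    Nonempty (MixSubdiv.Placement Q P) ∧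
    ∀ r : MixSubdiv.Placement Q P,
      (∃ ψ, MixSubdiv.IsAdapted r ψ) ∧
      ∀ ψ, MixSubdiv.IsAdapted r ψ → ∃ N₀ : ℝ, ∀ N : ℝ, N₀ ≤ N →
        MixSubdiv.IsPLConcaveOn Q
          (fun x => N * ψ x + MixSubdiv.tildeFun r (MixSubdiv.heightFun P nu) x) ∧
        MixSubdiv.CombIso
          (MixSubdiv.boundaryCoherentCells Q
            (fun x => N * ψ x + MixSubdiv.tildeFun r (MixSubdiv.heightFun P nu) x))
          (MixSubdiv.restrictedProductCells P lam nu) := by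
  obtain ⟨S, rfl, hSQ, hbd⟩ := MixSubdiv.exists_setup hP hlam
  rw [← hSQ] at hQ
  subst hQ
  have main : ∀ r : MixSubdiv.Placement S.Q S.P, ∀ ψ, MixSubdiv.IsAdapted r ψ →
      ∃ N₀ : ℝ, ∀ N : ℝ, N₀ ≤ N →
        MixSubdiv.IsPLConcaveOn S.Q
          (fun x => N * ψ x + MixSubdiv.tildeFun r (MixSubdiv.heightFun S.P nu) x) ∧
        MixSubdiv.CombIso
          (MixSubdiv.boundaryCoherentCells S.Q
            (fun x => N * ψ x + MixSubdiv.tildeFun r (MixSubdiv.heightFun S.P nu) x))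
          (MixSubdiv.restrictedProductCells S.P lam nu) := by
    intro r ψ hψ
    obtain ⟨N₀, h⟩ := Filter.eventually_atTop.1
      (MixSubdiv.Setup.eventually_coherentCells hψ nu)
    exact ⟨N₀, fun N hN => ⟨(h N hN).1, MixSubdiv.Setup.combIso_boundary (h N hN).2 hbd⟩⟩
  -- The bare existence statement follows from the precise one with `N = N₀`, for any placement and
  -- any adapted `ψ`.
  refine ⟨?_, S.nonempty_placement, fun r => ⟨MixSubdiv.Setup.exists_isAdapted r, main r⟩⟩
  obtain ⟨r⟩ := S.nonempty_placement
  obtain ⟨ψ, hψ⟩ := MixSubdiv.Setup.exists_isAdapted r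
  obtain ⟨N₀, h⟩ := main r ψ hψ
  exact ⟨_, h N₀ le_rfl⟩
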